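/- Let $Z,Z_1,Z_2,\dots$ be i.i.d. random elements of a measurable space, $\mathcal D_n=\{Z_i\}_{i=1}^n$, let $\Theta\subset\mathbb R^d$ be a compact convex set, and let $m(z,\theta)$ be measurable in $z$ and twice continuously differentiable in $\theta$ on an open set containing $\Theta$, with gradient $\dot m$ and Hessian $\ddot m$ with respect to $\theta$. Let $\hat\theta_n$ be an estimator that is measurable with respect to $\mathcal D_n$ and almost surely maximizes $M_n(\theta)=n^{-1}\sum_{i=1}^n m(Z_i,\theta)$ over $\Theta$. For each $n\ge 1$ let $\pi_{n,1},\dots,\pi_{n,n}>0$ be functions of $\mathcal D_n$ with $\sum_{i=1}^n\pi_{n,i}=1$. Let $(s_n)$ be positive integers (for large $n$). Given $\mathcal D_n$, draw $s_n$ indices independently with replacement from $\{1,\dots,n\}$ with probabilities $\pi_{n,i}$; let $Z_j^*$ and $\pi_{n,j}^*$ ($j=1,\dots,s_n$) be the corresponding observations and probabilities, and let $\tilde\theta_{s_n,R}$ be a (measurable) estimator that almost surely maximizes $$\theta\mapsto\sum_{j=1}^{s_n}\frac{m(Z_j^*,\theta)}{n s_n\pi_{n,j}^*}$$ over $\Theta$.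 Assume: 1. The parameter $\theta$ ranges over the compact set $\Theta$. 2. For every $z$, $m(z,\cdot)$ is concave on $\Theta$; $E\{m^2(Z,\theta)\}<\infty$ for every $\theta\in\Theta$; and $\theta\mapsto E\{m(Z,\theta)\}$ has a unique maximizer $\theta_0$ over $\Theta$, which lies in the interior of $\Theta$. 3. $-E\{\ddot m(Z,\theta_0)\}$ is positive definite; $E\{\ddot m_{k,l}^2(Z,\theta)\}<\infty$ for all $\theta\in\Theta$ and $k,l=1,\dots,d$; and there is a function $\psi$ with $E\{\psi^2(Z)\}<\infty$ such that $|\ddot m_{k,l}(z,\theta_1)-\ddot m_{k,l}(z,\theta_2)|\le\psi(z)\|\theta_1-\theta_2\|$ for all $z$, all $\theta_1,\theta_2\in\Theta$ and all $k,l$. 4. $E\|\dot m(Z,\theta_0)\|^2<\infty$, $E\{\dot m(Z,\theta_0)\dot m^{\mathsf T}(Z,\theta_0)\}$ is positive definite, and $n^{-1}\sum_{i=1}^n\|\dot m(Z_i,\hat\theta_n)\|^4=O_P(1)$. 5. $\max_{1\le i\le n}(n\pi_{n,i})^{-1}=O_P(1)$. For $\theta\in\Theta$ put $$\ddot M_n(\theta)=\frac1n\sum_{i=1}^n\ddot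 m(Z_i,\theta),\qquad \Lambda_{n,R}(\theta)=\frac1{n^2}\sum_{i=1}^n\frac{\dot m(Z_i,\theta)\dot m^{\mathsf T}(Z_i,\theta)}{\pi_{n,i}},\qquad V_{n,R}(\theta)=\ddot M_n^{-1}(\theta)\Lambda_{n,R}(\theta)\ddot M_n^{-1}(\theta).$$ Then, as $n\to\infty$ and $s_n\to\infty$, given $\mathcal D_n$ in probability, $\sqrt{s_n}\,\{V_{n,R}(\hat\theta_n)\}^{-1/2}(\tilde\theta_{s_n,R}-\hat\theta_n)$ converges in conditional distribution to $N(0,I_d)$; that is, for every $x\in\mathbb R^d$, with componentwise inequalities and $U\sim N(0,I_d)$, $$\Pr\Big(\sqrt{s_n}\,\{V_{n,R}(\hat\theta_n)\}^{-1/2}(\tilde\theta_{s_n,R}-\hat\theta_n)\le x\,\Big|\,\mathcal D_n\Big)-\Pr(U\le x)\longrightarrow 0\quad\text{in probability.}$$ -/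

import Mathlib

open MeasureTheory ProbabilityTheory Filter Topology
open scoped ENNReal MatrixOrder

noncomputable section

namespace Subsampling

/-- The Euclidean space `ℝ^d`. -/
abbrev Vec (d : ℕ) : Type := EuclideanSpace ℝ (Fin d)

variable {d : ℕ} {Ω 𝓩 : Type*}

/-- Boundedness in probability, `X n = O_P(1)` as `n → ∞`. -/
def BoundedInProb [MeasurableSpace Ω] (P : Measure Ω) (X : ℕ → Ω → ℝ) : Prop :=
  ∀ ε : ℝ≥0∞, 0 < ε → ∃ K : ℝ, ∀ᶠ n in atTop, P {ω | K < |X n ω|} ≤ ε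

/-- `θ` is a maximizer of `f` over the parameter set `Θ`. -/
def IsArgmax (f : Vec d → ℝ) (Θ : Set (Vec d)) (θ : Vec d) : Prop :=
  θ ∈ Θ ∧ IsMaxOn f Θ θ

/-- `θ` is the unique maximizer of `f` over the parameter set `Θ`. -/
def IsUniqueArgmax (f : Vec d → ℝ) (Θ : Set (Vec d)) (θ : Vec d) : Prop :=
  θ ∈ Θ ∧ ∀ η ∈ Θ, η ≠ θ → f η < f θ

/-- The gradient of `m z` with respect to the parameter. -/
def grad (m : 𝓩 → Vec d → ℝ) (z : 𝓩) (θ : Vec d) : Vec d := gradient (m z) θ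

/-- The Hessian matrix of `m z` with respect to the parameter. -/
def hess (m : 𝓩 → Vec d → ℝ) (z : 𝓩) (θ : Vec d) : Matrix (Fin d) (Fin d) ℝ :=
  Matrix.of fun k l =>
    fderiv ℝ (fderiv ℝ (m z)) θ (EuclideanSpace.single k 1) (EuclideanSpace.single l 1)

/-- The outer product `v vᵀ`. -/
def outer (v : Vec d) : Matrix (Fin d) (Fin d) ℝ := Matrix.of fun k l => v k * v l

/-- The population target `θ ↦ E m(Z, θ)`, where `μ` is the law of `Z`. -/
def popObjective [MeasurableSpace 𝓩] (μ : Measure 𝓩) (m : 𝓩 → Vec d → ℝ) (θ : Vec d) : ℝ :=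
  ∫ z, m z θ ∂μ

/-- The matrix of the expectations of the entries of the Hessian. -/
def popHess [MeasurableSpace 𝓩] (μ : Measure 𝓩) (m : 𝓩 → Vec d → ℝ) (θ : Vec d) :
    Matrix (Fin d) (Fin d) ℝ :=
  Matrix.of fun k l => ∫ z, hess m z θ k l ∂μ

/-- The second-moment matrix of the gradient. -/
def popLambda [MeasurableSpace 𝓩] (μ : Measure 𝓩) (m : 𝓩 → Vec d → ℝ) (θ : Vec d) :
    Matrix (Fin d) (Fin d) ℝ :=
  Matrix.of fun k l => ∫ z, outer (grad m z θ) k l ∂μ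

/-- The σ-algebra generated by the full data `Z 0, …, Z (n - 1)`. -/
abbrev dataSigma [MeasurableSpace 𝓩] (Z : ℕ → Ω → 𝓩) (n : ℕ) : MeasurableSpace Ω :=
  MeasurableSpace.comap (fun ω (i : Fin n) => Z i ω) inferInstance

/-- The full-data target function. -/
def fullObjective (m : 𝓩 → Vec d → ℝ) (Z : ℕ → Ω → 𝓩) (n : ℕ) (ω : Ω) (θ : Vec d) : ℝ :=
  (n : ℝ)⁻¹ * ∑ i : Fin n, m (Z i ω) θ

/-- The average of the Hessians over the full data. -/
def fullHess (m : 𝓩 → Vec d → ℝ) (Z : ℕ → Ω → 𝓩) (n : ℕ) (ω : Ω) (θ : Vec d) :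
    Matrix (Fin d) (Fin d) ℝ :=
  (n : ℝ)⁻¹ • ∑ i : Fin n, hess m (Z i ω) θ

/-- `π n` is a subsampling distribution on `{0, …, n - 1}` with positive weights, computed from
the full data of size `n`. -/
def IsSubsamplingDistribution [MeasurableSpace 𝓩] (Z : ℕ → Ω → 𝓩) (π : ℕ → ℕ → Ω → ℝ) : Prop :=
  ∀ n, 0 < n →
    (∀ i < n, Measurable[dataSigma Z n] (π n i)) ∧
    (∀ i < n, ∀ ω, 0 < π n i ω) ∧
    ∀ ω, ∑ i : Fin n, π n i ω = 1

/-- Subsampling with replacement: conditionally on the full data of size `n`, the indices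
`J n 0, …, J n (s n - 1)` are independent draws from the distribution `π n`. -/
def IsSubsampleWithReplacement [MeasurableSpace Ω] [MeasurableSpace 𝓩] (P : Measure Ω)
    (Z : ℕ → Ω → 𝓩) (π : ℕ → ℕ → Ω → ℝ) (s : ℕ → ℕ) (J : (n : ℕ) → Fin (s n) → Ω → ℕ) : Prop :=
  ∀ n, 0 < n →
    (∀ j, Measurable (J n j)) ∧
    ∀ k : Fin (s n) → Fin n,
      P⟦{ω | ∀ j, J n j ω = k j} | dataSigma Z n⟧ =ᵐ[P] fun ω => ∏ j, π n (k j) ω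

/-- The inverse-probability weighted subsample target function. -/
def subObjective (m : 𝓩 → Vec d → ℝ) (Z : ℕ → Ω → 𝓩) (π : ℕ → ℕ → Ω → ℝ) (s : ℕ → ℕ)
    (J : (n : ℕ) → Fin (s n) → Ω → ℕ) (n : ℕ) (ω : Ω) (θ : Vec d) : ℝ :=
  ∑ j : Fin (s n), m (Z (J n j ω) ω) θ / (n * s n * π n (J n j ω) ω)

/-- The matrix `Λ_{n,R}(θ)`. -/
def lambdaR (m : 𝓩 → Vec d → ℝ) (Z : ℕ → Ω → 𝓩) (π : ℕ → ℕ → Ω → ℝ) (n : ℕ) (ω : Ω)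
    (θ : Vec d) : Matrix (Fin d) (Fin d) ℝ :=
  ((n : ℝ) ^ 2)⁻¹ • ∑ i : Fin n, (π n i ω)⁻¹ • outer (grad m (Z i ω) θ)

/-- The matrix `V_{n,R}(θ)`. -/
def varianceR (m : 𝓩 → Vec d → ℝ) (Z : ℕ → Ω → 𝓩) (π : ℕ → ℕ → Ω → ℝ) (n : ℕ) (ω : Ω)
    (θ : Vec d) : Matrix (Fin d) (Fin d) ℝ :=
  (fullHess m Z n ω θ)⁻¹ * lambdaR m Z π n ω θ * (fullHess m Z n ω θ)⁻¹

/-- The inverse square root `V^{-1/2}` of a positive-definite matrix. -/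
def invSqrt (V : Matrix (Fin d) (Fin d) ℝ) : Matrix (Fin d) (Fin d) ℝ := (CFC.sqrt V)⁻¹

/-- The standardized subsampling error `√s_n V_{n,R}(θ̂_n)^{-1/2} (θ̃ - θ̂_n)`. -/
def standardizedError (m : 𝓩 → Vec d → ℝ) (Z : ℕ → Ω → 𝓩) (π : ℕ → ℕ → Ω → ℝ) (s : ℕ → ℕ)
    (θhat θtilde : ℕ → Ω → Vec d) (n : ℕ) (ω : Ω) : Vec d :=
  √(s n : ℝ) •
    Matrix.toEuclideanLin (invSqrt (varianceR m Z π n ω (θhat n ω))) (θtilde n ω - θhat n ω)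

/-- Convergence in conditional distribution to `ν`, given the full data in probability:
`Pr(Δ_n ≤ x | D_n) - ν(y ≤ x) = o_P(1)` for every `x`, with componentwise inequalities. -/
def TendstoInCondDistribution [MeasurableSpace Ω] [MeasurableSpace 𝓩] (P : Measure Ω)
    (Z : ℕ → Ω → 𝓩) (Δ : ℕ → Ω → Vec d) (ν : Measure (Vec d)) : Prop :=
  ∀ x : Vec d,
    TendstoInMeasure P (fun n => P⟦{ω | ∀ k, Δ n ω k ≤ x k} | dataSigma Z n⟧) atTop
      (fun _ => ν.real {y | ∀ k, y k ≤ x k})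

end Subsampling

end

open Subsampling

/-!
The proof linearizes the subsample estimator, and then applies a central limit theorem conditionally
on the data.

Statements that hold with probability tending to one are phrased through a filter `whp P` on
`ℕ × Ω`: a random sequence `X` tends to `a` in probability if and only if
`fun p => X p.1 p.2` tends to `a` along `whp P`. Limits in probability can then be combined by the
usual calculus of limits along a filter.

*Linearization.* If a concave function on `Θ` is, near a point `c`, within
`o(r²)` of the quadratic with gradient `S` and negative definite Hessian `H` at `c`, then its
maximizer lies within `r` of the Newton step `c - H⁻¹ S`: on the sphere of radius `r` around that
step the function is smaller than at its centre, and by concavity this persists outside the sphere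
(`norm_argmax_weighted_sum_sub_le`). No compactness argument or uniform law of large numbers is
needed. Applied to the full data around `θ₀`, this gives consistency of `θ̂`
(`FullDataModel.tendsto_norm_estimator_sub`). Applied to the weighted subsample around `θ̂` with
`r` of order `s^{-1/2}`, it gives `θ̃ - θ̂ = -H₀⁻¹ S* + o_P(s^{-1/2})`, where `S*` is the weighted
subsample average of the gradients at `θ̂` and `H₀` the population Hessian
(`SubsamplingModel.tendsto_sqrt_mul_norm_sub_newton`). The required control of the weighted
subsample averages comes from the conditional Chebyshev inequality, since their conditional variance
is at most `s⁻¹ · max (n π)⁻¹` times a mean square over the full data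
(`boundedInProb_sqrt_mul_subMean_sub`). The full-data average of the gradients vanishes at `θ̂` as
soon as `θ̂` is an interior point.

*Standardization.* The smallest eigenvalue of `Λ` is bounded away from zero in probability, although
nothing is assumed about upper bounds for the weights `π`: since the weights sum up to one, a large
weight can only affect few observations, and the fourth moment of the gradients controls the mass
which those carry (`norm_sq_le_weighted_sum`). Hence `B = V^{-1/2} M̈⁻¹` is bounded in probability and
`B Λ Bᵀ = 1` (`SubsamplingModel.exists_eventually_standardizer`), and the standardized error equals
`W = -√s B S*` up to `o_P(1)` (`SubsamplingModel.tendsto_norm_standardizedError_sub`).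

*Conditional limit.* Given the data, `W` is `s^{-1/2}` times a sum of `s` independent terms with
mean zero and identity covariance, so its conditional law is an explicit finite sum of point masses,
`scaledSumLaw`. For such laws a Lyapunov-type central limit theorem holds uniformly
(`exists_lyapunov_bound`); it comes from characteristic functions by way of contradiction, which
turns the convergence statement into a bound that can be applied for each value of the data
separately. The event that the standardized error lies below `x` is squeezed between the events that
`W` lies below `x ± δ`, up to an event of small probability, and the Gaussian distribution function
is continuous (`exists_stdGaussian_orthant_shift`).
-/

namespace Subsampling

/-! ### A central limit theorem for triangular arrays of finitely supported laws -/

lemma norm_exp_mul_I_taylor_two_le (y : ℝ) :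
    ‖Complex.exp (y * Complex.I) - (1 + y * Complex.I - y ^ 2 / 2)‖ ≤ 4 * |y| ^ 3 := by
  rcases le_total |y| 1 with h | h
  · have h1 := Complex.norm_exp_sub_sum_le_norm_mul_exp (y * Complex.I) 3
    have h2 : ‖(y : ℂ) * Complex.I‖ = |y| := by simp
    rw [h2] at h1
    have h3 : ∑ m ∈ Finset.range 3, ((y : ℂ) * Complex.I) ^ m / (m.factorial : ℂ)
        = 1 + y * Complex.I - y ^ 2 / 2 := by
      simp only [Finset.sum_range_succ, Finset.sum_range_zero, mul_pow, Complex.I_sq]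
      norm_num [Nat.factorial]
      ring
    rw [h3] at h1
    have h4 : Real.exp |y| ≤ 4 := by
      have := Real.exp_le_exp.2 h
      have := Real.exp_one_lt_d9
      linarith
    have h5 : 0 ≤ |y| ^ 3 := by positivity
    nlinarith
  · have h1 : ‖Complex.exp (y * Complex.I)‖ = 1 := Complex.norm_exp_ofReal_mul_I y
    have h2 : ‖(1 : ℂ) + y * Complex.I - y ^ 2 / 2‖ ≤ 1 + |y| + |y| ^ 2 / 2 := by
      refine (norm_sub_le _ _).trans ?_
      refine add_le_add ((norm_add_le _ _).trans ?_) ?_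
      · simp
      · simp
    have h3 := norm_sub_le (Complex.exp (y * Complex.I)) (1 + y * Complex.I - y ^ 2 / 2)
    have h4 : |y| ≤ |y| ^ 3 := le_self_pow₀ h (by norm_num)
    have h5 : |y| ^ 2 ≤ |y| ^ 3 := pow_le_pow_right₀ h (by norm_num)
    nlinarith

lemma norm_pow_sub_pow_le_of_norm_le_one {a b : ℂ} (ha : ‖a‖ ≤ 1) (hb : ‖b‖ ≤ 1) (s : ℕ) :
    ‖a ^ s - b ^ s‖ ≤ s * ‖a - b‖ := by
  induction s with
  | zero => simp
  | succ s ih =>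
    have h : a ^ (s + 1) - b ^ (s + 1) = a * (a ^ s - b ^ s) + (a - b) * b ^ s := by ring
    rw [h]
    refine (norm_add_le _ _).trans ?_
    rw [norm_mul, norm_mul, norm_pow]
    have h1 : ‖a‖ * ‖a ^ s - b ^ s‖ ≤ 1 * (s * ‖a - b‖) := by gcongr
    have h2 : ‖a - b‖ * ‖b‖ ^ s ≤ ‖a - b‖ * 1 := by
      gcongr
      exact pow_le_one₀ (norm_nonneg _) hb
    push_cast
    linarith

lemma abs_exp_neg_sub_le {x : ℝ} (hx : 0 ≤ x) : |Real.exp (-x) - (1 - x)| ≤ x ^ 2 := by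
  have h1 : 1 - x ≤ Real.exp (-x) := by have := Real.add_one_le_exp (-x); linarith
  rw [abs_of_nonneg (by linarith)]
  rcases le_total x 1 with h | h
  · have h2 := Real.abs_exp_sub_one_sub_id_le (x := -x) (by rw [abs_neg, abs_of_nonneg hx]; exact h)
    have h3 := (abs_le.1 h2).2
    nlinarith
  · have : Real.exp (-x) ≤ 1 := Real.exp_le_one_iff.2 (by linarith)
    nlinarith

/-- The law of `s^{-1/2} ∑ j, v (k j)` when `k 0, …, k (s - 1)` are independent draws from the
distribution `p` on `Fin n`. -/
noncomputable def scaledSumLaw {d n : ℕ} (s : ℕ) (p : Fin n → ℝ) (v : Fin n → Vec d) :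
    Measure (Vec d) :=
  ∑ k : Fin s → Fin n, ENNReal.ofReal (∏ j, p (k j)) •
    Measure.dirac ((√(s : ℝ))⁻¹ • ∑ j, v (k j))

section

variable {d n s : ℕ} {p : Fin n → ℝ} {v : Fin n → Vec d}

lemma sum_prod_eq_one (hp1 : ∑ i, p i = 1) : ∑ k : Fin s → Fin n, ∏ j, p (k j) = 1 := by
  have := Finset.prod_univ_sum (fun _ : Fin s => (Finset.univ : Finset (Fin n))) (fun _ i => p i)
  simp only [hp1, Finset.prod_const_one, Fintype.piFinset_univ] at this
  exact this.symm

lemma isProbabilityMeasure_scaledSumLaw (hp : ∀ i, 0 ≤ p i) (hp1 : ∑ i, p i = 1) :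
    IsProbabilityMeasure (scaledSumLaw s p v) := by
  constructor
  simp only [scaledSumLaw, Measure.coe_finsetSum, Finset.sum_apply, Measure.smul_apply,
    measure_univ, smul_eq_mul, mul_one]
  rw [← ENNReal.ofReal_sum_of_nonneg (fun k _ => Finset.prod_nonneg fun j _ => hp _),
    sum_prod_eq_one hp1, ENNReal.ofReal_one]

lemma scaledSumLaw_real_apply (hp : ∀ i, 0 ≤ p i) {A : Set (Vec d)} (hA : MeasurableSet A) :
    (scaledSumLaw s p v).real A = ∑ k : Fin s → Fin n, (∏ j, p (k j)) *
      A.indicator (fun _ => (1 : ℝ)) ((√(s : ℝ))⁻¹ • ∑ j, v (k j)) := by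
  simp only [scaledSumLaw, Measure.real, Measure.coe_finsetSum, Finset.sum_apply,
    Measure.smul_apply, smul_eq_mul, Measure.dirac_apply' _ hA]
  rw [ENNReal.toReal_sum]
  · refine Finset.sum_congr rfl fun k _ => ?_
    rw [ENNReal.toReal_mul, ENNReal.toReal_ofReal (Finset.prod_nonneg fun j _ => hp _)]
    by_cases h : (√(s : ℝ))⁻¹ • ∑ j, v (k j) ∈ A <;> simp [h]
  · intro k _
    by_cases h : (√(s : ℝ))⁻¹ • ∑ j, v (k j) ∈ A <;> simp [h]

lemma charFun_scaledSumLaw (hp : ∀ i, 0 ≤ p i) (t : Vec d) :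
    charFun (scaledSumLaw s p v) t =
      (∑ i, (p i : ℂ) * Complex.exp (((√(s : ℝ))⁻¹ * inner ℝ (v i) t : ℝ) * Complex.I)) ^ s := by
  rw [charFun_apply, scaledSumLaw, integral_finsetSum_measure]
  · simp only [integral_smul_measure, integral_dirac]
    have := Finset.prod_univ_sum (fun _ : Fin s => (Finset.univ : Finset (Fin n)))
      (fun _ i => (p i : ℂ) * Complex.exp (((√(s : ℝ))⁻¹ * inner ℝ (v i) t : ℝ) * Complex.I))
    rw [Finset.prod_const, Finset.card_univ, Fintype.card_fin, Fintype.piFinset_univ] at this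
    rw [this]
    refine Finset.sum_congr rfl fun k _ => ?_
    rw [ENNReal.toReal_ofReal (Finset.prod_nonneg fun j _ => hp _), Finset.prod_mul_distrib,
      ← Complex.exp_sum, ← Finset.sum_mul, inner_smul_left, sum_inner, Complex.real_smul]
    push_cast
    rw [Finset.mul_sum]
    simp
  · intro k _
    refine Integrable.smul_measure ?_ ENNReal.ofReal_ne_top
    exact integrable_dirac (by simp)

/-- A Lyapunov-type bound for the characteristic function of a normalized sum of independent
draws from a standardized finitely supported law. -/
lemma norm_charFun_scaledSumLaw_sub_le (hs : 0 < s) (hp : ∀ i, 0 ≤ p i) (hp1 : ∑ i, p i = 1)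
    (hmean : ∑ i, p i • v i = 0) (hcov : ∀ t : Vec d, ∑ i, p i * inner ℝ (v i) t ^ 2 = ‖t‖ ^ 2)
    {δ : ℝ} (hδ : 0 < δ) (hsδ : (s : ℝ)⁻¹ ≤ δ) (hfour : ∑ i, p i * ‖v i‖ ^ 4 ≤ δ * s)
    (t : Vec d) :
    ‖charFun (scaledSumLaw s p v) t - charFun (stdGaussian (Vec d)) t‖ ≤
      2 * √δ * (‖t‖ ^ 2 + ‖t‖ ^ 4) + δ * ‖t‖ ^ 4 := by
  have hs' : (0 : ℝ) < s := by exact_mod_cast hs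
  rw [charFun_scaledSumLaw hp, charFun_stdGaussian]
  set y : Fin n → ℝ := fun i => (√(s : ℝ))⁻¹ * inner ℝ (v i) t with hy
  set φ : ℂ := ∑ i, (p i : ℂ) * Complex.exp ((y i : ℝ) * Complex.I) with hφ
  set b : ℝ := Real.exp (-(‖t‖ ^ 2 / (2 * s))) with hb
  have hbs : Complex.exp (-(‖t‖ : ℂ) ^ 2 / 2) = (b : ℂ) ^ s := by
    rw [hb, Complex.ofReal_exp, ← Complex.exp_nat_mul]
    have hsC : (s : ℂ) ≠ 0 := by exact_mod_cast hs.ne'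
    push_cast
    congr 1
    field_simp
  rw [hbs]
  have hφ1 : ‖φ‖ ≤ 1 := by
    refine (norm_sum_le _ _).trans ?_
    rw [← hp1]
    refine Finset.sum_le_sum fun i _ => ?_
    rw [norm_mul, Complex.norm_exp_ofReal_mul_I, mul_one, Complex.norm_real, Real.norm_eq_abs,
      abs_of_nonneg (hp i)]
  have hb1 : ‖(b : ℂ)‖ ≤ 1 := by
    rw [Complex.norm_real, Real.norm_eq_abs, hb, abs_of_pos (Real.exp_pos _)]
    exact Real.exp_le_one_iff.2 (by rw [neg_nonpos]; positivity)
  refine (norm_pow_sub_pow_le_of_norm_le_one hφ1 hb1 s).trans ?_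
  have hsq : ((√(s : ℝ))⁻¹) ^ 2 = (s : ℝ)⁻¹ := by rw [inv_pow, Real.sq_sqrt hs'.le]
  have hy1 : ∑ i, p i * y i = 0 := by
    have : ∑ i, p i * y i = (√(s : ℝ))⁻¹ * inner ℝ (∑ i, p i • v i) t := by
      rw [sum_inner, Finset.mul_sum]
      refine Finset.sum_congr rfl fun i _ => ?_
      rw [inner_smul_left, hy]; simp; ring
    rw [this, hmean, inner_zero_left, mul_zero]
  have hy2 : ∑ i, p i * y i ^ 2 = ‖t‖ ^ 2 / s := by
    rw [← hcov t, Finset.sum_div]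
    refine Finset.sum_congr rfl fun i _ => ?_
    rw [hy]; simp only [mul_pow, hsq]; field_simp
  have hy4 : ∑ i, p i * y i ^ 4 ≤ δ * ‖t‖ ^ 4 / s := by
    have : ∑ i, p i * y i ^ 4 ≤ ∑ i, (p i * ‖v i‖ ^ 4) * (‖t‖ ^ 4 / s ^ 2) := by
      refine Finset.sum_le_sum fun i _ => ?_
      have h1 : y i ^ 4 = (s : ℝ)⁻¹ ^ 2 * inner ℝ (v i) t ^ 4 := by
        rw [← hsq, hy]; ring
      have h2 : inner ℝ (v i) t ^ 4 ≤ (‖v i‖ * ‖t‖) ^ 4 := by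
        have h3 := abs_real_inner_le_norm (v i) t
        have h4 : inner ℝ (v i) t ^ 4 = |inner ℝ (v i) t| ^ 4 :=
          ((by decide : Even 4).pow_abs _).symm
        rw [h4]; gcongr
      rw [h1, mul_assoc]
      refine mul_le_mul_of_nonneg_left ?_ (hp i)
      calc (s : ℝ)⁻¹ ^ 2 * inner ℝ (v i) t ^ 4 ≤ (s : ℝ)⁻¹ ^ 2 * (‖v i‖ * ‖t‖) ^ 4 := by gcongr
        _ = _ := by field_simp
    refine this.trans ?_
    rw [← Finset.sum_mul]
    calc (∑ i, p i * ‖v i‖ ^ 4) * (‖t‖ ^ 4 / s ^ 2) ≤ (δ * s) * (‖t‖ ^ 4 / s ^ 2) := by gcongr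
      _ = _ := by field_simp
  -- the third absolute moment is interpolated between the second and the fourth one
  have hy3 : ∑ i, p i * |y i| ^ 3 ≤ √δ / 2 * (‖t‖ ^ 2 + ‖t‖ ^ 4) / s := by
    have hsδ0 : 0 < √δ := Real.sqrt_pos.2 hδ
    have h1 : ∀ i, p i * |y i| ^ 3 ≤ √δ / 2 * (p i * y i ^ 2) + (2 * √δ)⁻¹ * (p i * y i ^ 4) := by
      intro i
      have h2 : |y i| ^ 3 ≤ √δ / 2 * y i ^ 2 + (2 * √δ)⁻¹ * y i ^ 4 := by
        have h3 : y i ^ 2 = |y i| ^ 2 := (sq_abs _).symm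
        have h4 : y i ^ 4 = |y i| ^ 4 := ((by decide : Even 4).pow_abs _).symm
        rw [h3, h4, ← sub_nonneg]
        have : √δ / 2 * |y i| ^ 2 + (2 * √δ)⁻¹ * |y i| ^ 4 - |y i| ^ 3
            = (2 * √δ)⁻¹ * (|y i| * (√δ - |y i|)) ^ 2 := by field_simp; ring
        rw [this]; positivity
      have := mul_le_mul_of_nonneg_left h2 (hp i)
      linarith
    refine (Finset.sum_le_sum fun i _ => h1 i).trans ?_
    rw [Finset.sum_add_distrib, ← Finset.mul_sum, ← Finset.mul_sum, hy2]
    have h5 : (2 * √δ)⁻¹ * ∑ i, p i * y i ^ 4 ≤ (2 * √δ)⁻¹ * (δ * ‖t‖ ^ 4 / s) := by gcongr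
    have h6 : (2 * √δ)⁻¹ * (δ * ‖t‖ ^ 4 / s) = √δ / 2 * (‖t‖ ^ 4 / s) := by
      have : δ = √δ * √δ := (Real.mul_self_sqrt hδ.le).symm
      field_simp
      rw [Real.sq_sqrt hδ.le]
    rw [h6] at h5
    calc _ ≤ √δ / 2 * (‖t‖ ^ 2 / s) + √δ / 2 * (‖t‖ ^ 4 / s) := by linarith
      _ = _ := by ring
  have hφb : ‖φ - ((1 - ‖t‖ ^ 2 / (2 * s) : ℝ) : ℂ)‖ ≤ 4 * ∑ i, p i * |y i| ^ 3 := by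
    have h1 : ((1 - ‖t‖ ^ 2 / (2 * s) : ℝ) : ℂ)
        = ∑ i, (p i : ℂ) * (1 + y i * Complex.I - (y i : ℂ) ^ 2 / 2) := by
      have e1 : ∑ i, (p i : ℂ) * (1 + y i * Complex.I - (y i : ℂ) ^ 2 / 2)
          = ((∑ i, p i : ℝ) : ℂ) + ((∑ i, p i * y i : ℝ) : ℂ) * Complex.I
            - ((∑ i, p i * y i ^ 2 : ℝ) : ℂ) / 2 := by
        push_cast
        rw [Finset.sum_mul, Finset.sum_div, ← Finset.sum_add_distrib, ← Finset.sum_sub_distrib]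
        exact Finset.sum_congr rfl fun i _ => by ring
      rw [e1, hp1, hy1, hy2]
      push_cast
      field_simp
      ring
    rw [h1, hφ, ← Finset.sum_sub_distrib, Finset.mul_sum]
    refine (norm_sum_le _ _).trans (Finset.sum_le_sum fun i _ => ?_)
    rw [← mul_sub, norm_mul, Complex.norm_real, Real.norm_eq_abs, abs_of_nonneg (hp i)]
    have := mul_le_mul_of_nonneg_left (norm_exp_mul_I_taylor_two_le (y i)) (hp i)
    linarith
  have hbb : ‖(b : ℂ) - ((1 - ‖t‖ ^ 2 / (2 * s) : ℝ) : ℂ)‖ ≤ (‖t‖ ^ 2 / (2 * s)) ^ 2 := by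
    rw [← Complex.ofReal_sub, Complex.norm_real, Real.norm_eq_abs]
    exact abs_exp_neg_sub_le (by positivity)
  have htot : ‖φ - b‖ ≤ 2 * √δ * (‖t‖ ^ 2 + ‖t‖ ^ 4) / s + (‖t‖ ^ 2 / (2 * s)) ^ 2 := by
    have h1 : ‖φ - b‖ ≤ ‖φ - ((1 - ‖t‖ ^ 2 / (2 * s) : ℝ) : ℂ)‖ +
        ‖(b : ℂ) - ((1 - ‖t‖ ^ 2 / (2 * s) : ℝ) : ℂ)‖ := by
      rw [norm_sub_rev (b : ℂ)]; exact norm_sub_le_norm_sub_add_norm_sub _ _ _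
    have h2 : 4 * (√δ / 2 * (‖t‖ ^ 2 + ‖t‖ ^ 4) / s)
      = 2 * √δ * (‖t‖ ^ 2 + ‖t‖ ^ 4) / s := by ring
    linarith
  calc (s : ℝ) * ‖φ - b‖
      ≤ s * (2 * √δ * (‖t‖ ^ 2 + ‖t‖ ^ 4) / s + (‖t‖ ^ 2 / (2 * s)) ^ 2) := by gcongr
    _ = 2 * √δ * (‖t‖ ^ 2 + ‖t‖ ^ 4) + (s : ℝ)⁻¹ * (‖t‖ ^ 4 / 4) := by field_simp; ring
    _ ≤ 2 * √δ * (‖t‖ ^ 2 + ‖t‖ ^ 4) + δ * ‖t‖ ^ 4 := by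
      gcongr
      have : 0 ≤ ‖t‖ ^ 4 := by positivity
      linarith

end

lemma measurableSet_orthant {d : ℕ} (x : Vec d) : MeasurableSet {y : Vec d | ∀ k, y k ≤ x k} := by
  simp only [Set.ofPred_forall]
  exact MeasurableSet.iInter fun k => measurableSet_le (by fun_prop) (by fun_prop)

lemma stdGaussian_hyperplane {d : ℕ} (k : Fin d) (c : ℝ) :
    stdGaussian (Vec d) {y | y k = c} = 0 := by
  have h := measurePreserving_eval_multivariateGaussian (μ := (0 : Vec d))
    (S := (1 : Matrix (Fin d) (Fin d) ℝ)) Matrix.PosSemidef.one (i := k)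
  rw [multivariateGaussian_zero_one] at h
  have h2 := h.measure_preimage (s := {c}) (measurableSet_singleton c).nullMeasurableSet
  have h3 : gaussianReal ((0 : Vec d) k) (Real.toNNReal ((1 : Matrix (Fin d) (Fin d) ℝ) k k)) {c}
      = 0 := by
    have := nullSingletonClass_gaussianReal (μ := (0 : Vec d) k)
      (v := Real.toNNReal ((1 : Matrix (Fin d) (Fin d) ℝ) k k)) (by simp)
    exact measure_singleton c
  rw [h3] at h2
  exact h2

lemma stdGaussian_exists_eq {d : ℕ} (x : Vec d) :
    stdGaussian (Vec d) {y | ∃ k, y k = x k} = 0 := by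
  rw [Set.ofPred_exists]
  exact measure_iUnion_null fun k => stdGaussian_hyperplane k _

lemma stdGaussian_frontier_orthant {d : ℕ} (x : Vec d) :
    stdGaussian (Vec d) (frontier {y | ∀ k, y k ≤ x k}) = 0 := by
  refine measure_mono_null ?_ (stdGaussian_exists_eq x)
  have hcl : IsClosed {y : Vec d | ∀ k, y k ≤ x k} := by
    simp only [Set.ofPred_forall]
    exact isClosed_iInter fun k => isClosed_le (by fun_prop) (by fun_prop)
  have hop : IsOpen {y : Vec d | ∀ k, y k < x k} := by
    simp only [Set.ofPred_forall]
    exact isOpen_iInter_of_finite fun k => isOpen_lt (by fun_prop) (by fun_prop)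
  intro y hy
  rw [hcl.frontier_eq] at hy
  by_contra hne
  refine hy.2 (interior_maximal (fun z hz k => (hz k).le) hop (fun k => ?_))
  exact lt_of_le_of_ne (hy.1 k) fun h => hne ⟨k, h⟩

/-- A uniform central limit theorem: the distribution function, at a fixed point, of the
normalized sum of `s` independent draws from a standardized finitely supported law is close to the
Gaussian one as soon as `s⁻¹` and the Lyapunov ratio `s⁻¹ ∑ i, p i * ‖v i‖ ^ 4` are small. -/
theorem exists_lyapunov_bound {d : ℕ} (x : Vec d) {η : ℝ} (hη : 0 < η) :
    ∃ δ : ℝ, 0 < δ ∧ ∀ (n s : ℕ) (p : Fin n → ℝ) (v : Fin n → Vec d), 0 < s →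
      (∀ i, 0 ≤ p i) → ∑ i, p i = 1 → ∑ i, p i • v i = 0 →
      (∀ t : Vec d, ∑ i, p i * inner ℝ (v i) t ^ 2 = ‖t‖ ^ 2) →
      (s : ℝ)⁻¹ ≤ δ → ∑ i, p i * ‖v i‖ ^ 4 ≤ δ * s →
      |(scaledSumLaw s p v).real {y | ∀ k, y k ≤ x k} -
        (stdGaussian (Vec d)).real {y | ∀ k, y k ≤ x k}| ≤ η := by
  by_contra! hcon
  have hδ : ∀ N : ℕ, (0 : ℝ) < 1 / ((N : ℝ) + 1) := fun N => Nat.one_div_pos_of_nat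
  choose n s p v hs hp hp1 hmean hcov hsδ hfour hbad using fun N : ℕ => hcon _ (hδ N)
  let ν : ℕ → ProbabilityMeasure (Vec d) := fun N =>
    ⟨scaledSumLaw (s N) (p N) (v N), isProbabilityMeasure_scaledSumLaw (hp N) (hp1 N)⟩
  let γ : ProbabilityMeasure (Vec d) := ⟨stdGaussian (Vec d), inferInstance⟩
  have hconv : Tendsto ν atTop (𝓝 γ) := by
    refine ProbabilityMeasure.tendsto_of_tendsto_charFun fun t => ?_
    rw [tendsto_iff_norm_sub_tendsto_zero]
    refine squeeze_zero (fun _ => norm_nonneg _) (fun N => norm_charFun_scaledSumLaw_sub_le (hs N)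
      (hp N) (hp1 N) (hmean N) (hcov N) (hδ N) (hsδ N) (hfour N) t) ?_
    have h0 : Tendsto (fun N : ℕ => 1 / ((N : ℝ) + 1)) atTop (𝓝 0) :=
      tendsto_one_div_add_atTop_nhds_zero_nat
    have h1 : Tendsto (fun N : ℕ => √(1 / ((N : ℝ) + 1))) atTop (𝓝 0) := by
      have := (Real.continuous_sqrt.tendsto 0).comp h0
      rwa [Real.sqrt_zero] at this
    simpa using ((h1.const_mul 2).mul_const (‖t‖ ^ 2 + ‖t‖ ^ 4)).add (h0.mul_const (‖t‖ ^ 4))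
  have hm := ProbabilityMeasure.tendsto_measure_of_null_frontier_of_tendsto' hconv
    (E := {y | ∀ k, y k ≤ x k}) (stdGaussian_frontier_orthant x)
  have hr : Tendsto (fun N => (scaledSumLaw (s N) (p N) (v N)).real {y | ∀ k, y k ≤ x k}) atTop
      (𝓝 ((stdGaussian (Vec d)).real {y | ∀ k, y k ≤ x k})) :=
    (ENNReal.tendsto_toReal (measure_ne_top _ _)).comp hm
  obtain ⟨N, hN⟩ := ((Metric.tendsto_nhds.1 hr) η hη).exists
  exact absurd hN (not_lt.2 (hbad N).le)

/-- Continuity of the Gaussian distribution function along the diagonal direction. -/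
lemma exists_stdGaussian_orthant_shift {d : ℕ} (x : Vec d) {η : ℝ} (hη : 0 < η) :
    ∃ δ : ℝ, 0 < δ ∧
      (stdGaussian (Vec d)).real {y | ∀ k, y k ≤ x k + δ} ≤
        (stdGaussian (Vec d)).real {y | ∀ k, y k ≤ x k} + η ∧
      (stdGaussian (Vec d)).real {y | ∀ k, y k ≤ x k} - η ≤
        (stdGaussian (Vec d)).real {y | ∀ k, y k ≤ x k - δ} := by
  set γ := stdGaussian (Vec d)
  -- both shifted orthants differ from the unshifted one by part of a thin slab `|y k - x k| ≤ δ`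
  have hslab : Tendsto (fun N : ℕ => γ.real {y | ∃ k, |y k - x k| ≤ 1 / ((N : ℝ) + 1)}) atTop
      (𝓝 0) := by
    have hanti : Antitone fun N : ℕ => {y : Vec d | ∃ k, |y k - x k| ≤ 1 / ((N : ℝ) + 1)} := by
      rintro M N hMN y ⟨k, hk⟩
      exact ⟨k, hk.trans (one_div_le_one_div_of_le (by positivity) (by gcongr))⟩
    have hmeas : ∀ N : ℕ, MeasurableSet {y : Vec d | ∃ k, |y k - x k| ≤ 1 / ((N : ℝ) + 1)} := by
      intro N
      simp only [Set.ofPred_exists]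
      exact MeasurableSet.iUnion fun k => measurableSet_le (by fun_prop) (by fun_prop)
    have h := tendsto_measure_iInter_atTop (μ := γ) (fun N => (hmeas N).nullMeasurableSet) hanti
      ⟨0, measure_ne_top _ _⟩
    have hz : γ (⋂ N : ℕ, {y : Vec d | ∃ k, |y k - x k| ≤ 1 / ((N : ℝ) + 1)}) = 0 := by
      refine measure_mono_null ?_ (stdGaussian_exists_eq x)
      intro y hy
      rw [Set.mem_iInter] at hy
      by_contra hne
      have hpos : ∀ k, 0 < |y k - x k| := fun k =>
        abs_pos.2 (sub_ne_zero.2 fun h => hne ⟨k, h⟩)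
      have : ∀ᶠ N : ℕ in atTop, ∀ k, 1 / ((N : ℝ) + 1) < |y k - x k| :=
        eventually_all.2 fun k =>
          tendsto_one_div_add_atTop_nhds_zero_nat.eventually_lt_const (hpos k)
      obtain ⟨N, hN⟩ := this.exists
      obtain ⟨k, hk⟩ := hy N
      exact absurd hk (not_le.2 (hN k))
    rw [hz] at h
    exact (ENNReal.tendsto_toReal ENNReal.zero_ne_top).comp h
  obtain ⟨N, hN⟩ := (hslab.eventually_lt_const hη).exists
  have hδ : (0 : ℝ) < 1 / ((N : ℝ) + 1) := Nat.one_div_pos_of_nat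
  refine ⟨1 / ((N : ℝ) + 1), hδ, ?_, ?_⟩
  · refine (measureReal_mono (s₂ := {y | ∀ k, y k ≤ x k} ∪
      {y | ∃ k, |y k - x k| ≤ 1 / ((N : ℝ) + 1)}) ?_).trans
      ((measureReal_union_le _ _).trans (by linarith))
    intro y hy
    by_cases h : ∀ k, y k ≤ x k
    · exact Or.inl h
    · push Not at h
      obtain ⟨k, hk⟩ := h
      refine Or.inr ⟨k, ?_⟩
      rw [abs_of_pos (by linarith)]
      linarith [hy k]
  · rw [sub_le_iff_le_add]
    refine (measureReal_mono (s₂ := {y | ∀ k, y k ≤ x k - 1 / ((N : ℝ) + 1)} ∪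
      {y | ∃ k, |y k - x k| ≤ 1 / ((N : ℝ) + 1)}) ?_).trans
      ((measureReal_union_le _ _).trans (by linarith))
    intro y hy
    by_cases h : ∀ k, y k ≤ x k - 1 / ((N : ℝ) + 1)
    · exact Or.inl h
    · push Not at h
      obtain ⟨k, hk⟩ := h
      refine Or.inr ⟨k, ?_⟩
      have := hy k
      rw [abs_of_nonpos (by linarith)]
      linarith

/-! ### Matrices acting on Euclidean space -/

section Matrices

variable {d : ℕ}

open Matrix

lemma toEuclideanLin_apply_coord (A : Matrix (Fin d) (Fin d) ℝ) (u : Vec d) (k : Fin d) :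
    toEuclideanLin A u k = ∑ l, A k l * u l := by
  simp [Matrix.mulVec, dotProduct]

lemma toEuclideanLin_mul_apply (A B : Matrix (Fin d) (Fin d) ℝ) (u : Vec d) :
    toEuclideanLin (A * B) u = toEuclideanLin A (toEuclideanLin B u) := by
  simp

lemma toEuclideanLin_sub_apply (A B : Matrix (Fin d) (Fin d) ℝ) (u : Vec d) :
    toEuclideanLin (A - B) u = toEuclideanLin A u - toEuclideanLin B u := by
  rw [map_sub, LinearMap.sub_apply]

lemma toEuclideanLin_one_apply (u : Vec d) :
    toEuclideanLin (1 : Matrix (Fin d) (Fin d) ℝ) u = u := by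
  simp

lemma inner_toEuclideanLin (A : Matrix (Fin d) (Fin d) ℝ) (u v : Vec d) :
    inner ℝ u (toEuclideanLin A v) = ∑ k, ∑ l, A k l * (u k * v l) := by
  simp only [PiLp.inner_apply, toEuclideanLin_apply_coord, RCLike.inner_apply, conj_trivial,
    Finset.sum_mul]
  exact Finset.sum_congr rfl fun k _ => Finset.sum_congr rfl fun l _ => by ring

lemma inner_toEuclideanLin_transpose (A : Matrix (Fin d) (Fin d) ℝ) (u v : Vec d) :
    inner ℝ u (toEuclideanLin Aᵀ v) = inner ℝ (toEuclideanLin A u) v := by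
  rw [real_inner_comm v, inner_toEuclideanLin, inner_toEuclideanLin, Finset.sum_comm]
  exact Finset.sum_congr rfl fun k _ => Finset.sum_congr rfl fun l _ => by
    rw [Matrix.transpose_apply]; ring

lemma abs_coord_le_norm (u : Vec d) (k : Fin d) : |u k| ≤ ‖u‖ := by
  simpa using PiLp.norm_apply_le u k

lemma sum_abs_coord_sq_le (u : Vec d) : (∑ k, |u k|) ^ 2 ≤ d * ‖u‖ ^ 2 := by
  have h := sq_sum_le_card_mul_sum_sq (s := (Finset.univ : Finset (Fin d))) (f := fun k => |u k|)
  simpa [EuclideanSpace.real_norm_sq_eq] using h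

/-- A matrix with entries bounded by `κ` defines a bilinear form bounded by `d * κ`. -/
lemma abs_inner_toEuclideanLin_le {A : Matrix (Fin d) (Fin d) ℝ} {κ : ℝ}
    (hA : ∀ k l, |A k l| ≤ κ) (u v : Vec d) :
    |inner ℝ u (toEuclideanLin A v)| ≤ d * κ * (‖u‖ * ‖v‖) := by
  rcases Nat.eq_zero_or_pos d with rfl | hd
  · simp [Subsingleton.elim u 0]
  have hκ : 0 ≤ κ := (abs_nonneg _).trans (hA ⟨0, hd⟩ ⟨0, hd⟩)
  rw [inner_toEuclideanLin]
  have h1 : |∑ k, ∑ l, A k l * (u k * v l)| ≤ κ * ((∑ k, |u k|) * ∑ l, |v l|) := by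
    rw [Finset.sum_mul_sum, Finset.mul_sum]
    refine (Finset.abs_sum_le_sum_abs _ _).trans (Finset.sum_le_sum fun k _ => ?_)
    rw [Finset.mul_sum]
    refine (Finset.abs_sum_le_sum_abs _ _).trans (Finset.sum_le_sum fun l _ => ?_)
    rw [abs_mul, abs_mul]
    exact mul_le_mul_of_nonneg_right (hA k l) (by positivity)
  have h2 : (∑ k, |u k|) * (∑ l, |v l|) ≤ d * (‖u‖ * ‖v‖) := by
    refine le_of_sq_le_sq ?_ (by positivity)
    rw [mul_pow]
    calc (∑ k, |u k|) ^ 2 * (∑ l, |v l|) ^ 2 ≤ (d * ‖u‖ ^ 2) * (d * ‖v‖ ^ 2) :=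
          mul_le_mul (sum_abs_coord_sq_le u) (sum_abs_coord_sq_le v) (by positivity) (by positivity)
      _ = _ := by ring
  calc _ ≤ κ * (d * (‖u‖ * ‖v‖)) := h1.trans (mul_le_mul_of_nonneg_left h2 hκ)
    _ = _ := by ring

lemma norm_toEuclideanLin_le {A : Matrix (Fin d) (Fin d) ℝ} {κ : ℝ}
    (hA : ∀ k l, |A k l| ≤ κ) (u : Vec d) : ‖toEuclideanLin A u‖ ≤ d * κ * ‖u‖ := by
  rcases (norm_nonneg (toEuclideanLin A u)).eq_or_lt with h | h
  · rw [← h]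
    rcases Nat.eq_zero_or_pos d with rfl | hd
    · simp
    have hκ : 0 ≤ κ := (abs_nonneg _).trans (hA ⟨0, hd⟩ ⟨0, hd⟩)
    positivity
  · have h1 := (le_abs_self _).trans (abs_inner_toEuclideanLin_le hA (toEuclideanLin A u) u)
    rw [real_inner_self_eq_norm_sq] at h1
    nlinarith

lemma exists_entrywise_bound {α : Type*} {F : Filter α} {A : α → Matrix (Fin d) (Fin d) ℝ}
    {A₀ : Matrix (Fin d) (Fin d) ℝ} (h : ∀ k l, Tendsto (fun a => A a k l) F (𝓝 (A₀ k l))) :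
    ∃ κ : α → ℝ, (∀ a, 0 ≤ κ a) ∧ Tendsto κ F (𝓝 0) ∧ ∀ a k l, |A a k l - A₀ k l| ≤ κ a := by
  refine ⟨fun a => ∑ k, ∑ l, |A a k l - A₀ k l|, fun a => Finset.sum_nonneg fun _ _ =>
    Finset.sum_nonneg fun _ _ => abs_nonneg _, ?_, fun a k l => ?_⟩
  · have h1 : Tendsto (fun a => ∑ k, ∑ l, |A a k l - A₀ k l|) F
        (𝓝 (∑ _k : Fin d, ∑ _l : Fin d, |(0 : ℝ)|)) := by
      refine tendsto_finsetSum _ fun k _ => tendsto_finsetSum _ fun l _ => Tendsto.abs ?_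
      have h2 := (h k l).sub_const (A₀ k l)
      rwa [sub_self] at h2
    simpa using h1
  · exact (Finset.single_le_sum (f := fun l => |A a k l - A₀ k l|) (fun _ _ => abs_nonneg _)
      (Finset.mem_univ l)).trans
      (Finset.single_le_sum (f := fun k => ∑ l, |A a k l - A₀ k l|)
      (fun _ _ => Finset.sum_nonneg fun _ _ => abs_nonneg _) (Finset.mem_univ k))

lemma exists_norm_toEuclideanLin_le (A : Matrix (Fin d) (Fin d) ℝ) :
    ∃ C : ℝ, 0 < C ∧ ∀ u : Vec d, ‖toEuclideanLin A u‖ ≤ C * ‖u‖ := by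
  refine ⟨d * (∑ k, ∑ l, |A k l|) + 1, by positivity, fun u => ?_⟩
  have h : ∀ k l, |A k l| ≤ ∑ k, ∑ l, |A k l| := fun k l =>
    (Finset.single_le_sum (f := fun l => |A k l|) (fun _ _ => abs_nonneg _)
      (Finset.mem_univ l)).trans
    (Finset.single_le_sum (f := fun k => ∑ l, |A k l|)
      (fun _ _ => Finset.sum_nonneg fun _ _ => abs_nonneg _) (Finset.mem_univ k))
  refine (norm_toEuclideanLin_le h u).trans ?_
  have := norm_nonneg u
  nlinarith

lemma inner_toEuclideanLin_eq_dotProduct (A : Matrix (Fin d) (Fin d) ℝ) (u v : Vec d) :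
    inner ℝ u (toEuclideanLin A v) = u.ofLp ⬝ᵥ A *ᵥ v.ofLp := by
  rw [inner_toEuclideanLin]
  simp only [dotProduct, Matrix.mulVec, Finset.mul_sum]
  exact Finset.sum_congr rfl fun k _ => Finset.sum_congr rfl fun l _ => by ring

lemma continuous_toEuclideanLin (A : Matrix (Fin d) (Fin d) ℝ) :
    Continuous fun u : Vec d => toEuclideanLin A u :=
  LinearMap.continuous_of_finiteDimensional _

/-- A positive definite quadratic form is coercive. -/
lemma exists_coercive_of_posDef {A : Matrix (Fin d) (Fin d) ℝ} (hA : A.PosDef) :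
    ∃ c : ℝ, 0 < c ∧ ∀ u : Vec d, c * ‖u‖ ^ 2 ≤ inner ℝ u (toEuclideanLin A u) := by
  have hpos : ∀ u : Vec d, u ≠ 0 → 0 < inner ℝ u (toEuclideanLin A u) := by
    intro u hu
    rw [inner_toEuclideanLin_eq_dotProduct]
    have := hA.dotProduct_mulVec_pos (x := u.ofLp) (fun h => hu (by ext k; exact congrFun h k))
    simpa using this
  have hcont : Continuous fun u : Vec d => inner ℝ u (toEuclideanLin A u) :=
    continuous_id.inner (continuous_toEuclideanLin A)
  rcases (Metric.sphere (0 : Vec d) 1).eq_empty_or_nonempty with he | hne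
  · refine ⟨1, one_pos, fun u => ?_⟩
    have : u = 0 := by
      by_contra hu
      have : (‖u‖⁻¹ • u) ∈ Metric.sphere (0 : Vec d) 1 := by
        simp [norm_smul, inv_mul_cancel₀ (norm_ne_zero_iff.2 hu)]
      rw [he] at this
      exact this
    simp [this]
  · obtain ⟨w, hw, hmin⟩ := (isCompact_sphere (0 : Vec d) 1).exists_isMinOn hne hcont.continuousOn
    have hw1 : ‖w‖ = 1 := by simpa using hw
    refine ⟨_, hpos w (fun h => by simp [h] at hw1), fun u => ?_⟩
    rcases eq_or_ne u 0 with rfl | hu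
    · simp
    have hu' : ‖u‖ ≠ 0 := norm_ne_zero_iff.2 hu
    have h1 : (‖u‖⁻¹ • u) ∈ Metric.sphere (0 : Vec d) 1 := by
      simp [norm_smul, inv_mul_cancel₀ hu']
    have h2 := isMinOn_iff.1 hmin _ h1
    rw [map_smul, inner_smul_left, inner_smul_right] at h2
    simp only [conj_trivial] at h2
    calc _ ≤ ‖u‖⁻¹ * (‖u‖⁻¹ * inner ℝ u (toEuclideanLin A u)) * ‖u‖ ^ 2 := by gcongr
      _ = _ := by field_simp

lemma posDef_of_coercive {A : Matrix (Fin d) (Fin d) ℝ} (hA : A.IsSymm) {c : ℝ} (hc : 0 < c)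
    (h : ∀ u : Vec d, c * ‖u‖ ^ 2 ≤ inner ℝ u (toEuclideanLin A u)) : A.PosDef := by
  refine Matrix.PosDef.of_dotProduct_mulVec_pos (Matrix.isHermitian_iff_isSymm.2 hA) fun x hx => ?_
  have h1 := h (WithLp.toLp 2 x)
  rw [inner_toEuclideanLin_eq_dotProduct] at h1
  have h2 : 0 < ‖(WithLp.toLp 2 x : Vec d)‖ := by
    rw [norm_pos_iff]
    intro h0
    exact hx (by simpa using h0)
  have h3 : 0 < c * ‖(WithLp.toLp 2 x : Vec d)‖ ^ 2 := by positivity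
  simpa using h3.trans_le h1

/-- If `V = H⁻¹ Λ H⁻¹`, then `B = V^{-1/2} H⁻¹` standardizes `Λ`, that is `B Λ Bᵀ = 1`. -/
lemma standardizer_mul_mul_transpose {H Λ : Matrix (Fin d) (Fin d) ℝ} (hH : H.IsSymm)
    (hHu : IsUnit H.det) (hΛ : Λ.PosDef) :
    (invSqrt (H⁻¹ * Λ * H⁻¹) * H⁻¹) * Λ * (invSqrt (H⁻¹ * Λ * H⁻¹) * H⁻¹)ᵀ = 1 := by
  have hHi : (H⁻¹)ᵀ = H⁻¹ := by rw [Matrix.transpose_nonsing_inv, hH.eq]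
  have hVpd : (H⁻¹ * Λ * H⁻¹).PosDef := by
    have h1 : IsUnit (H⁻¹) := (Matrix.isUnit_iff_isUnit_det _).2 (Matrix.isUnit_nonsing_inv_det _ hHu)
    have h2 := hΛ.mul_mul_conjTranspose_same (B := H⁻¹)
      (Matrix.vecMul_injective_of_isUnit h1)
    rwa [Matrix.conjTranspose_eq_transpose_of_trivial, hHi] at h2
  set V := H⁻¹ * Λ * H⁻¹ with hV
  have hV0 : 0 ≤ V := hVpd.posSemidef.nonneg
  have hsq : CFC.sqrt V * CFC.sqrt V = V := CFC.sqrt_mul_sqrt_self V hV0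
  have hsu : IsUnit (CFC.sqrt V) := (CFC.isUnit_sqrt_iff V hV0).2 hVpd.isUnit
  have hsd : IsUnit (CFC.sqrt V).det := (Matrix.isUnit_iff_isUnit_det _).1 hsu
  have hst : (CFC.sqrt V)ᵀ = CFC.sqrt V := by
    have := (CFC.sqrt_nonneg V).isSelfAdjoint.star_eq
    rwa [Matrix.star_eq_conjTranspose, Matrix.conjTranspose_eq_transpose_of_trivial] at this
  rw [Matrix.transpose_mul, hHi, invSqrt, Matrix.transpose_nonsing_inv, hst]
  calc (CFC.sqrt V)⁻¹ * H⁻¹ * Λ * (H⁻¹ * (CFC.sqrt V)⁻¹)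
      = (CFC.sqrt V)⁻¹ * (H⁻¹ * Λ * H⁻¹) * (CFC.sqrt V)⁻¹ := by simp only [Matrix.mul_assoc]
    _ = (CFC.sqrt V)⁻¹ * (CFC.sqrt V * CFC.sqrt V) * (CFC.sqrt V)⁻¹ := by rw [← hV, hsq]
    _ = 1 := by
      rw [Matrix.nonsing_inv_mul_cancel_left _ _ hsd, Matrix.mul_nonsing_inv _ hsd]

/-- A standardizer of a coercive form is bounded, as seen on its transpose. -/
lemma norm_le_of_mul_mul_transpose_eq_one {B Λ : Matrix (Fin d) (Fin d) ℝ}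
    (hB : B * Λ * Bᵀ = 1) {c : ℝ} (hc : 0 < c)
    (h : ∀ u : Vec d, c * ‖u‖ ^ 2 ≤ inner ℝ u (toEuclideanLin Λ u)) (u : Vec d) :
    ‖toEuclideanLin B u‖ ≤ (√c)⁻¹ * ‖u‖ := by
  have hsc : 0 < √c := Real.sqrt_pos.2 hc
  have hT : ∀ w : Vec d, ‖toEuclideanLin Bᵀ w‖ ≤ (√c)⁻¹ * ‖w‖ := by
    intro w
    have h1 := h (toEuclideanLin Bᵀ w)
    have h2 : inner ℝ (toEuclideanLin Bᵀ w) (toEuclideanLin Λ (toEuclideanLin Bᵀ w)) = ‖w‖ ^ 2 := by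
      have h3 := inner_toEuclideanLin_transpose Bᵀ w (toEuclideanLin Λ (toEuclideanLin Bᵀ w))
      rw [Matrix.transpose_transpose, ← toEuclideanLin_mul_apply, ← toEuclideanLin_mul_apply,
        hB, toEuclideanLin_one_apply, real_inner_self_eq_norm_sq] at h3
      rw [h3]
    rw [h2] at h1
    rw [inv_mul_eq_div, le_div_iff₀ hsc]
    refine le_of_sq_le_sq ?_ (norm_nonneg _)
    rw [mul_pow, Real.sq_sqrt hc.le]
    linarith
  have h1 : ‖toEuclideanLin B u‖ ^ 2 ≤ (√c)⁻¹ * ‖toEuclideanLin B u‖ * ‖u‖ := by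
    rw [← real_inner_self_eq_norm_sq]
    have h2 := inner_toEuclideanLin_transpose B u (toEuclideanLin B u)
    rw [← h2, real_inner_comm]
    refine (real_inner_le_norm _ _).trans ?_
    gcongr
    exact hT _
  rcases (norm_nonneg (toEuclideanLin B u)).eq_or_lt with h0 | h0
  · rw [← h0]; positivity
  · nlinarith

/-! ### Measurability of matrix operations -/

variable {Ω : Type*} [MeasurableSpace Ω]

lemma measurable_matrix_apply_of_continuous {A : Ω → Matrix (Fin d) (Fin d) ℝ}
    (hA : ∀ k l, Measurable fun ω => A ω k l) {f : Matrix (Fin d) (Fin d) ℝ → ℝ}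
    (hf : Continuous f) : Measurable fun ω => f (A ω) := by
  have h1 : Measurable fun ω => (fun k l => A ω k l : Fin d → Fin d → ℝ) :=
    measurable_pi_lambda _ fun k => measurable_pi_lambda _ fun l => hA k l
  exact (show Continuous fun M : Fin d → Fin d → ℝ => f (Matrix.of M) from hf).measurable.comp h1

lemma measurable_matrix_inv {A : Ω → Matrix (Fin d) (Fin d) ℝ}
    (hA : ∀ k l, Measurable fun ω => A ω k l) (k l : Fin d) :
    Measurable fun ω => (A ω)⁻¹ k l := by
  have h : ∀ ω, (A ω)⁻¹ k l = ((A ω).det)⁻¹ * (A ω).adjugate k l := by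
    intro ω
    rw [Matrix.inv_def, Matrix.smul_apply, smul_eq_mul, Ring.inverse_eq_inv']
  simp only [h]
  refine Measurable.mul ?_ ?_
  · exact (measurable_matrix_apply_of_continuous hA (Continuous.matrix_det continuous_id)).inv
  · exact measurable_matrix_apply_of_continuous hA
      ((Continuous.matrix_adjugate continuous_id).matrix_elem k l)

lemma measurable_matrix_mul {A B : Ω → Matrix (Fin d) (Fin d) ℝ}
    (hA : ∀ k l, Measurable fun ω => A ω k l) (hB : ∀ k l, Measurable fun ω => B ω k l)
    (k l : Fin d) : Measurable fun ω => (A ω * B ω) k l := by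
  simp only [Matrix.mul_apply]
  exact Finset.measurable_sum _ fun i _ => (hA k i).mul (hB i l)

lemma isClosed_setOf_posSemidef :
    IsClosed {A : Fin d → Fin d → ℝ | (Matrix.of A).PosSemidef} := by
  have h : {A : Fin d → Fin d → ℝ | (Matrix.of A).PosSemidef} =
      {A | ∀ k l, A k l = A l k} ∩ {A | ∀ x : Fin d → ℝ, 0 ≤ x ⬝ᵥ (Matrix.of A) *ᵥ x} := by
    ext A
    constructor
    · intro hA
      refine ⟨fun k l => ?_, fun x => ?_⟩
      · exact (Matrix.isHermitian_iff_isSymm.1 hA.isHermitian).apply l k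
      · simpa using hA.dotProduct_mulVec_nonneg x
    · rintro ⟨h1, h2⟩
      refine Matrix.PosSemidef.of_dotProduct_mulVec_nonneg
        (Matrix.isHermitian_iff_isSymm.2 ?_) fun x => by simpa using h2 x
      exact Matrix.IsSymm.ext fun k l => h1 l k
  rw [h]
  refine IsClosed.inter ?_ ?_
  · simp only [Set.ofPred_forall]
    exact isClosed_iInter fun k => isClosed_iInter fun l =>
      isClosed_eq (by fun_prop) (by fun_prop)
  · simp only [Set.ofPred_forall]
    refine isClosed_iInter fun x => isClosed_le continuous_const ?_
    simp only [dotProduct, Matrix.mulVec, Matrix.of_apply]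
    fun_prop

/-- The square root is measurable because it inverts the squaring map, which is continuous and
injective on the closed set of positive semidefinite matrices (Lusin–Souslin). -/
lemma measurable_matrix_sqrt {A : Ω → Matrix (Fin d) (Fin d) ℝ}
    (hA : ∀ k l, Measurable fun ω => A ω k l) (k l : Fin d) :
    Measurable fun ω => CFC.sqrt (A ω) k l := by
  let S : Set (Fin d → Fin d → ℝ) := {A | (Matrix.of A).PosSemidef}
  let f : (Fin d → Fin d → ℝ) → (Fin d → Fin d → ℝ) := fun M => Matrix.of M * Matrix.of M
  have hS : MeasurableSet S := isClosed_setOf_posSemidef.measurableSet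
  have hf : Continuous f := by
    refine continuous_pi fun i => continuous_pi fun j => ?_
    simp only [f, Matrix.mul_apply, Matrix.of_apply]
    fun_prop
  have hinj : Set.InjOn f S := by
    intro M hM N hN hMN
    have h1 : CFC.sqrt (Matrix.of M * Matrix.of M) = Matrix.of M :=
      CFC.sqrt_unique rfl (Matrix.PosSemidef.nonneg hM)
    have h2 : CFC.sqrt (Matrix.of N * Matrix.of N) = Matrix.of N :=
      CFC.sqrt_unique rfl (Matrix.PosSemidef.nonneg hN)
    have h3 : Matrix.of M * Matrix.of M = Matrix.of N * Matrix.of N := hMN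
    have : Matrix.of M = Matrix.of N := by rw [← h1, h3, h2]
    exact this
  have hemb := hf.continuousOn.measurableEmbedding hS hinj
  obtain ⟨g, hg, hgf⟩ := hemb.exists_measurable_extend (g := (Subtype.val : S → _))
    measurable_subtype_coe (fun _ => inferInstance)
  have hA' : Measurable fun ω => (fun k l => A ω k l : Fin d → Fin d → ℝ) :=
    measurable_pi_lambda _ fun k => measurable_pi_lambda _ fun l => hA k l
  have hT : MeasurableSet {ω | (A ω).PosSemidef} := hA' hS
  classical
  have heq : (fun ω => CFC.sqrt (A ω) k l) = fun ω =>
      if (A ω).PosSemidef then g (fun k l => A ω k l) k l else 0 := by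
    funext ω
    split_ifs with h
    · obtain ⟨R, hR⟩ : ∃ R : Fin d → Fin d → ℝ, CFC.sqrt (A ω) = Matrix.of R :=
        ⟨fun k l => CFC.sqrt (A ω) k l, rfl⟩
      have h1 : R ∈ S := by
        change (Matrix.of R).PosSemidef
        rw [← hR]
        exact (CFC.sqrt_nonneg (A ω)).posSemidef
      have h2 : g (f R) = R := congrFun hgf (⟨R, h1⟩ : S)
      have h3 : f R = fun k l => A ω k l := by
        change (Matrix.of R * Matrix.of R : Matrix (Fin d) (Fin d) ℝ) = A ω
        rw [← hR]
        exact CFC.sqrt_mul_sqrt_self (A ω) h.nonneg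
      rw [hR, ← h3, h2, Matrix.of_apply]
    · rw [CFC.sqrt, cfcₙ_apply_of_not_predicate]
      · rfl
      · change ¬ (A ω - 0).PosSemidef
        simpa
  rw [heq]
  refine Measurable.ite hT ?_ measurable_const
  exact (measurable_pi_apply l).comp ((measurable_pi_apply k).comp (hg.comp hA'))

lemma measurable_invSqrt {A : Ω → Matrix (Fin d) (Fin d) ℝ}
    (hA : ∀ k l, Measurable fun ω => A ω k l) (k l : Fin d) :
    Measurable fun ω => invSqrt (A ω) k l :=
  measurable_matrix_inv (measurable_matrix_sqrt hA) k l

lemma measurable_toEuclideanLin {A : Ω → Matrix (Fin d) (Fin d) ℝ} {u : Ω → Vec d}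
    (hA : ∀ k l, Measurable fun ω => A ω k l) (hu : Measurable u) :
    Measurable fun ω => toEuclideanLin (A ω) (u ω) := by
  have h : Measurable fun ω => (fun k => ∑ l, A ω k l * u ω l : Fin d → ℝ) :=
    measurable_pi_lambda _ fun k => Finset.measurable_sum _ fun l _ => (hA k l).mul (by fun_prop)
  have h2 : (fun ω => toEuclideanLin (A ω) (u ω)) =
      fun ω => WithLp.toLp 2 (fun k => ∑ l, A ω k l * u ω l : Fin d → ℝ) := by
    funext ω; ext k; rw [toEuclideanLin_apply_coord]
  rw [h2]
  fun_prop

end Matrices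

/-! ### Taylor expansions of the criterion function -/

section Taylor

variable {d : ℕ} {𝓩 : Type*} {m : 𝓩 → Vec d → ℝ} {Θ U : Set (Vec d)}

open Matrix

lemma inner_grad (m : 𝓩 → Vec d → ℝ) (z : 𝓩) (θ w : Vec d) :
    inner ℝ (grad m z θ) w = fderiv ℝ (m z) θ w := by
  rw [grad, gradient, InnerProductSpace.toDual_symm_apply]

lemma inner_hess (m : 𝓩 → Vec d → ℝ) (z : 𝓩) (θ u w : Vec d) :
    inner ℝ u (toEuclideanLin (hess m z θ) w) = fderiv ℝ (fderiv ℝ (m z)) θ u w := by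
  have hexp : ∀ u : Vec d, u = ∑ k, u k • EuclideanSpace.single k (1 : ℝ) := by
    intro u
    ext l
    simp [Finset.sum_apply, Pi.single_apply]
  rw [inner_toEuclideanLin]
  conv_rhs => rw [hexp u, hexp w]
  simp only [map_sum, map_smul, _root_.sum_apply, _root_.smul_apply,
    smul_eq_mul, hess, Matrix.of_apply, Finset.mul_sum]
  rw [Finset.sum_comm]
  exact Finset.sum_congr rfl fun l _ => Finset.sum_congr rfl fun k _ => by ring

lemma hasDerivAt_line (hU : IsOpen U) (hm : ∀ z, ContDiffOn ℝ 2 (m z) U) (z : 𝓩) {c u : Vec d}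
    {t : ℝ} (ht : c + t • u ∈ U) :
    HasDerivAt (fun t : ℝ => m z (c + t • u)) (inner ℝ (grad m z (c + t • u)) u) t := by
  have h1 : DifferentiableAt ℝ (m z) (c + t • u) :=
    ((hm z).contDiffAt (hU.mem_nhds ht)).differentiableAt (by norm_num)
  have h2 : HasDerivAt (fun t : ℝ => c + t • u) u t := by
    simpa using ((hasDerivAt_id t).smul_const u).const_add c
  rw [inner_grad]
  exact h1.hasFDerivAt.comp_hasDerivAt t h2

lemma differentiableAt_fderiv (hU : IsOpen U) (hm : ∀ z, ContDiffOn ℝ 2 (m z) U) (z : 𝓩)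
    {θ : Vec d} (hθ : θ ∈ U) : DifferentiableAt ℝ (fderiv ℝ (m z)) θ :=
  (((hm z).contDiffAt (hU.mem_nhds hθ)).fderiv_right (m := 1) (by norm_num)).differentiableAt
    (by norm_num)

lemma hasDerivAt_inner_grad_line (hU : IsOpen U) (hm : ∀ z, ContDiffOn ℝ 2 (m z) U) (z : 𝓩)
    {c u w : Vec d} {t : ℝ} (ht : c + t • u ∈ U) :
    HasDerivAt (fun t : ℝ => inner ℝ (grad m z (c + t • u)) w)
      (inner ℝ u (toEuclideanLin (hess m z (c + t • u)) w)) t := by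
  have h2 : HasDerivAt (fun t : ℝ => c + t • u) u t := by
    simpa using ((hasDerivAt_id t).smul_const u).const_add c
  have h3 := (differentiableAt_fderiv hU hm z ht).hasFDerivAt.comp_hasDerivAt t h2
  have h4 := (ContinuousLinearMap.apply ℝ ℝ w).hasFDerivAt.comp_hasDerivAt t h3
  simp only [inner_grad, inner_hess]
  exact h4

lemma hess_isSymm (hU : IsOpen U) (hm : ∀ z, ContDiffOn ℝ 2 (m z) U) (z : 𝓩)
    {θ : Vec d} (hθ : θ ∈ U) : (hess m z θ).IsSymm := by
  refine Matrix.IsSymm.ext fun k l => ?_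
  have := ((hm z).contDiffAt (hU.mem_nhds hθ)).isSymmSndFDerivAt (by simp)
  exact this _ _

lemma line_mem (hconv : Convex ℝ Θ) {c θ : Vec d} (hc : c ∈ Θ) (hθ : θ ∈ Θ) {t : ℝ}
    (ht : t ∈ Set.Icc (0 : ℝ) 1) : c + t • (θ - c) ∈ Θ :=
  hconv.add_smul_sub_mem hc hθ ht

/-- If the Hessian entries are bounded by `L` on `Θ`, the gradient is Lipschitz on `Θ`. -/
lemma norm_grad_sub_le (hU : IsOpen U) (hΘU : Θ ⊆ U) (hm : ∀ z, ContDiffOn ℝ 2 (m z) U)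
    (hconv : Convex ℝ Θ) {z : 𝓩} {L : ℝ} (hL : ∀ θ ∈ Θ, ∀ k l, |hess m z θ k l| ≤ L)
    {c θ : Vec d} (hc : c ∈ Θ) (hθ : θ ∈ Θ) :
    ‖grad m z θ - grad m z c‖ ≤ d * L * ‖θ - c‖ := by
  set w := grad m z θ - grad m z c with hw
  have h1 := norm_image_sub_le_of_norm_deriv_le_segment' (a := (0 : ℝ)) (b := 1)
    (f := fun t : ℝ => inner ℝ (grad m z (c + t • (θ - c))) w)
    (C := d * L * (‖θ - c‖ * ‖w‖))
    (fun t ht => (hasDerivAt_inner_grad_line hU hm z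
      (hΘU (line_mem hconv hc hθ ht))).hasDerivWithinAt)
    (fun t ht => abs_inner_toEuclideanLin_le
      (hL _ (line_mem hconv hc hθ (Set.Ico_subset_Icc_self ht))) _ _) 1 (by simp)
  simp only [one_smul, zero_smul, add_zero, add_sub_cancel, sub_zero, mul_one] at h1
  rw [← inner_sub_left, ← hw, real_inner_self_eq_norm_sq, Real.norm_eq_abs, abs_of_nonneg
    (by positivity)] at h1
  rcases (norm_nonneg w).eq_or_lt with h | h
  · rw [← h]
    rcases Nat.eq_zero_or_pos d with rfl | hd
    · simp
    have : 0 ≤ L := (abs_nonneg _).trans (hL c hc ⟨0, hd⟩ ⟨0, hd⟩)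
    positivity
  · nlinarith

/-- Second-order Taylor expansion with a Lipschitz Hessian. -/
lemma abs_taylor_two_le (hU : IsOpen U) (hΘU : Θ ⊆ U) (hm : ∀ z, ContDiffOn ℝ 2 (m z) U)
    (hconv : Convex ℝ Θ) {z : 𝓩} {ψ : ℝ}
    (hψ : ∀ θ₁ ∈ Θ, ∀ θ₂ ∈ Θ, ∀ k l, |hess m z θ₁ k l - hess m z θ₂ k l| ≤ ψ * ‖θ₁ - θ₂‖)
    {c θ : Vec d} (hc : c ∈ Θ) (hθ : θ ∈ Θ) :
    |m z θ - m z c - inner ℝ (grad m z c) (θ - c) -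
      1 / 2 * inner ℝ (θ - c) (toEuclideanLin (hess m z c) (θ - c))| ≤ d * ψ * ‖θ - c‖ ^ 3 := by
  set u := θ - c with hu
  have hmem : ∀ t ∈ Set.Icc (0 : ℝ) 1, c + t • u ∈ Θ := fun t ht => line_mem hconv hc hθ ht
  rcases Nat.eq_zero_or_pos d with rfl | hd
  · have : θ = c := Subsingleton.elim _ _
    have hu0 : u = 0 := Subsingleton.elim _ _
    simp [this, hu0]
  -- the mean value inequality is applied twice along the segment: the second derivative controls
  -- the first one, and the first one controls the function
  set q := inner ℝ u (toEuclideanLin (hess m z c) u) with hq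
  have hψ0 : 0 ≤ ψ * ‖u‖ := (abs_nonneg _).trans (hψ θ hθ c hc ⟨0, hd⟩ ⟨0, hd⟩)
  have hbound : ∀ t ∈ Set.Icc (0 : ℝ) 1,
      |inner ℝ u (toEuclideanLin (hess m z (c + t • u)) u) - q| ≤ d * ψ * ‖u‖ ^ 3 := by
    intro t ht
    have h1 : ∀ k l, |(hess m z (c + t • u) - hess m z c) k l| ≤ ψ * ‖u‖ := by
      intro k l
      refine (hψ _ (hmem t ht) c hc k l).trans ?_
      rw [add_sub_cancel_left, norm_smul, Real.norm_eq_abs, abs_of_nonneg ht.1]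
      nlinarith [ht.2]
    have h2 := abs_inner_toEuclideanLin_le h1 u u
    rw [toEuclideanLin_sub_apply, inner_sub_right] at h2
    refine h2.trans (le_of_eq (by ring))
  have hg : ∀ t ∈ Set.Icc (0 : ℝ) 1,
      |inner ℝ (grad m z (c + t • u)) u - inner ℝ (grad m z c) u - t * q| ≤ d * ψ * ‖u‖ ^ 3 := by
    intro t ht
    have h1 := norm_image_sub_le_of_norm_deriv_le_segment' (a := (0 : ℝ)) (b := 1)
      (f := fun t : ℝ => inner ℝ (grad m z (c + t • u)) u - t * q)
      (f' := fun t => inner ℝ u (toEuclideanLin (hess m z (c + t • u)) u) - q)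
      (C := d * ψ * ‖u‖ ^ 3)
      (fun t ht => ((hasDerivAt_inner_grad_line hU hm z (hΘU (hmem t ht))).sub
        (by simpa using (hasDerivAt_id t).mul_const q)).hasDerivWithinAt)
      (fun t ht => hbound t (Set.Ico_subset_Icc_self ht)) t ht
    simp only [zero_smul, add_zero, zero_mul, sub_zero, Real.norm_eq_abs] at h1
    have h2 : 0 ≤ d * ψ * ‖u‖ ^ 3 := (abs_nonneg _).trans (hbound t ht)
    rw [sub_right_comm] at h1
    exact h1.trans (mul_le_of_le_one_right h2 ht.2)
  have hsqd : ∀ t : ℝ, HasDerivAt (fun t : ℝ => t ^ 2 / 2 * q) (t * q) t := by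
    intro t
    refine (((hasDerivAt_pow 2 t).div_const 2).mul_const q).congr_deriv ?_
    push_cast
    ring
  have h1 := norm_image_sub_le_of_norm_deriv_le_segment' (a := (0 : ℝ)) (b := 1)
    (f := fun t : ℝ => m z (c + t • u) - t * inner ℝ (grad m z c) u - t ^ 2 / 2 * q)
    (f' := fun t => inner ℝ (grad m z (c + t • u)) u - inner ℝ (grad m z c) u - t * q)
    (C := d * ψ * ‖u‖ ^ 3)
    (fun t ht => (((hasDerivAt_line hU hm z (hΘU (hmem t ht))).sub
        (by simpa using (hasDerivAt_id t).mul_const (inner ℝ (grad m z c) u))).sub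
        (hsqd t)).hasDerivWithinAt)
    (fun t ht => hg t (Set.Ico_subset_Icc_self ht)) 1 (by simp)
  have h2 : c + u = θ := by rw [hu]; abel
  simp only [one_smul, zero_smul, add_zero, zero_mul, sub_zero, mul_one, one_mul, h2,
    Real.norm_eq_abs] at h1
  convert h1 using 2
  ring

end Taylor

/-! ### Localization of the maximizer of a concave function -/

section Localization

variable {d : ℕ} {Θ : Set (Vec d)}

open Matrix

/-- A concave function that is close to a concave quadratic function near `c` has all its
maximizers close to the maximizer `a = c - H⁻¹ S` of that quadratic function. -/
theorem norm_argmax_sub_le {F : Vec d → ℝ} (hF : ConcaveOn ℝ Θ F) {θs : Vec d}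
    (hθs : IsArgmax F Θ θs) {c S e : Vec d} {ρ r lam α β : ℝ} (hr : 0 < r)
    (hball : Metric.closedBall c ρ ⊆ Θ) {H : Matrix (Fin d) (Fin d) ℝ} (hHs : H.IsSymm)
    (hH : ∀ u : Vec d, inner ℝ u (toEuclideanLin H u) ≤ -lam * ‖u‖ ^ 2)
    (he : toEuclideanLin H e = -S)
    (hα : 0 ≤ α) (hβ : 0 ≤ β)
    (happ : ∀ θ ∈ Metric.closedBall c ρ, |F θ - F c - inner ℝ S (θ - c) -
      1 / 2 * inner ℝ (θ - c) (toEuclideanLin H (θ - c))| ≤ α * ‖θ - c‖ ^ 2 + β * ‖θ - c‖ ^ 3)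
    (hρ : ‖e‖ + r ≤ ρ)
    (hsmall : 2 * (α * (‖e‖ + r) ^ 2 + β * (‖e‖ + r) ^ 3) < lam / 2 * r ^ 2) :
    ‖θs - (c + e)‖ ≤ r := by
  by_contra! hlt
  set a := c + e with ha
  set D := ‖θs - a‖ with hD
  have hDpos : 0 < D := hr.trans hlt
  -- `a + w` is where the segment from `a` to `θs` crosses the sphere of radius `r`; by concavity
  -- `F` is there at least as large as at `a`, while the quadratic function is smaller by
  -- at least `lam / 2 * r ^ 2`
  set w := (r / D) • (θs - a) with hw
  have hwn : ‖w‖ = r := by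
    rw [hw, norm_smul, Real.norm_eq_abs, abs_of_pos (by positivity), ← hD]
    field_simp
  have hac : ‖a - c‖ ≤ ‖e‖ + r := by rw [ha, add_sub_cancel_left]; linarith
  have hawc : ‖a + w - c‖ ≤ ‖e‖ + r := by
    have : a + w - c = e + w := by rw [ha]; abel
    rw [this, ← hwn]; exact norm_add_le _ _
  have hab : a ∈ Metric.closedBall c ρ := by
    rw [mem_closedBall_iff_norm]; exact hac.trans hρ
  have hawb : a + w ∈ Metric.closedBall c ρ := by
    rw [mem_closedBall_iff_norm]; exact hawc.trans hρ
  have hFle : F a ≤ F (a + w) := by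
    have h1 : 0 ≤ r / D := by positivity
    have h2 : r / D ≤ 1 := (div_le_one hDpos).2 hlt.le
    have h3 := hF.2 (hball hab) hθs.1 (sub_nonneg.2 h2) h1 (by ring)
    have h4 : (1 - r / D) • a + (r / D) • θs = a + w := by
      rw [hw, smul_sub, sub_smul, one_smul]; abel
    rw [h4] at h3
    have h5 : F a ≤ F θs := hθs.2 (hball hab)
    simp only [smul_eq_mul] at h3
    nlinarith
  have herr : ∀ θ ∈ Metric.closedBall c ρ, ‖θ - c‖ ≤ ‖e‖ + r → |F θ - F c - inner ℝ S (θ - c) -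
      1 / 2 * inner ℝ (θ - c) (toEuclideanLin H (θ - c))| ≤
        α * (‖e‖ + r) ^ 2 + β * (‖e‖ + r) ^ 3 := by
    intro θ hθ hn
    refine (happ θ hθ).trans ?_
    gcongr
  have h1 := (abs_le.1 (herr a hab hac)).1
  have h2 := (abs_le.1 (herr (a + w) hawb hawc)).2
  have hquad : inner ℝ S (a + w - c) +
      1 / 2 * inner ℝ (a + w - c) (toEuclideanLin H (a + w - c)) -
      (inner ℝ S (a - c) + 1 / 2 * inner ℝ (a - c) (toEuclideanLin H (a - c)))
      = 1 / 2 * inner ℝ w (toEuclideanLin H w) := by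
    have e1 : a + w - c = e + w := by rw [ha]; abel
    have e2 : a - c = e := by rw [ha]; abel
    have e3 : inner ℝ e (toEuclideanLin H w) = -inner ℝ S w := by
      have h := inner_toEuclideanLin_transpose H e w
      rw [hHs.eq, he, inner_neg_left] at h
      exact h
    rw [e1, e2, map_add, inner_add_left, inner_add_right, inner_add_right, inner_add_right, e3, he,
      inner_neg_right, inner_neg_right, real_inner_comm S w]
    ring
  have hw2 := hH w
  rw [hwn] at hw2
  nlinarith

end Localization

section WeightedSums

variable {d : ℕ} {𝓩 : Type*} {m : 𝓩 → Vec d → ℝ} {Θ U : Set (Vec d)} {ι : Type*} [Fintype ι]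

open Matrix

/-- Localization of the maximizer of a weighted sum of concave criterion functions, in terms of
the weighted gradient, Hessian and Lipschitz constant at `c`. -/
theorem norm_argmax_weighted_sum_sub_le (hU : IsOpen U) (hΘU : Θ ⊆ U)
    (hm : ∀ z, ContDiffOn ℝ 2 (m z) U) (hconc : ∀ z, ConcaveOn ℝ Θ (m z)) (hconv : Convex ℝ Θ)
    {w : ι → ℝ} (hw : ∀ i, 0 ≤ w i) {z : ι → 𝓩} {ψ : ι → ℝ}
    (hψ : ∀ i, ∀ θ₁ ∈ Θ, ∀ θ₂ ∈ Θ, ∀ k l,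
      |hess m (z i) θ₁ k l - hess m (z i) θ₂ k l| ≤ ψ i * ‖θ₁ - θ₂‖)
    {θs c e : Vec d} (hθs : IsArgmax (fun θ => ∑ i, w i * m (z i) θ) Θ θs)
    {ρ r lam κ Ψ : ℝ} (hr : 0 < r) (hball : Metric.closedBall c ρ ⊆ Θ)
    {H : Matrix (Fin d) (Fin d) ℝ} (hHs : H.IsSymm)
    (hH : ∀ u : Vec d, inner ℝ u (toEuclideanLin H u) ≤ -lam * ‖u‖ ^ 2)
    (he : toEuclideanLin H e = -∑ i, w i • grad m (z i) c)
    (hκ0 : 0 ≤ κ) (hΨ0 : 0 ≤ Ψ)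
    (hκ : ∀ k l, |∑ i, w i * hess m (z i) c k l - H k l| ≤ κ)
    (hΨ : ∑ i, w i * ψ i ≤ Ψ) (hρ : ‖e‖ + r ≤ ρ)
    (hsmall : d * κ * (‖e‖ + r) ^ 2 + 2 * (d * Ψ * (‖e‖ + r) ^ 3) < lam / 2 * r ^ 2) :
    ‖θs - (c + e)‖ ≤ r := by
  have hρ0 : 0 ≤ ρ := by have := norm_nonneg e; linarith
  have hcΘ : c ∈ Θ := hball (Metric.mem_closedBall_self hρ0)
  refine norm_argmax_sub_le (α := d * κ / 2) (β := d * Ψ) (lam := lam) ?_ hθs hr hball hHs hH he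
    (by positivity) (by positivity) ?_ hρ (by linarith)
  · refine ⟨hconv, fun x hx y hy a b ha hb hab => ?_⟩
    simp only [smul_eq_mul]
    rw [Finset.mul_sum, Finset.mul_sum, ← Finset.sum_add_distrib]
    refine Finset.sum_le_sum fun i _ => ?_
    have := mul_le_mul_of_nonneg_left ((hconc (z i)).2 hx hy ha hb hab) (hw i)
    simp only [smul_eq_mul] at this
    linarith
  · intro θ hθ
    set u := θ - c with hu
    have hdecomp : (∑ i, w i * m (z i) θ) - (∑ i, w i * m (z i) c) -
        inner ℝ (∑ i, w i • grad m (z i) c) u - 1 / 2 * inner ℝ u (toEuclideanLin H u)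
        = ∑ i, w i * (m (z i) θ - m (z i) c - inner ℝ (grad m (z i) c) u -
            1 / 2 * inner ℝ u (toEuclideanLin (hess m (z i) c) u)) +
          1 / 2 * inner ℝ u (toEuclideanLin (∑ i, w i • hess m (z i) c - H) u) := by
      simp only [map_sub, map_sum, map_smul, LinearMap.sub_apply, LinearMap.sum_apply,
        LinearMap.smul_apply, inner_sub_right, inner_sum, sum_inner, inner_smul_left,
        inner_smul_right, mul_sub, Finset.sum_sub_distrib, conj_trivial, Finset.mul_sum]
      have : ∑ i, w i * (1 / 2 * inner ℝ u (toEuclideanLin (hess m (z i) c) u))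
        = ∑ i, 1 / 2 * (w i * inner ℝ u (toEuclideanLin (hess m (z i) c) u)) :=
        Finset.sum_congr rfl fun i _ => by ring
      rw [this]
      ring
    rw [hdecomp]
    have h1 : |∑ i, w i * (m (z i) θ - m (z i) c - inner ℝ (grad m (z i) c) u -
            1 / 2 * inner ℝ u (toEuclideanLin (hess m (z i) c) u))| ≤ d * Ψ * ‖u‖ ^ 3 := by
      refine (Finset.abs_sum_le_sum_abs _ _).trans ?_
      have h2 : ∑ i, w i * (d * ψ i * ‖u‖ ^ 3) ≤ d * Ψ * ‖u‖ ^ 3 := by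
        have h3 : ∑ i, w i * (d * ψ i * ‖u‖ ^ 3) = (∑ i, w i * ψ i) * (d * ‖u‖ ^ 3) := by
          rw [Finset.sum_mul]
          exact Finset.sum_congr rfl fun i _ => by ring
        rw [h3]
        calc _ ≤ Ψ * (d * ‖u‖ ^ 3) := by gcongr
          _ = _ := by ring
      refine (Finset.sum_le_sum fun i _ => ?_).trans h2
      rw [abs_mul, abs_of_nonneg (hw i)]
      exact mul_le_mul_of_nonneg_left
        (abs_taylor_two_le hU hΘU hm hconv (hψ i) hcΘ (hball hθ)) (hw i)
    have h2 : |1 / 2 * inner ℝ u (toEuclideanLin (∑ i, w i • hess m (z i) c - H) u)| ≤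
        d * κ / 2 * ‖u‖ ^ 2 := by
      rw [abs_mul, abs_of_pos (by norm_num : (0 : ℝ) < 1 / 2)]
      have h3 := abs_inner_toEuclideanLin_le (A := ∑ i, w i • hess m (z i) c - H) (κ := κ)
        (fun k l => by simpa [Matrix.sum_apply] using hκ k l) u u
      linarith
    exact (abs_add_le _ _).trans (by linarith)

end WeightedSums

/-! ### Measurability of the gradient and the Hessian -/

section Measurability

variable {d : ℕ} {𝓩 : Type*} {m : 𝓩 → Vec d → ℝ} {U : Set (Vec d)}

open Matrix

lemma grad_apply_eq_inner (m : 𝓩 → Vec d → ℝ) (z : 𝓩) (θ : Vec d) (k : Fin d) :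
    grad m z θ k = inner ℝ (grad m z θ) (EuclideanSpace.single k 1) := by
  simp [PiLp.inner_apply]

lemma hess_apply_eq_inner (m : 𝓩 → Vec d → ℝ) (z : 𝓩) (θ : Vec d) (k l : Fin d) :
    hess m z θ k l = inner ℝ (EuclideanSpace.single k 1)
      (toEuclideanLin (hess m z θ) (EuclideanSpace.single l 1)) := by
  rw [inner_hess]; rfl

lemma continuousOn_grad_apply (hU : IsOpen U) (hm : ∀ z, ContDiffOn ℝ 2 (m z) U) (z : 𝓩)
    (k : Fin d) : ContinuousOn (fun θ => grad m z θ k) U := by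
  simp only [grad_apply_eq_inner, inner_grad]
  exact ((hm z).continuousOn_fderiv_of_isOpen hU (by norm_num)).clm_apply continuousOn_const

lemma continuousOn_hess_apply (hU : IsOpen U) (hm : ∀ z, ContDiffOn ℝ 2 (m z) U) (z : 𝓩)
    (k l : Fin d) : ContinuousOn (fun θ => hess m z θ k l) U := by
  have h1 : ContDiffOn ℝ 1 (fderiv ℝ (m z)) U := (hm z).fderiv_of_isOpen hU (by norm_num)
  have h2 := h1.continuousOn_fderiv_of_isOpen hU (by norm_num)
  exact (h2.clm_apply continuousOn_const).clm_apply continuousOn_const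

variable [MeasurableSpace 𝓩]

/-- A directional derivative is a limit of difference quotients, hence measurable in the
observation. -/
lemma measurable_of_hasDerivAt_line (hU : IsOpen U) {f : 𝓩 → Vec d → ℝ}
    (hf : ∀ θ ∈ U, Measurable fun z => f z θ) {θ u : Vec d} (hθ : θ ∈ U) {f' : 𝓩 → ℝ}
    (hd : ∀ z, HasDerivAt (fun t : ℝ => f z (θ + t • u)) (f' z) 0) : Measurable f' := by
  classical
  let τ : ℕ → ℝ := fun N => 1 / ((N : ℝ) + 1)
  have hτ : Tendsto τ atTop (𝓝 0) := tendsto_one_div_add_atTop_nhds_zero_nat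
  have hτ0 : ∀ N, τ N ≠ 0 := fun N => (Nat.one_div_pos_of_nat).ne'
  have hτU : ∀ᶠ N in atTop, θ + τ N • u ∈ U := by
    have h1 : Tendsto (fun N => θ + τ N • u) atTop (𝓝 (θ + (0 : ℝ) • u)) :=
      (hτ.smul_const u).const_add θ
    rw [zero_smul, add_zero] at h1
    exact h1.eventually (hU.mem_nhds hθ)
  refine measurable_of_tendsto_metrizable
    (f := fun N z => if θ + τ N • u ∈ U then (τ N)⁻¹ * (f z (θ + τ N • u) - f z θ) else 0)
    (fun N => ?_) ?_
  · by_cases h : θ + τ N • u ∈ U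
    · simp only [h, if_true]
      exact ((hf _ h).sub (hf _ hθ)).const_mul _
    · simp only [h, if_false]
      exact measurable_const
  · rw [tendsto_pi_nhds]
    intro z
    have h1 := (hd z).tendsto_slope_zero.comp
      (tendsto_nhdsWithin_iff.2 ⟨hτ, Eventually.of_forall hτ0⟩)
    refine h1.congr' ?_
    filter_upwards [hτU] with N hN
    simp [hN]

lemma measurable_grad_apply (hU : IsOpen U) (hm : ∀ z, ContDiffOn ℝ 2 (m z) U)
    (hmeas : ∀ θ ∈ U, Measurable fun z => m z θ) {θ : Vec d} (hθ : θ ∈ U) (u : Vec d) :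
    Measurable fun z => inner ℝ (grad m z θ) u :=
  measurable_of_hasDerivAt_line hU hmeas (u := u) hθ fun z => by
    simpa using hasDerivAt_line hU hm z (c := θ) (u := u) (t := 0) (by simpa using hθ)

lemma measurable_hess_apply (hU : IsOpen U) (hm : ∀ z, ContDiffOn ℝ 2 (m z) U)
    (hmeas : ∀ θ ∈ U, Measurable fun z => m z θ) {θ : Vec d} (hθ : θ ∈ U) (k l : Fin d) :
    Measurable fun z => hess m z θ k l := by
  simp only [hess_apply_eq_inner]
  exact measurable_of_hasDerivAt_line hU (f := fun z θ => inner ℝ (grad m z θ)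
    (EuclideanSpace.single l 1)) (fun _ hθ => measurable_grad_apply hU hm hmeas hθ _)
    (u := EuclideanSpace.single k 1) hθ fun z => by
      simpa using hasDerivAt_inner_grad_line hU hm z (c := θ) (u := EuclideanSpace.single k 1)
        (w := EuclideanSpace.single l 1) (t := 0) (by simpa using hθ)

/-- A function that is measurable in the observation and continuous in the parameter on `U` may be
evaluated at a random observation and a random parameter in `U`. -/
lemma measurable_comp_of_continuousOn {Ω : Type*} [MeasurableSpace Ω] {f : 𝓩 → Vec d → ℝ}
    (hf : ∀ θ ∈ U, Measurable fun z => f z θ) (hc : ∀ z, ContinuousOn (f z) U)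
    {X : Ω → 𝓩} {θ : Ω → Vec d} (hX : Measurable X) (hθ : Measurable θ) (hθU : ∀ ω, θ ω ∈ U) :
    Measurable fun ω => f (X ω) (θ ω) := by
  have h := measurable_uncurry_of_continuous_of_measurable (ι := U) (α := 𝓩) (β := ℝ)
    (u := fun θ z => f z θ) (fun z => (hc z).domRestrict) (fun θ => hf θ θ.2)
  exact h.comp ((hθ.subtype_mk (h := hθU)).prodMk hX)

lemma measurable_grad_comp {Ω : Type*} [MeasurableSpace Ω] (hU : IsOpen U)
    (hm : ∀ z, ContDiffOn ℝ 2 (m z) U) (hmeas : ∀ θ ∈ U, Measurable fun z => m z θ)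
    {X : Ω → 𝓩} {θ : Ω → Vec d} (hX : Measurable X) (hθ : Measurable θ) (hθU : ∀ ω, θ ω ∈ U)
    (k : Fin d) : Measurable fun ω => grad m (X ω) (θ ω) k :=
  measurable_comp_of_continuousOn (f := fun z θ => grad m z θ k)
    (fun _ hθ => by
      simp only [grad_apply_eq_inner]; exact measurable_grad_apply hU hm hmeas hθ _)
    (fun z => continuousOn_grad_apply hU hm z k) hX hθ hθU

lemma measurable_hess_comp {Ω : Type*} [MeasurableSpace Ω] (hU : IsOpen U)
    (hm : ∀ z, ContDiffOn ℝ 2 (m z) U) (hmeas : ∀ θ ∈ U, Measurable fun z => m z θ)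
    {X : Ω → 𝓩} {θ : Ω → Vec d} (hX : Measurable X) (hθ : Measurable θ) (hθU : ∀ ω, θ ω ∈ U)
    (k l : Fin d) : Measurable fun ω => hess m (X ω) (θ ω) k l :=
  measurable_comp_of_continuousOn (f := fun z θ => hess m z θ k l)
    (fun _ hθ => measurable_hess_apply hU hm hmeas hθ k l)
    (fun z => continuousOn_hess_apply hU hm z k l) hX hθ hθU

end Measurability

/-! ### Convergence and boundedness in probability -/

section Whp

variable {Ω : Type*} [MeasurableSpace Ω]

/-- The filter on `ℕ × Ω` of events that hold with probability tending to one. Convergence in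
probability of `X n` is convergence of `fun p => X p.1 p.2` along this filter. -/
def whp (P : Measure Ω) : Filter (ℕ × Ω) where
  sets := {A | Tendsto (fun n => P {ω | (n, ω) ∉ A}) atTop (𝓝 0)}
  univ_sets := by simp
  sets_of_superset := by
    intro A B hA hAB
    refine tendsto_of_tendsto_of_tendsto_of_le_of_le tendsto_const_nhds hA (fun _ => zero_le)
      (fun n => measure_mono fun ω hω h => hω (hAB h))
  inter_sets := by
    intro A B hA hB
    have h := Tendsto.add hA hB
    rw [add_zero] at h
    refine tendsto_of_tendsto_of_tendsto_of_le_of_le tendsto_const_nhds h (fun _ => zero_le)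
      (fun n => (measure_mono ?_).trans (measure_union_le _ _))
    intro ω hω
    by_cases hA' : (n, ω) ∈ A
    · exact Or.inr fun hB' => hω ⟨hA', hB'⟩
    · exact Or.inl hA'

variable {P : Measure Ω}

lemma eventually_whp_iff {p : ℕ × Ω → Prop} :
    (∀ᶠ x in whp P, p x) ↔ Tendsto (fun n => P {ω | ¬ p (n, ω)}) atTop (𝓝 0) := Iff.rfl

lemma eventually_whp_of_ae {p : ℕ × Ω → Prop} (h : ∀ᶠ n in atTop, ∀ᵐ ω ∂P, p (n, ω)) :
    ∀ᶠ x in whp P, p x := by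
  rw [eventually_whp_iff]
  refine tendsto_const_nhds.congr' ?_
  filter_upwards [h] with n hn
  exact (ae_iff.1 hn).symm

lemma tendsto_fst_whp : Tendsto Prod.fst (whp P) atTop := by
  intro A hA
  exact eventually_whp_of_ae (Eventually.mono hA fun n hn => Eventually.of_forall fun _ => hn)

lemma tendsto_whp_iff_tendstoInMeasure {X : ℕ → Ω → ℝ} {a : ℝ} :
    Tendsto (fun p : ℕ × Ω => X p.1 p.2) (whp P) (𝓝 a) ↔
      TendstoInMeasure P X atTop (fun _ => a) := by
  rw [Metric.tendsto_nhds, tendstoInMeasure_iff_dist]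
  refine forall_congr' fun ε => forall_congr' fun _ => ?_
  rw [eventually_whp_iff]
  simp only [not_lt]

lemma BoundedInProb.eventually_le {X : ℕ → Ω → ℝ} (hX : BoundedInProb P X) {ε : ℝ≥0∞}
    (hε : 0 < ε) : ∃ K : ℝ, 0 < K ∧ ∀ᶠ n in atTop, P {ω | K < |X n ω|} ≤ ε := by
  obtain ⟨K, hK⟩ := hX ε hε
  refine ⟨max K 1, by positivity, hK.mono fun n hn => (measure_mono ?_).trans hn⟩
  intro ω hω
  exact (le_max_left K 1).trans_lt hω

/-- Domination up to events of vanishing probability preserves boundedness in probability. -/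
lemma BoundedInProb.mono {X Y : ℕ → Ω → ℝ} (hX : BoundedInProb P X)
    (h : ∀ᶠ p in whp P, |Y p.1 p.2| ≤ |X p.1 p.2|) : BoundedInProb P Y := by
  intro ε hε
  have hε2 : 0 < ε / 2 := ENNReal.half_pos hε.ne'
  obtain ⟨K, hK⟩ := hX _ hε2
  refine ⟨K, ?_⟩
  filter_upwards [hK, (eventually_whp_iff.1 h).eventually_le_const hε2] with n h1 h2
  calc P {ω | K < |Y n ω|}
      ≤ P ({ω | K < |X n ω|} ∪ {ω | ¬ |Y n ω| ≤ |X n ω|}) := by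
        refine measure_mono fun ω hω => ?_
        by_cases h3 : |Y n ω| ≤ |X n ω|
        · exact Or.inl (lt_of_lt_of_le hω h3)
        · exact Or.inr h3
    _ ≤ ε / 2 + ε / 2 := (measure_union_le _ _).trans (add_le_add h1 h2)
    _ = ε := ENNReal.add_halves ε

lemma BoundedInProb.map₂ {X Y : ℕ → Ω → ℝ} (hX : BoundedInProb P X) (hY : BoundedInProb P Y)
    {f : ℝ → ℝ → ℝ} {b : ℝ → ℝ → ℝ} (hb : ∀ x y K L, |x| ≤ K → |y| ≤ L → |f x y| ≤ b K L) :
    BoundedInProb P fun n ω => f (X n ω) (Y n ω) := by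
  intro ε hε
  have hε2 : 0 < ε / 2 := ENNReal.half_pos hε.ne'
  obtain ⟨K, hK⟩ := hX _ hε2
  obtain ⟨L, hL⟩ := hY _ hε2
  refine ⟨b K L, ?_⟩
  filter_upwards [hK, hL] with n h1 h2
  calc P {ω | b K L < |f (X n ω) (Y n ω)|}
      ≤ P ({ω | K < |X n ω|} ∪ {ω | L < |Y n ω|}) := by
        refine measure_mono fun ω hω => ?_
        by_contra h3
        simp only [Set.mem_union, Set.mem_ofPred_eq, not_or, not_lt] at h3
        exact absurd hω (not_lt.2 (hb _ _ _ _ h3.1 h3.2))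
    _ ≤ ε / 2 + ε / 2 := (measure_union_le _ _).trans (add_le_add h1 h2)
    _ = ε := ENNReal.add_halves ε

lemma BoundedInProb.add {X Y : ℕ → Ω → ℝ} (hX : BoundedInProb P X) (hY : BoundedInProb P Y) :
    BoundedInProb P fun n ω => X n ω + Y n ω :=
  hX.map₂ hY (f := fun x y => x + y) (b := fun K L => K + L) fun _ _ _ _ h1 h2 =>
    (abs_add_le _ _).trans (add_le_add h1 h2)

lemma BoundedInProb.mul {X Y : ℕ → Ω → ℝ} (hX : BoundedInProb P X) (hY : BoundedInProb P Y) :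
    BoundedInProb P fun n ω => X n ω * Y n ω :=
  hX.map₂ hY (f := fun x y => x * y) (b := fun K L => K * L) fun _ _ _ _ h1 h2 => by
    rw [abs_mul]
    exact mul_le_mul h1 h2 (abs_nonneg _) ((abs_nonneg _).trans h1)

lemma BoundedInProb.of_tendsto {X : ℕ → Ω → ℝ} {a : ℝ}
    (h : Tendsto (fun p : ℕ × Ω => X p.1 p.2) (whp P) (𝓝 a)) : BoundedInProb P X := by
  intro ε hε
  refine ⟨|a| + 1, ?_⟩
  have h1 : ∀ᶠ p in whp P, |X p.1 p.2| ≤ |a| + 1 := h.abs.eventually_le_const (by linarith)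
  filter_upwards [(eventually_whp_iff.1 h1).eventually_le_const hε] with n hn
  simpa only [not_le] using hn

lemma BoundedInProb.const (c : ℝ) : BoundedInProb P fun _ _ => c :=
  BoundedInProb.of_tendsto (a := c) tendsto_const_nhds

lemma BoundedInProb.pow {X : ℕ → Ω → ℝ} (hX : BoundedInProb P X) (k : ℕ) :
    BoundedInProb P fun n ω => X n ω ^ k := by
  induction k with
  | zero => simpa using BoundedInProb.const 1
  | succ k ih => simpa only [pow_succ] using ih.mul hX

lemma BoundedInProb.finset_sum {ι : Type*} (t : Finset ι) {X : ι → ℕ → Ω → ℝ}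
    (hX : ∀ i ∈ t, BoundedInProb P (X i)) : BoundedInProb P fun n ω => ∑ i ∈ t, X i n ω := by
  classical
  induction t using Finset.induction_on with
  | empty => simpa using BoundedInProb.const 0
  | insert i t hi ih =>
    simp only [Finset.sum_insert hi]
    exact (hX i (Finset.mem_insert_self i t)).add
      (ih fun j hj => hX j (Finset.mem_insert_of_mem hj))

/-- `o_P(1) · O_P(1) = o_P(1)`. -/
lemma BoundedInProb.tendsto_mul_zero {X Y : ℕ → Ω → ℝ} (hX : BoundedInProb P X)
    (hY : Tendsto (fun p : ℕ × Ω => Y p.1 p.2) (whp P) (𝓝 0)) :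
    Tendsto (fun p : ℕ × Ω => Y p.1 p.2 * X p.1 p.2) (whp P) (𝓝 0) := by
  rw [Metric.tendsto_nhds]
  intro δ hδ
  rw [eventually_whp_iff, ENNReal.tendsto_nhds_zero]
  intro ε hε
  have hε2 : 0 < ε / 2 := ENNReal.half_pos hε.ne'
  obtain ⟨K, hK0, hK⟩ := hX.eventually_le hε2
  have h1 : ∀ᶠ p in whp P, |Y p.1 p.2| < δ / K := by
    have := hY.abs
    rw [abs_zero] at this
    exact this.eventually_lt_const (by positivity)
  filter_upwards [hK, (eventually_whp_iff.1 h1).eventually_le_const hε2] with n h2 h3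
  calc P {ω | ¬ dist (Y n ω * X n ω) 0 < δ}
      ≤ P ({ω | K < |X n ω|} ∪ {ω | ¬ |Y n ω| < δ / K}) := by
        refine measure_mono fun ω hω => ?_
        by_contra h4
        simp only [Set.mem_union, Set.mem_ofPred_eq, not_or, not_lt, not_le] at h4
        refine hω ?_
        rw [dist_zero_right, Real.norm_eq_abs, abs_mul]
        calc |Y n ω| * |X n ω| ≤ |Y n ω| * K := by gcongr; exact h4.1
          _ < δ / K * K := by gcongr; exact h4.2
          _ = δ := by field_simp
    _ ≤ ε / 2 + ε / 2 := (measure_union_le _ _).trans (add_le_add h2 h3)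
    _ = ε := ENNReal.add_halves ε

end Whp

/-! ### Moments of finite samples drawn with replacement -/

section FiniteSampling

variable {n s : ℕ} {p : Fin n → ℝ}

lemma sum_prod_mul_prod (p : Fin n → ℝ) (f : Fin s → Fin n → ℝ) :
    ∑ k : Fin s → Fin n, (∏ j, p (k j)) * ∏ j, f j (k j) = ∏ j, ∑ i, p i * f j i := by
  have h := Finset.prod_univ_sum (fun _ : Fin s => (Finset.univ : Finset (Fin n)))
    (fun j i => p i * f j i)
  rw [Fintype.piFinset_univ] at h
  rw [h]
  exact Finset.sum_congr rfl fun k _ => Finset.prod_mul_distrib.symm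

lemma sum_prod_mul_coord (hp1 : ∑ i, p i = 1) (x : Fin n → ℝ) (j₀ : Fin s) :
    ∑ k : Fin s → Fin n, (∏ j, p (k j)) * x (k j₀) = ∑ i, p i * x i := by
  have h := sum_prod_mul_prod p (fun j i => if j = j₀ then x i else 1)
  have h1 : ∀ k : Fin s → Fin n, ∏ j, (if j = j₀ then x (k j) else 1) = x (k j₀) := fun k => by
    rw [Finset.prod_ite_eq' Finset.univ j₀ (fun j => x (k j)), if_pos (Finset.mem_univ _)]
  have h2 : ∀ j, ∑ i, p i * (if j = j₀ then x i else 1) =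
      if j = j₀ then ∑ i, p i * x i else 1 := fun j => by
    split_ifs <;> simp [hp1]
  simp only [h1, h2] at h
  rw [h, Finset.prod_ite_eq' Finset.univ j₀ (fun _ => ∑ i, p i * x i),
    if_pos (Finset.mem_univ _)]

lemma sum_prod_mul_coord_mul_coord (hp1 : ∑ i, p i = 1) (x : Fin n → ℝ) {j₀ j₁ : Fin s}
    (hj : j₀ ≠ j₁) :
    ∑ k : Fin s → Fin n, (∏ j, p (k j)) * (x (k j₀) * x (k j₁)) = (∑ i, p i * x i) ^ 2 := by
  have h := sum_prod_mul_prod p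
    (fun j i => (if j = j₀ then x i else 1) * (if j = j₁ then x i else 1))
  have h1 : ∀ k : Fin s → Fin n, ∏ j, ((if j = j₀ then x (k j) else 1) *
      (if j = j₁ then x (k j) else 1)) = x (k j₀) * x (k j₁) := fun k => by
    rw [Finset.prod_mul_distrib, Finset.prod_ite_eq' Finset.univ j₀ (fun j => x (k j)),
      Finset.prod_ite_eq' Finset.univ j₁ (fun j => x (k j)), if_pos (Finset.mem_univ _),
      if_pos (Finset.mem_univ _)]
  have h2 : ∀ j, ∑ i, p i * ((if j = j₀ then x i else 1) * (if j = j₁ then x i else 1)) =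
      (if j = j₀ then ∑ i, p i * x i else 1) * (if j = j₁ then ∑ i, p i * x i else 1) := fun j => by
    by_cases h0 : j = j₀
    · have h3 : j ≠ j₁ := fun h => hj (h0.symm.trans h)
      simp [h0, hj]
    · by_cases h3 : j = j₁ <;> simp [h0, h3, hp1, hj.symm]
  simp only [h1, h2] at h
  rw [h, Finset.prod_mul_distrib, Finset.prod_ite_eq' Finset.univ j₀ (fun _ => ∑ i, p i * x i),
    Finset.prod_ite_eq' Finset.univ j₁ (fun _ => ∑ i, p i * x i), if_pos (Finset.mem_univ _),
    if_pos (Finset.mem_univ _), sq]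

/-- The variance of the average of `s` independent draws is at most `s⁻¹` times the second moment
of one draw. -/
lemma sum_prod_mul_sq_mean_sub_le (hs : 0 < s) (hp1 : ∑ i, p i = 1) (y : Fin n → ℝ) :
    ∑ k : Fin s → Fin n, (∏ j, p (k j)) * ((s : ℝ)⁻¹ * ∑ j, y (k j) - ∑ i, p i * y i) ^ 2 ≤
      (s : ℝ)⁻¹ * ∑ i, p i * y i ^ 2 := by
  have hs' : (s : ℝ) ≠ 0 := by exact_mod_cast hs.ne'
  set b := ∑ i, p i * y i with hb
  set x : Fin n → ℝ := fun i => y i - b with hx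
  have hx0 : ∑ i, p i * x i = 0 := by
    simp only [hx, mul_sub, Finset.sum_sub_distrib, ← Finset.sum_mul, hp1, one_mul]
    rw [← hb, sub_self]
  have hx2 : ∑ i, p i * x i ^ 2 ≤ ∑ i, p i * y i ^ 2 := by
    have : ∑ i, p i * x i ^ 2 = ∑ i, p i * y i ^ 2 - b ^ 2 := by
      have h1 : ∀ i, p i * x i ^ 2 = p i * y i ^ 2 - 2 * b * (p i * y i) + p i * b ^ 2 :=
        fun i => by simp only [hx]; ring
      simp only [h1, Finset.sum_add_distrib, Finset.sum_sub_distrib, ← Finset.mul_sum,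
        ← Finset.sum_mul, hp1, ← hb]
      ring
    rw [this]
    linarith [sq_nonneg b]
  have hk : ∀ k : Fin s → Fin n, ((s : ℝ)⁻¹ * ∑ j, y (k j) - b) ^ 2 =
      (s : ℝ)⁻¹ ^ 2 * ∑ j₀, ∑ j₁, x (k j₀) * x (k j₁) := fun k => by
    rw [← Finset.sum_mul_sum, ← sq, ← mul_pow]
    congr 1
    simp only [hx, Finset.sum_sub_distrib, Finset.sum_const, Finset.card_univ, Fintype.card_fin,
      nsmul_eq_mul]
    field_simp
  have hsum : ∑ k : Fin s → Fin n, (∏ j, p (k j)) * ((s : ℝ)⁻¹ * ∑ j, y (k j) - b) ^ 2 =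
      (s : ℝ)⁻¹ ^ 2 * ∑ j₀ : Fin s, ∑ j₁ : Fin s,
        ∑ k : Fin s → Fin n, (∏ j, p (k j)) * (x (k j₀) * x (k j₁)) := by
    simp only [hk]
    simp only [Finset.mul_sum]
    rw [Finset.sum_comm]
    refine Finset.sum_congr rfl fun j₀ _ => ?_
    rw [Finset.sum_comm]
    exact Finset.sum_congr rfl fun j₁ _ => Finset.sum_congr rfl fun k _ => by ring
  have hterm : ∀ j₀ j₁ : Fin s, ∑ k : Fin s → Fin n, (∏ j, p (k j)) * (x (k j₀) * x (k j₁)) =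
      if j₁ = j₀ then ∑ i, p i * x i ^ 2 else 0 := fun j₀ j₁ => by
    split_ifs with h
    · rw [h, ← sum_prod_mul_coord hp1 (fun i => x i ^ 2) j₀]
      exact Finset.sum_congr rfl fun k _ => by ring
    · rw [sum_prod_mul_coord_mul_coord hp1 x (Ne.symm h), hx0]
      norm_num
  rw [hsum]
  simp only [hterm, Finset.sum_ite_eq', Finset.mem_univ, if_true, Finset.sum_const,
    Finset.card_univ, Fintype.card_fin, nsmul_eq_mul]
  calc (s : ℝ)⁻¹ ^ 2 * (s * ∑ i, p i * x i ^ 2) = (s : ℝ)⁻¹ * ∑ i, p i * x i ^ 2 := by field_simp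
    _ ≤ _ := by gcongr

end FiniteSampling

/-! ### Conditional calculus for the subsample -/

section Conditional

variable {Ω : Type*} {𝒟 mΩ : MeasurableSpace Ω} {P : Measure Ω} [IsProbabilityMeasure P]
  {n s : ℕ} {w : ℕ → Ω → ℝ} {J : Fin s → Ω → ℕ}

/-- The event that the drawn indices are `k` for some `k` and `ω` lies in the set attached to
`k`. -/
def drawnEvent (n : ℕ) (J : Fin s → Ω → ℕ) (B : (Fin s → Fin n) → Set Ω) : Set Ω :=
  ⋃ k : Fin s → Fin n, {ω | ∀ j, J j ω = k j} ∩ B k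

lemma measurableSet_drawn (hJm : ∀ j, Measurable (J j)) (k : Fin s → Fin n) :
    MeasurableSet {ω | ∀ j, J j ω = k j} := by
  simp only [Set.ofPred_forall]
  exact MeasurableSet.iInter fun j => (hJm j) (measurableSet_singleton _)

lemma measurableSet_drawnEvent (h𝒟 : 𝒟 ≤ mΩ) (hJm : ∀ j, Measurable (J j))
    {B : (Fin s → Fin n) → Set Ω} (hB : ∀ k, MeasurableSet[𝒟] (B k)) :
    MeasurableSet (drawnEvent n J B) :=
  MeasurableSet.iUnion fun k => (measurableSet_drawn hJm k).inter (h𝒟 _ (hB k))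

lemma indicator_drawnEvent (B : (Fin s → Fin n) → Set Ω) (ω : Ω) :
    (drawnEvent n J B).indicator (fun _ => (1 : ℝ)) ω =
      ∑ k, (B k).indicator ({ω | ∀ j, J j ω = k j}.indicator fun _ => (1 : ℝ)) ω := by
  classical
  by_cases h : ∃ k : Fin s → Fin n, ∀ j, J j ω = k j
  · obtain ⟨k, hk⟩ := h
    have huniq : ∀ k' : Fin s → Fin n, (∀ j, J j ω = k' j) → k' = k := fun k' hk' =>
      funext fun j => Fin.ext ((hk' j).symm.trans (hk j))
    rw [Finset.sum_eq_single k]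
    · by_cases hB : ω ∈ B k
      · have h1 : ω ∈ drawnEvent n J B := Set.mem_iUnion.2 ⟨k, hk, hB⟩
        rw [Set.indicator_of_mem h1, Set.indicator_of_mem hB, Set.indicator_of_mem]
        exact hk
      · have h1 : ω ∉ drawnEvent n J B := fun h => by
          obtain ⟨k', hk', hB'⟩ := Set.mem_iUnion.1 h
          rw [huniq k' hk'] at hB'
          exact hB hB'
        rw [Set.indicator_of_notMem h1, Set.indicator_of_notMem hB]
    · intro k' _ hne
      have : ω ∉ {ω | ∀ j, J j ω = k' j} := fun h => hne (huniq k' h)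
      by_cases hB : ω ∈ B k'
      · rw [Set.indicator_of_mem hB, Set.indicator_of_notMem this]
      · rw [Set.indicator_of_notMem hB]
    · intro h; exact absurd (Finset.mem_univ k) h
  · push Not at h
    have h1 : ω ∉ drawnEvent n J B := fun h' => by
      obtain ⟨k', hk', _⟩ := Set.mem_iUnion.1 h'
      obtain ⟨j, hj⟩ := h k'
      exact hj (hk' j)
    rw [Set.indicator_of_notMem h1]
    refine (Finset.sum_eq_zero fun k _ => ?_).symm
    have : ω ∉ {ω | ∀ j, J j ω = k j} := fun h' => by
      obtain ⟨j, hj⟩ := h k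
      exact hj (h' j)
    by_cases hB : ω ∈ B k
    · rw [Set.indicator_of_mem hB, Set.indicator_of_notMem this]
    · rw [Set.indicator_of_notMem hB]

/-- The conditional probability of an event that depends on the data and on the drawn indices. -/
lemma condProb_drawnEvent (h𝒟 : 𝒟 ≤ mΩ) (hJm : ∀ j, Measurable (J j))
    (hJ : ∀ k : Fin s → Fin n,
      P⟦{ω | ∀ j, J j ω = k j} | 𝒟⟧ =ᵐ[P] fun ω => ∏ j, w (k j) ω)
    {B : (Fin s → Fin n) → Set Ω} (hB : ∀ k, MeasurableSet[𝒟] (B k)) :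
    P⟦drawnEvent n J B | 𝒟⟧ =ᵐ[P]
      fun ω => ∑ k : Fin s → Fin n, (∏ j, w (k j) ω) * (B k).indicator (fun _ => (1 : ℝ)) ω := by
  have hint : ∀ k : Fin s → Fin n,
      Integrable ({ω | ∀ j, J j ω = k j}.indicator fun _ => (1 : ℝ)) P := fun k =>
    (integrable_const 1).indicator (measurableSet_drawn hJm k)
  have h0 : (drawnEvent n J B).indicator (fun _ => (1 : ℝ)) =
      ∑ k, (B k).indicator ({ω | ∀ j, J j ω = k j}.indicator fun _ => (1 : ℝ)) := by
    funext ω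
    rw [indicator_drawnEvent, Finset.sum_apply]
  rw [h0]
  refine (condExp_finsetSum (fun k _ => (hint k).indicator (h𝒟 _ (hB k))) 𝒟).trans ?_
  have h1 : ∀ᵐ ω ∂P, ∀ k : Fin s → Fin n,
      (P[(B k).indicator ({ω | ∀ j, J j ω = k j}.indicator fun _ => (1 : ℝ)) | 𝒟]) ω =
        (∏ j, w (k j) ω) * (B k).indicator (fun _ => (1 : ℝ)) ω := by
    rw [ae_all_iff]
    intro k
    filter_upwards [condExp_indicator (hint k) (hB k), hJ k] with ω h2 h3
    rw [h2]
    by_cases hω : ω ∈ B k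
    · rw [Set.indicator_of_mem hω, Set.indicator_of_mem hω, mul_one]; exact h3
    · rw [Set.indicator_of_notMem hω, Set.indicator_of_notMem hω, mul_zero]
  filter_upwards [h1] with ω hω
  rw [Finset.sum_apply]
  exact Finset.sum_congr rfl fun k _ => hω k

lemma measureReal_eq_integral_condProb (h𝒟 : 𝒟 ≤ mΩ) {A : Set Ω} (hA : MeasurableSet A) :
    P.real A = ∫ ω, (P⟦A | 𝒟⟧) ω ∂P := by
  rw [integral_condExp h𝒟, integral_indicator hA]
  simp

/-- Almost surely the drawn indices lie in `{0, …, n - 1}`. -/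
lemma ae_exists_drawn (h𝒟 : 𝒟 ≤ mΩ) (hJm : ∀ j, Measurable (J j))
    (hJ : ∀ k : Fin s → Fin n,
      P⟦{ω | ∀ j, J j ω = k j} | 𝒟⟧ =ᵐ[P] fun ω => ∏ j, w (k j) ω)
    (hw1 : ∀ ω, ∑ i : Fin n, w i ω = 1) :
    ∀ᵐ ω ∂P, ∃ k : Fin s → Fin n, ∀ j, J j ω = k j := by
  have hB : ∀ k : Fin s → Fin n, MeasurableSet[𝒟] ((fun _ => Set.univ) k : Set Ω) :=
    fun _ => MeasurableSet.univ
  have hm := measurableSet_drawnEvent (n := n) h𝒟 hJm hB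
  have h1 : P.real (drawnEvent n J fun _ => Set.univ) = 1 := by
    rw [measureReal_eq_integral_condProb h𝒟 hm,
      integral_congr_ae (condProb_drawnEvent h𝒟 hJm hJ hB)]
    have : ∀ ω, ∑ k : Fin s → Fin n, ∏ j, w (k j) ω = 1 := fun ω =>
      sum_prod_eq_one (p := fun i : Fin n => w i ω) (hw1 ω)
    simp [this]
  have h2 : P (drawnEvent n J fun _ => Set.univ) = 1 := by
    rw [← ENNReal.toReal_eq_one_iff]; exact h1
  have h3 := (prob_compl_eq_zero_iff hm).2 h2
  rw [ae_iff]
  refine measure_mono_null ?_ h3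
  intro ω hω h
  obtain ⟨k, hk, _⟩ := Set.mem_iUnion.1 h
  exact hω ⟨k, hk⟩

/-- Conditional Markov inequality: a nonnegative function of the data and of the drawn indices is
small if its conditional expectation given the data is small. -/
lemma conditional_markov (h𝒟 : 𝒟 ≤ mΩ) (hJm : ∀ j, Measurable (J j))
    (hJ : ∀ k : Fin s → Fin n,
      P⟦{ω | ∀ j, J j ω = k j} | 𝒟⟧ =ᵐ[P] fun ω => ∏ j, w (k j) ω)
    (hwm : ∀ i < n, Measurable[𝒟] (w i)) (hw0 : ∀ i < n, ∀ ω, 0 ≤ w i ω)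
    (hw1 : ∀ ω, ∑ i : Fin n, w i ω = 1)
    {F : (Fin s → ℕ) → Ω → ℝ} (hF0 : ∀ k ω, 0 ≤ F k ω)
    (hFm : ∀ k : Fin s → Fin n, Measurable[𝒟] (F fun j => k j)) {c t : ℝ} (hc : 0 ≤ c)
    (ht : 0 < t) :
    P {ω | t ≤ F (fun j => J j ω) ω} ≤
      P {ω | c < ∑ k : Fin s → Fin n, (∏ j, w (k j) ω) * F (fun j => k j) ω} +
        ENNReal.ofReal (c / t) := by
  set E : Ω → ℝ := fun ω => ∑ k : Fin s → Fin n, (∏ j, w (k j) ω) * F (fun j => k j) ω with hE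
  have hEm : Measurable[𝒟] E := Finset.measurable_sum _ fun k _ =>
    (Finset.measurable_prod _ fun j _ => hwm (k j) (k j).2).mul (hFm k)
  have hG : MeasurableSet[𝒟] {ω | E ω ≤ c} := measurableSet_le hEm measurable_const
  set B : (Fin s → Fin n) → Set Ω := fun k => {ω | t ≤ F (fun j => k j) ω} ∩ {ω | E ω ≤ c} with hBdef
  have hB : ∀ k, MeasurableSet[𝒟] (B k) := fun k =>
    (measurableSet_le measurable_const (hFm k)).inter hG
  have hm := measurableSet_drawnEvent (n := n) h𝒟 hJm hB
  have hprod0 : ∀ (k : Fin s → Fin n) ω, 0 ≤ ∏ j, w (k j) ω := fun k ω =>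
    Finset.prod_nonneg fun j _ => hw0 _ (k j).2 ω
  have hreal : P.real (drawnEvent n J B) ≤ c / t := by
    rw [measureReal_eq_integral_condProb h𝒟 hm,
      integral_congr_ae (condProb_drawnEvent h𝒟 hJm hJ hB)]
    have hle : ∀ ω, ∑ k : Fin s → Fin n, (∏ j, w (k j) ω) *
        (B k).indicator (fun _ => (1 : ℝ)) ω ≤ c / t := by
      intro ω
      by_cases hω : E ω ≤ c
      · rw [le_div_iff₀ ht, Finset.sum_mul]
        refine le_trans (Finset.sum_le_sum fun k _ => ?_) hω
        rw [mul_assoc]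
        refine mul_le_mul_of_nonneg_left ?_ (hprod0 k ω)
        by_cases hk : ω ∈ B k
        · rw [Set.indicator_of_mem hk, one_mul]; exact hk.1
        · rw [Set.indicator_of_notMem hk, zero_mul]; exact hF0 _ _
      · rw [Finset.sum_eq_zero]
        · positivity
        · intro k _
          rw [Set.indicator_of_notMem (fun h => hω h.2), mul_zero]
    calc _ ≤ ∫ _, c / t ∂P := by
          refine integral_mono_of_nonneg (Eventually.of_forall fun ω => ?_)
            (integrable_const _) (Eventually.of_forall hle)
          exact Finset.sum_nonneg fun k _ => mul_nonneg (hprod0 k ω)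
            (Set.indicator_nonneg (fun _ _ => zero_le_one) _)
      _ = c / t := by simp
  have hsub : ∀ᵐ ω ∂P, t ≤ F (fun j => J j ω) ω →
      ω ∈ {ω | c < E ω} ∪ drawnEvent n J B := by
    filter_upwards [ae_exists_drawn h𝒟 hJm hJ hw1] with ω ⟨k, hk⟩ hω
    by_cases h : c < E ω
    · exact Or.inl h
    · refine Or.inr (Set.mem_iUnion.2 ⟨k, hk, ?_, not_lt.1 h⟩)
      have : (fun j => J j ω) = fun j => ((k j : Fin n) : ℕ) := funext hk
      change t ≤ F (fun j => k j) ω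
      rwa [← this]
  calc P {ω | t ≤ F (fun j => J j ω) ω} ≤ P ({ω | c < E ω} ∪ drawnEvent n J B) :=
        measure_mono_ae hsub
    _ ≤ P {ω | c < E ω} + P (drawnEvent n J B) := measure_union_le _ _
    _ ≤ _ := by
        gcongr
        rw [← ofReal_measureReal]
        exact ENNReal.ofReal_le_ofReal hreal

end Conditional

/-- The conditional variance of the normalized weighted subsample average. -/
lemma sum_prod_mul_sq_weighted_sub_le {n s : ℕ} (hn : 0 < n) (hs : 0 < s) {p : Fin n → ℝ}
    (hp0 : ∀ i, 0 < p i) (hp1 : ∑ i, p i = 1) (y : Fin n → ℝ) {K : ℝ}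
    (hK : ∀ i, ((n : ℝ) * p i)⁻¹ ≤ K) :
    ∑ k : Fin s → Fin n, (∏ j, p (k j)) *
      (√(s : ℝ) * (∑ j, ((n : ℝ) * s * p (k j))⁻¹ * y (k j) - (n : ℝ)⁻¹ * ∑ i, y i)) ^ 2 ≤
      K * ((n : ℝ)⁻¹ * ∑ i, y i ^ 2) := by
  have hn' : (0 : ℝ) < n := by exact_mod_cast hn
  have hs' : (0 : ℝ) < s := by exact_mod_cast hs
  let x : Fin n → ℝ := fun i => ((n : ℝ) * p i)⁻¹ * y i
  have hmean : ∑ i : Fin n, p i * x i = (n : ℝ)⁻¹ * ∑ i, y i := by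
    rw [Finset.mul_sum]
    refine Finset.sum_congr rfl fun i _ => ?_
    have := (hp0 i).ne'
    simp only [x]
    field_simp
  have h1 := sum_prod_mul_sq_mean_sub_le hs hp1 x
  rw [hmean] at h1
  have h2 : ∀ k : Fin s → Fin n,
      (√(s : ℝ) * (∑ j, ((n : ℝ) * s * p (k j))⁻¹ * y (k j) - (n : ℝ)⁻¹ * ∑ i, y i)) ^ 2 =
      s * ((s : ℝ)⁻¹ * ∑ j, x (k j) - (n : ℝ)⁻¹ * ∑ i, y i) ^ 2 := fun k => by
    have h3 : (s : ℝ)⁻¹ * ∑ j, x (k j) = ∑ j, ((n : ℝ) * s * p (k j))⁻¹ * y (k j) := by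
      rw [Finset.mul_sum]
      refine Finset.sum_congr rfl fun j _ => ?_
      simp only [x]
      rw [mul_inv, mul_inv, mul_inv]
      ring
    rw [mul_pow, Real.sq_sqrt hs'.le, h3]
  calc _ = s * ∑ k : Fin s → Fin n, (∏ j, p (k j)) *
          ((s : ℝ)⁻¹ * ∑ j, x (k j) - (n : ℝ)⁻¹ * ∑ i, y i) ^ 2 := by
        simp only [h2, mul_left_comm _ (s : ℝ)]
        rw [← Finset.mul_sum]
    _ ≤ s * ((s : ℝ)⁻¹ * ∑ i : Fin n, p i * x i ^ 2) := by gcongr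
    _ = ∑ i : Fin n, p i * x i ^ 2 := by field_simp
    _ = ∑ i : Fin n, (n : ℝ)⁻¹ * (((n : ℝ) * p i)⁻¹ * y i ^ 2) := by
        refine Finset.sum_congr rfl fun i _ => ?_
        have := (hp0 i).ne'
        simp only [x]
        field_simp
    _ ≤ ∑ i : Fin n, (n : ℝ)⁻¹ * (K * y i ^ 2) := by
        gcongr with i
        exact hK i
    _ = _ := by rw [← Finset.mul_sum, ← Finset.mul_sum]; ring

/-! ### Averages over the full data and over the subsample -/

section Averages

variable {Ω 𝓩 : Type*} [MeasurableSpace 𝓩] {Z : ℕ → Ω → 𝓩}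

lemma measurable_dataSigma (n : ℕ) {i : ℕ} (hi : i < n) : Measurable[dataSigma Z n] (Z i) :=
  (measurable_pi_apply (⟨i, hi⟩ : Fin n)).comp
    (comap_measurable (fun ω (i : Fin n) => Z i ω))

lemma inv_mul_weight_le_iSup (π : ℕ → ℕ → Ω → ℝ) (n : ℕ) (ω : Ω) (i : Fin n) :
    ((n : ℝ) * π n i ω)⁻¹ ≤ ⨆ i : Fin n, ((n : ℝ) * π n i ω)⁻¹ :=
  le_ciSup (f := fun i : Fin n => ((n : ℝ) * π n i ω)⁻¹) (Set.finite_range _).bddAbove i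

variable [MeasurableSpace Ω] {P : Measure Ω} {μ : Measure 𝓩}

lemma dataSigma_le (hZ : ∀ i, Measurable (Z i)) (n : ℕ) :
    dataSigma Z n ≤ (inferInstance : MeasurableSpace Ω) :=
  Measurable.comap_le (measurable_pi_lambda _ fun i => hZ i)

lemma ae_forall_data (hZ : ∀ i, Measurable (Z i)) (hlaw : ∀ i, P.map (Z i) = μ) {p : 𝓩 → Prop}
    (hp : ∀ᵐ z ∂μ, p z) : ∀ᵐ ω ∂P, ∀ i, p (Z i ω) := by
  rw [ae_all_iff]
  intro i
  rw [← hlaw i] at hp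
  exact ae_of_ae_map (hZ i).aemeasurable hp

variable [IsProbabilityMeasure P]

/-- The weak law of large numbers. -/
lemma tendsto_mean_whp (hZ : ∀ i, Measurable (Z i)) (hlaw : ∀ i, P.map (Z i) = μ)
    (hind : iIndepFun Z P) {f : 𝓩 → ℝ} (hf : Integrable f μ) :
    Tendsto (fun p : ℕ × Ω => (p.1 : ℝ)⁻¹ * ∑ i : Fin p.1, f (Z i p.2)) (whp P)
      (𝓝 (∫ z, f z ∂μ)) := by
  set g := hf.1.mk f with hg
  have hgm : StronglyMeasurable g := hf.1.stronglyMeasurable_mk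
  have hfg : f =ᵐ[μ] g := hf.1.ae_eq_mk
  have hgi : Integrable g μ := hf.congr hfg
  have hae : ∀ᵐ ω ∂P, ∀ i, f (Z i ω) = g (Z i ω) := ae_forall_data hZ hlaw hfg
  have hident : ∀ i, IdentDistrib (g ∘ Z i) (g ∘ Z 0) P P := fun i =>
    (IdentDistrib.mk (hZ i).aemeasurable (hZ 0).aemeasurable
      ((hlaw i).trans (hlaw 0).symm)).comp hgm.measurable
  have hint : Integrable (g ∘ Z 0) P := by
    rw [← integrable_map_measure _ (hZ 0).aemeasurable, hlaw 0]
    · exact hgi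
    · rw [hlaw 0]; exact hgm.aestronglyMeasurable
  have hslln := strong_law_ae_real (fun i => g ∘ Z i) hint
    (fun i j hij => (hind.indepFun hij).comp hgm.measurable hgm.measurable) hident
  have hE : ∫ ω, (g ∘ Z 0) ω ∂P = ∫ z, f z ∂μ := by
    rw [integral_congr_ae hfg, ← hlaw 0, integral_map (hZ 0).aemeasurable
      hgm.aestronglyMeasurable]
    rfl
  have hmain : TendstoInMeasure P
      (fun (n : ℕ) ω => (n : ℝ)⁻¹ * ∑ i : Fin n, g (Z i ω)) atTop (fun _ => ∫ z, f z ∂μ) := by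
    refine tendstoInMeasure_of_tendsto_ae (fun n => ?_) ?_
    · exact ((Finset.measurable_sum _ fun (i : Fin n) _ =>
        hgm.measurable.comp (hZ i)).const_mul _).aestronglyMeasurable
    · filter_upwards [hslln] with ω hω
      rw [hE] at hω
      refine hω.congr fun n => ?_
      rw [Finset.sum_range, div_eq_inv_mul]
      rfl
  refine (tendsto_whp_iff_tendstoInMeasure.2 hmain).congr' ?_
  refine eventually_whp_of_ae (Eventually.of_forall fun n => ?_)
  filter_upwards [hae] with ω hω
  simp [hω]

variable {π : ℕ → ℕ → Ω → ℝ} {s : ℕ → ℕ} {J : (n : ℕ) → Fin (s n) → Ω → ℕ}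

/-- The average over the full data. -/
noncomputable def fullMean (y : ℕ → ℕ → Ω → ℝ) (n : ℕ) (ω : Ω) : ℝ :=
  (n : ℝ)⁻¹ * ∑ i : Fin n, y n i ω

/-- The inverse-probability weighted average over the subsample. -/
noncomputable def subMean (π : ℕ → ℕ → Ω → ℝ) (s : ℕ → ℕ) (J : (n : ℕ) → Fin (s n) → Ω → ℕ)
    (y : ℕ → ℕ → Ω → ℝ) (n : ℕ) (ω : Ω) : ℝ :=
  ∑ j : Fin (s n), ((n : ℝ) * s n * π n (J n j ω) ω)⁻¹ * y n (J n j ω) ω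

/-- The weighted subsample average is within `O_P(s^{-1/2})` of the full-data average, because its
conditional variance is at most `s⁻¹ · max (n π)⁻¹ · n⁻¹ ∑ y²`. -/
lemma boundedInProb_sqrt_mul_subMean_sub (hZ : ∀ i, Measurable (Z i))
    (hπ : IsSubsamplingDistribution Z π)
    (hπ_bdd : BoundedInProb P fun n ω => ⨆ i : Fin n, ((n : ℝ) * π n i ω)⁻¹)
    (hs : Tendsto s atTop atTop) (hJ : IsSubsampleWithReplacement P Z π s J)
    {y : ℕ → ℕ → Ω → ℝ} (hym : ∀ n, ∀ i < n, Measurable[dataSigma Z n] (y n i))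
    (hy : BoundedInProb P fun n ω => (n : ℝ)⁻¹ * ∑ i : Fin n, y n i ω ^ 2) :
    BoundedInProb P fun n ω => √(s n : ℝ) * (subMean π s J y n ω - fullMean y n ω) := by
  intro ε hε
  have hε2 : 0 < ε / 2 := ENNReal.half_pos hε.ne'
  obtain ⟨r, hr0, hr⟩ := ENNReal.lt_iff_exists_nnreal_btwn.1 hε2
  have hr0' : 0 < (r : ℝ) := by exact_mod_cast hr0
  obtain ⟨c, hc0, hc⟩ := (hπ_bdd.mul hy).eventually_le hε2
  set t : ℝ := c / r with ht
  have ht0 : 0 < t := by positivity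
  refine ⟨√t, ?_⟩
  filter_upwards [hc, hs.eventually_gt_atTop 0, eventually_gt_atTop 0] with n hcn hsn hn
  obtain ⟨hπm, hπ0, hπ1⟩ := hπ n hn
  obtain ⟨hJm, hJp⟩ := hJ n hn
  let F : (Fin (s n) → ℕ) → Ω → ℝ := fun k ω =>
    (√(s n : ℝ) * (∑ j, ((n : ℝ) * s n * π n (k j) ω)⁻¹ * y n (k j) ω - fullMean y n ω)) ^ 2
  have hfm : Measurable[dataSigma Z n] (fullMean y n) :=
    (show Measurable[dataSigma Z n] fun ω => ∑ i : Fin n, y n i ω from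
      Finset.measurable_sum _ fun (i : Fin n) _ => hym n i i.2).const_mul _
  have hFm : ∀ k : Fin (s n) → Fin n, Measurable[dataSigma Z n] (F fun j => k j) := by
    intro k
    have h1 : Measurable[dataSigma Z n] fun ω =>
        ∑ j, ((n : ℝ) * s n * π n (k j) ω)⁻¹ * y n (k j) ω :=
      Finset.measurable_sum _ fun j _ =>
        ((hπm (k j) (k j).2).const_mul _).inv.mul (hym n (k j) (k j).2)
    exact ((h1.sub hfm).const_mul _).pow_const 2
  have hbound : ∀ ω, ∑ k : Fin (s n) → Fin n, (∏ j, π n (k j) ω) * F (fun j => k j) ω ≤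
      (⨆ i : Fin n, ((n : ℝ) * π n i ω)⁻¹) * ((n : ℝ)⁻¹ * ∑ i : Fin n, y n i ω ^ 2) :=
    fun ω => sum_prod_mul_sq_weighted_sub_le hn hsn (p := fun i : Fin n => π n i ω)
      (fun i => hπ0 i i.2 ω) (hπ1 ω) (fun i : Fin n => y n i ω) (inv_mul_weight_le_iSup π n ω)
  have hM := conditional_markov (P := P) (dataSigma_le hZ n) hJm hJp hπm
    (fun i hi ω => (hπ0 i hi ω).le) hπ1 (F := F) (fun _ _ => sq_nonneg _) hFm hc0.le ht0
  have hsub : {ω | √t < |√(s n : ℝ) * (subMean π s J y n ω - fullMean y n ω)|} ⊆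
      {ω | t ≤ F (fun j => J n j ω) ω} := by
    intro ω hω
    have h1 : √t < |√(s n : ℝ) * (subMean π s J y n ω - fullMean y n ω)| := hω
    have h2 := Real.lt_sq_of_sqrt_lt h1
    rw [sq_abs] at h2
    exact h2.le
  have hmean : P {ω | c < ∑ k : Fin (s n) → Fin n, (∏ j, π n (k j) ω) * F (fun j => k j) ω} ≤
      ε / 2 := by
    refine (measure_mono fun ω hω => ?_).trans hcn
    exact lt_of_lt_of_le hω ((hbound ω).trans (le_abs_self _))
  have hct : ENNReal.ofReal (c / t) ≤ ε / 2 := by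
    have : c / t = r := by rw [ht]; field_simp
    rw [this, ENNReal.ofReal_coe_nnreal]
    exact hr.le
  exact ((measure_mono hsub).trans hM).trans
    ((add_le_add hmean hct).trans (ENNReal.add_halves ε).le)

end Averages

/-! ### The full-data estimator -/

section FullData

open Matrix

/-- The assumptions of the theorem on the data, the criterion function and the full-data estimator,
in normalized form: `ψ` is measurable and nonnegative, the Lipschitz condition holds almost
everywhere, and the full-data estimator takes all its values in `Θ`. -/
structure FullDataModel {d : ℕ} {Ω 𝓩 : Type*} [MeasurableSpace Ω] [MeasurableSpace 𝓩]
    (P : Measure Ω) (μ : Measure 𝓩) (Z : ℕ → Ω → 𝓩) (m : 𝓩 → Vec d → ℝ) (Θ U : Set (Vec d))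
    (θ₀ : Vec d) (ψ : 𝓩 → ℝ) (θhat : ℕ → Ω → Vec d) : Prop where
  measurable_data : ∀ i, Measurable (Z i)
  law_data : ∀ i, P.map (Z i) = μ
  indep_data : iIndepFun Z P
  isOpen : IsOpen U
  subset : Θ ⊆ U
  measurable_criterion : ∀ θ ∈ U, Measurable fun z => m z θ
  smooth : ∀ z, ContDiffOn ℝ 2 (m z) U
  isCompact : IsCompact Θ
  convex : Convex ℝ Θ
  concave : ∀ z, ConcaveOn ℝ Θ (m z)
  integrable_criterion : ∀ θ ∈ Θ, Integrable (fun z => m z θ) μ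
  popObjective_le : ∀ θ ∈ Θ, popObjective μ m θ ≤ popObjective μ m θ₀
  mem_interior : θ₀ ∈ interior Θ
  posDef_hess : (-popHess μ m θ₀).PosDef
  memLp_hess : ∀ k l, MemLp (fun z => hess m z θ₀ k l) 2 μ
  measurable_psi : Measurable ψ
  psi_nonneg : ∀ z, 0 ≤ ψ z
  memLp_psi : MemLp ψ 2 μ
  lipschitz_hess : ∀ᵐ z ∂μ, ∀ θ₁ ∈ Θ, ∀ θ₂ ∈ Θ, ∀ k l,
    |hess m z θ₁ k l - hess m z θ₂ k l| ≤ ψ z * ‖θ₁ - θ₂‖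
  measurable_estimator : ∀ n, Measurable[dataSigma Z n] (θhat n)
  estimator_mem : ∀ n ω, θhat n ω ∈ Θ
  argmax_estimator : ∀ n, ∀ᵐ ω ∂P, IsArgmax (fullObjective m Z n ω) Θ (θhat n ω)
  memLp_grad : MemLp (fun z => grad m z θ₀) 2 μ
  posDef_lambda : (popLambda μ m θ₀).PosDef
  bounded_grad : BoundedInProb P fun n ω =>
    (n : ℝ)⁻¹ * ∑ i : Fin n, ‖grad m (Z i ω) (θhat n ω)‖ ^ 4

lemma norm_le_sum_abs {d : ℕ} (u : Vec d) : ‖u‖ ≤ ∑ k, |u k| := by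
  have h : u = ∑ k, u k • EuclideanSpace.single k (1 : ℝ) := by
    ext l
    simp [Finset.sum_apply, Pi.single_apply]
  conv_lhs => rw [h]
  refine (norm_sum_le _ _).trans (le_of_eq (Finset.sum_congr rfl fun k _ => ?_))
  rw [norm_smul, Real.norm_eq_abs]
  simp

namespace FullDataModel

variable {d : ℕ} {Ω 𝓩 : Type*} [MeasurableSpace Ω] [MeasurableSpace 𝓩]
  {P : Measure Ω} {μ : Measure 𝓩}
  {Z : ℕ → Ω → 𝓩} {m : 𝓩 → Vec d → ℝ} {Θ U : Set (Vec d)}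
  {θ₀ : Vec d} {ψ : 𝓩 → ℝ} {θhat : ℕ → Ω → Vec d}

lemma memLp_grad_apply (M : FullDataModel P μ Z m Θ U θ₀ ψ θhat) (k : Fin d) :
    MemLp (fun z => grad m z θ₀ k) 2 μ :=
  M.memLp_grad.continuousLinearMap_comp (EuclideanSpace.proj (𝕜 := ℝ) k)

lemma mem (M : FullDataModel P μ Z m Θ U θ₀ ψ θhat) : θ₀ ∈ Θ := interior_subset M.mem_interior

lemma ae_lipschitz (M : FullDataModel P μ Z m Θ U θ₀ ψ θhat) :
    ∀ᵐ ω ∂P, ∀ i, ∀ θ₁ ∈ Θ, ∀ θ₂ ∈ Θ, ∀ k l,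
      |hess m (Z i ω) θ₁ k l - hess m (Z i ω) θ₂ k l| ≤ ψ (Z i ω) * ‖θ₁ - θ₂‖ :=
  ae_forall_data M.measurable_data M.law_data M.lipschitz_hess

lemma eventually_lipschitz (M : FullDataModel P μ Z m Θ U θ₀ ψ θhat) :
    ∀ᶠ p in whp P, ∀ i, ∀ θ₁ ∈ Θ, ∀ θ₂ ∈ Θ, ∀ k l,
      |hess m (Z i p.2) θ₁ k l - hess m (Z i p.2) θ₂ k l| ≤ ψ (Z i p.2) * ‖θ₁ - θ₂‖ :=
  eventually_whp_of_ae (Eventually.of_forall fun _ => M.ae_lipschitz)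

lemma exists_closedBall (M : FullDataModel P μ Z m Θ U θ₀ ψ θhat) :
    ∃ ρ : ℝ, 0 < ρ ∧ Metric.closedBall θ₀ ρ ⊆ Θ := by
  obtain ⟨ρ, hρ, h⟩ := Metric.nhds_basis_closedBall.mem_iff.1 (mem_interior_iff_mem_nhds.1
    M.mem_interior)
  exact ⟨ρ, hρ, h⟩

lemma isSymm_popHess (M : FullDataModel P μ Z m Θ U θ₀ ψ θhat) : (popHess μ m θ₀).IsSymm := by
  have h := Matrix.isHermitian_iff_isSymm.1 M.posDef_hess.isHermitian
  have h2 := h.neg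
  rwa [neg_neg] at h2

lemma isUnit_det_popHess (M : FullDataModel P μ Z m Θ U θ₀ ψ θhat) :
    IsUnit (popHess μ m θ₀).det := by
  have h := M.posDef_hess.isUnit.neg
  rw [neg_neg] at h
  exact (Matrix.isUnit_iff_isUnit_det _).1 h

lemma exists_popHess_le (M : FullDataModel P μ Z m Θ U θ₀ ψ θhat) :
    ∃ lam : ℝ, 0 < lam ∧
      ∀ u : Vec d, inner ℝ u (toEuclideanLin (popHess μ m θ₀) u) ≤ -lam * ‖u‖ ^ 2 := by
  obtain ⟨c, hc, h⟩ := exists_coercive_of_posDef M.posDef_hess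
  refine ⟨c, hc, fun u => ?_⟩
  have h1 := h u
  rw [map_neg, LinearMap.neg_apply, inner_neg_right] at h1
  linarith

/-- The Newton step `-H₀⁻¹ S` for the population Hessian `H₀`. -/
lemma popHess_newton (M : FullDataModel P μ Z m Θ U θ₀ ψ θhat) (S : Vec d) :
    toEuclideanLin (popHess μ m θ₀) (-toEuclideanLin (popHess μ m θ₀)⁻¹ S) = -S := by
  rw [map_neg, ← toEuclideanLin_mul_apply, Matrix.mul_nonsing_inv _ M.isUnit_det_popHess,
    toEuclideanLin_one_apply]

lemma tendsto_mean [IsProbabilityMeasure P] (M : FullDataModel P μ Z m Θ U θ₀ ψ θhat) {f : 𝓩 → ℝ}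
    (hf : Integrable f μ) :
    Tendsto (fun p : ℕ × Ω => (p.1 : ℝ)⁻¹ * ∑ i : Fin p.1, f (Z i p.2)) (whp P)
      (𝓝 (∫ z, f z ∂μ)) :=
  tendsto_mean_whp M.measurable_data M.law_data M.indep_data hf

variable [IsProbabilityMeasure μ]

lemma integrable_psi (M : FullDataModel P μ Z m Θ U θ₀ ψ θhat) : Integrable ψ μ :=
  M.memLp_psi.integrable (by norm_num)

lemma integrable_hess (M : FullDataModel P μ Z m Θ U θ₀ ψ θhat) (k l : Fin d) :
    Integrable (fun z => hess m z θ₀ k l) μ :=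
  (M.memLp_hess k l).integrable (by norm_num)

lemma integrable_grad (M : FullDataModel P μ Z m Θ U θ₀ ψ θhat) :
    Integrable (fun z => grad m z θ₀) μ :=
  M.memLp_grad.integrable (by norm_num)

/-- The expected gradient has no positive component at the population maximizer, because
`0 ≥ E m(Z, θ₀ + t u) - E m(Z, θ₀) ≥ t E⟪ṁ(Z, θ₀), u⟫ - O(t²)`. -/
lemma integral_inner_grad_nonpos (M : FullDataModel P μ Z m Θ U θ₀ ψ θhat) (u : Vec d) :
    ∫ z, inner ℝ (grad m z θ₀) u ∂μ ≤ 0 := by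
  set a := ∫ z, inner ℝ (grad m z θ₀) u ∂μ with ha
  have hHint : Integrable (fun z => inner ℝ u (toEuclideanLin (hess m z θ₀) u)) μ := by
    simp only [inner_toEuclideanLin]
    exact integrable_finsetSum _ fun k _ => integrable_finsetSum _ fun l _ =>
      (M.integrable_hess k l).mul_const _
  set b := ∫ z, inner ℝ u (toEuclideanLin (hess m z θ₀) u) ∂μ with hb
  set c := ∫ z, ψ z ∂μ with hc
  have hgint : Integrable (fun z => inner ℝ (grad m z θ₀) u) μ := M.integrable_grad.inner_const u
  have hsmall : ∀ᶠ t in 𝓝[>] (0 : ℝ), a ≤ t * (-(1 / 2 * b) + t * (d * c * ‖u‖ ^ 3)) := by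
    have h1 : Tendsto (fun t : ℝ => θ₀ + t • u) (𝓝 0) (𝓝 θ₀) := by
      have : Continuous fun t : ℝ => θ₀ + t • u := by fun_prop
      simpa using this.tendsto 0
    have h2 : ∀ᶠ t in 𝓝[>] (0 : ℝ), θ₀ + t • u ∈ Θ := by
      refine (h1.eventually (mem_interior_iff_mem_nhds.1 M.mem_interior)).filter_mono ?_
      exact nhdsWithin_le_nhds
    filter_upwards [h2, self_mem_nhdsWithin] with t ht ht0
    have ht0' : 0 < t := ht0
    have hgt : Integrable (fun z => t * inner ℝ (grad m z θ₀) u) μ := hgint.const_mul _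
    have hHt : Integrable (fun z => t ^ 2 * (1 / 2) *
        inner ℝ u (toEuclideanLin (hess m z θ₀) u)) μ := hHint.const_mul _
    have hψt : Integrable (fun z => t ^ 3 * (d * ‖u‖ ^ 3) * ψ z) μ := M.integrable_psi.const_mul _
    have hadd : Integrable (fun z => t * inner ℝ (grad m z θ₀) u + t ^ 2 * (1 / 2) *
        inner ℝ u (toEuclideanLin (hess m z θ₀) u)) μ := hgt.add hHt
    have hle : ∫ z, (t * inner ℝ (grad m z θ₀) u + t ^ 2 * (1 / 2) *
        inner ℝ u (toEuclideanLin (hess m z θ₀) u) - t ^ 3 * (d * ‖u‖ ^ 3) * ψ z) ∂μ ≤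
        ∫ z, (m z (θ₀ + t • u) - m z θ₀) ∂μ := by
      refine integral_mono_ae (hadd.sub hψt) ((M.integrable_criterion _ ht).sub (M.integrable_criterion _ M.mem)) ?_
      filter_upwards [M.lipschitz_hess] with z hz
      have h3 := (abs_le.1 (abs_taylor_two_le M.isOpen M.subset M.smooth M.convex hz M.mem ht)).1
      rw [add_sub_cancel_left, map_smul, inner_smul_left, inner_smul_right, inner_smul_right,
        norm_smul, Real.norm_eq_abs, abs_of_pos ht0'] at h3
      simp only [conj_trivial] at h3
      linarith
    rw [integral_sub hadd hψt, integral_add hgt hHt, integral_const_mul,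
      integral_const_mul, integral_const_mul, ← ha, ← hb, ← hc,
      integral_sub (M.integrable_criterion _ ht) (M.integrable_criterion _ M.mem)] at hle
    have h4 := M.popObjective_le _ ht
    rw [popObjective, popObjective] at h4
    have h5 : t * a ≤ t * (t * (-(1 / 2 * b) + t * (d * c * ‖u‖ ^ 3))) := by nlinarith
    exact le_of_mul_le_mul_left h5 ht0'
  have hlim : Tendsto (fun t : ℝ => t * (-(1 / 2 * b) + t * (d * c * ‖u‖ ^ 3))) (𝓝[>] 0)
      (𝓝 0) := by
    have : Continuous fun t : ℝ => t * (-(1 / 2 * b) + t * (d * c * ‖u‖ ^ 3)) := by fun_prop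
    have h := this.tendsto 0
    simp only [zero_mul] at h
    exact h.mono_left nhdsWithin_le_nhds
  exact ge_of_tendsto hlim hsmall

lemma integral_grad_apply (M : FullDataModel P μ Z m Θ U θ₀ ψ θhat) (k : Fin d) :
    ∫ z, grad m z θ₀ k ∂μ = 0 := by
  simp only [grad_apply_eq_inner]
  refine le_antisymm (M.integral_inner_grad_nonpos _) ?_
  have h := M.integral_inner_grad_nonpos (-EuclideanSpace.single k 1)
  simp only [inner_neg_right, integral_neg] at h
  linarith

variable [IsProbabilityMeasure P]

/-- Consistency of the full-data estimator. Concavity reduces the claim to a small ball around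
`θ₀`, on which the objective is nearly quadratic. -/
theorem tendsto_norm_estimator_sub (M : FullDataModel P μ Z m Θ U θ₀ ψ θhat) :
    Tendsto (fun p : ℕ × Ω => ‖θhat p.1 p.2 - θ₀‖) (whp P) (𝓝 0) := by
  obtain ⟨lam, hlam, hH⟩ := M.exists_popHess_le
  obtain ⟨ρ, hρ, hball⟩ := M.exists_closedBall
  obtain ⟨C, hC, hCle⟩ := exists_norm_toEuclideanLin_le (popHess μ m θ₀)⁻¹
  set Eψ := ∫ z, ψ z ∂μ with hEψ
  have hEψ0 : 0 ≤ Eψ := integral_nonneg M.psi_nonneg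
  let S : ℕ × Ω → Vec d := fun p => ∑ i : Fin p.1, (p.1 : ℝ)⁻¹ • grad m (Z i p.2) θ₀
  let e : ℕ × Ω → Vec d := fun p => -toEuclideanLin (popHess μ m θ₀)⁻¹ (S p)
  let Ψ : ℕ × Ω → ℝ := fun p => (p.1 : ℝ)⁻¹ * ∑ i : Fin p.1, ψ (Z i p.2)
  have hS : Tendsto (fun p => ‖S p‖) (whp P) (𝓝 0) := by
    have h1 : Tendsto (fun p => ∑ k, |S p k|) (whp P) (𝓝 (∑ _k : Fin d, |(0 : ℝ)|)) := by
      refine tendsto_finsetSum _ fun k _ => Tendsto.abs ?_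
      have h2 := M.tendsto_mean ((M.memLp_grad_apply k).integrable (by norm_num))
      rw [M.integral_grad_apply k] at h2
      refine h2.congr fun p => ?_
      simp only [S]
      rw [Finset.mul_sum]
      simp
    simp only [abs_zero, Finset.sum_const_zero] at h1
    exact squeeze_zero (fun _ => norm_nonneg _) (fun p => norm_le_sum_abs _) h1
  have he : Tendsto (fun p => ‖e p‖) (whp P) (𝓝 0) := by
    refine squeeze_zero (fun _ => norm_nonneg _) (fun p => ?_) (by simpa using hS.const_mul C)
    simp only [e, norm_neg]
    exact hCle _
  have hlimH : ∀ k l, Tendsto (fun p : ℕ × Ω => (Matrix.of fun k l => (p.1 : ℝ)⁻¹ *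
      ∑ i : Fin p.1, hess m (Z i p.2) θ₀ k l) k l) (whp P) (𝓝 (popHess μ m θ₀ k l)) := fun k l =>
    M.tendsto_mean (f := fun z => hess m z θ₀ k l) (M.integrable_hess k l)
  obtain ⟨κ, hκ0, hκ, hκle⟩ := exists_entrywise_bound hlimH
  have hΨ : Tendsto Ψ (whp P) (𝓝 Eψ) := M.tendsto_mean M.integrable_psi
  rw [Metric.tendsto_nhds]
  intro ε hε
  -- the cubic remainder is dominated by the quadratic term at this radius
  set r := min (ε / 4) (min (ρ / 2) (lam / (8 * (d * Eψ + 1)))) with hr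
  have hr0 : 0 < r := by positivity
  have hr1 : r ≤ ε / 4 := min_le_left _ _
  have hr2 : r ≤ ρ / 2 := (min_le_right _ _).trans (min_le_left _ _)
  have hr3 : r * (8 * (d * Eψ + 1)) ≤ lam := by
    have h1 : r ≤ lam / (8 * (d * Eψ + 1)) := (min_le_right _ _).trans (min_le_right _ _)
    rwa [le_div_iff₀ (by positivity)] at h1
  have hlim : Tendsto (fun p => d * κ p * (‖e p‖ + r) ^ 2 + 2 * (d * Ψ p * (‖e p‖ + r) ^ 3))
      (whp P) (𝓝 (d * 0 * (0 + r) ^ 2 + 2 * (d * Eψ * (0 + r) ^ 3))) :=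
    (((hκ.const_mul _).mul ((he.add_const r).pow 2))).add
      (((hΨ.const_mul _).mul ((he.add_const r).pow 3)).const_mul 2)
  have hlt : d * 0 * (0 + r) ^ 2 + 2 * (d * Eψ * (0 + r) ^ 3) < lam / 2 * r ^ 2 := by
    have h1 : d * Eψ * r ≤ lam / 8 := by nlinarith
    have h2 : 0 < r ^ 2 := by positivity
    have h3 : d * Eψ * r * r ^ 2 ≤ lam / 8 * r ^ 2 := by gcongr
    have h4 : 0 < lam * r ^ 2 := by positivity
    nlinarith
  have hargmax : ∀ᶠ p in whp P, IsArgmax (fullObjective m Z p.1 p.2) Θ (θhat p.1 p.2) :=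
    eventually_whp_of_ae (Eventually.of_forall fun n => M.argmax_estimator n)
  filter_upwards [hlim.eventually_lt_const hlt, he.eventually_le_const hr0, hargmax,
    M.eventually_lipschitz] with p h1 h2 h3 h4
  have h5 := norm_argmax_weighted_sum_sub_le (w := fun _ : Fin p.1 => (p.1 : ℝ)⁻¹)
    (z := fun i => Z i p.2) (ψ := fun i => ψ (Z i p.2)) (θs := θhat p.1 p.2) (c := θ₀) (e := e p)
    (ρ := ρ) (r := r) (κ := κ p) (Ψ := Ψ p)
    M.isOpen M.subset M.smooth M.concave M.convex (fun _ => by positivity) (fun i => h4 i)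
    (by
      have : (fun θ => ∑ i : Fin p.1, (p.1 : ℝ)⁻¹ * m (Z i p.2) θ) = fullObjective m Z p.1 p.2 := by
        funext θ; rw [fullObjective, Finset.mul_sum]
      rw [this]; exact h3)
    hr0 hball M.isSymm_popHess hH (M.popHess_newton _)
    (hκ0 p)
    (mul_nonneg (by positivity) (Finset.sum_nonneg fun _ _ => M.psi_nonneg _))
    (fun k l => by
      rw [← Finset.mul_sum]
      exact hκle p k l)
    (by rw [← Finset.mul_sum]) (by linarith) h1
  rw [Real.dist_eq, sub_zero, abs_of_nonneg (norm_nonneg _)]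
  have h6 : θhat p.1 p.2 - θ₀ = (θhat p.1 p.2 - (θ₀ + e p)) + e p := by abel
  rw [h6]
  refine (norm_add_le _ _).trans_lt ?_
  linarith

end FullDataModel

end FullData

open Matrix

/-! ### Full-data quantities at the estimator -/

lemma inner_outer (v u : Vec d) : inner ℝ u (toEuclideanLin (outer v) u) = inner ℝ v u ^ 2 := by
  rw [inner_toEuclideanLin, PiLp.inner_apply, sq, Finset.sum_mul_sum]
  refine Finset.sum_congr rfl fun k _ => Finset.sum_congr rfl fun l _ => ?_
  simp only [outer, Matrix.of_apply, RCLike.inner_apply, conj_trivial]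
  ring

lemma fullHess_apply {d : ℕ} {Ω 𝓩 : Type*} (m : 𝓩 → Vec d → ℝ) (Z : ℕ → Ω → 𝓩) (n : ℕ) (ω : Ω)
    (θ : Vec d) (k l : Fin d) :
    fullHess m Z n ω θ k l = (n : ℝ)⁻¹ * ∑ i : Fin n, hess m (Z i ω) θ k l := by
  simp [fullHess, Matrix.sum_apply]

lemma lambdaR_apply {d : ℕ} {Ω 𝓩 : Type*} (m : 𝓩 → Vec d → ℝ) (Z : ℕ → Ω → 𝓩)
    (π : ℕ → ℕ → Ω → ℝ) (n : ℕ) (ω : Ω) (θ : Vec d) (k l : Fin d) :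
    lambdaR m Z π n ω θ k l = ((n : ℝ) ^ 2)⁻¹ * ∑ i : Fin n,
      (π n i ω)⁻¹ * (grad m (Z i ω) θ k * grad m (Z i ω) θ l) := by
  simp [lambdaR, Matrix.sum_apply, outer]

lemma inner_lambdaR {d : ℕ} {Ω 𝓩 : Type*} (m : 𝓩 → Vec d → ℝ) (Z : ℕ → Ω → 𝓩)
    (π : ℕ → ℕ → Ω → ℝ) (n : ℕ) (ω : Ω) (θ u : Vec d) :
    inner ℝ u (toEuclideanLin (lambdaR m Z π n ω θ) u) =
      ((n : ℝ) ^ 2)⁻¹ * ∑ i : Fin n, (π n i ω)⁻¹ * inner ℝ (grad m (Z i ω) θ) u ^ 2 := by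
  simp only [lambdaR, map_smul, map_sum, LinearMap.smul_apply, LinearMap.sum_apply,
    inner_smul_right, inner_sum, inner_outer]

lemma isSymm_lambdaR {d : ℕ} {Ω 𝓩 : Type*} (m : 𝓩 → Vec d → ℝ) (Z : ℕ → Ω → 𝓩)
    (π : ℕ → ℕ → Ω → ℝ) (n : ℕ) (ω : Ω) (θ : Vec d) : (lambdaR m Z π n ω θ).IsSymm := by
  refine Matrix.IsSymm.ext fun k l => ?_
  rw [lambdaR_apply, lambdaR_apply]
  congr 1
  exact Finset.sum_congr rfl fun i _ => by ring

/-- The pointwise bound behind `norm_sq_le_weighted_sum`: it combines `x² ≤ √τ |x| + x⁴ / τ` with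
the inequality between the arithmetic and the geometric mean for `√τ |x| / n`. -/
lemma inv_mul_sq_le {ν p x A τ : ℝ} (hν : 0 < ν) (hp : 0 < p) (hA : 0 < A) (hτ : 0 < τ) :
    ν⁻¹ * x ^ 2 ≤ τ / A * ((ν ^ 2)⁻¹ * (p⁻¹ * x ^ 2)) + A / 4 * p + τ⁻¹ * (ν⁻¹ * x ^ 4) := by
  obtain ⟨t, ht0, rfl⟩ : ∃ t : ℝ, 0 < t ∧ t ^ 2 = τ :=
    ⟨√τ, Real.sqrt_pos.2 hτ, Real.sq_sqrt hτ.le⟩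
  have h1 : x ^ 2 ≤ t * |x| + (t ^ 2)⁻¹ * x ^ 4 := by
    rcases le_total |x| t with hxt | hxt
    · have h2 : x ^ 2 ≤ t * |x| := by
        rw [← sq_abs, sq]; exact mul_le_mul_of_nonneg_right hxt (abs_nonneg _)
      have : 0 ≤ (t ^ 2)⁻¹ * x ^ 4 := by positivity
      linarith
    · have h2 : t ^ 2 ≤ x ^ 2 := by rw [← sq_abs x]; gcongr
      have h3 : x ^ 2 ≤ (t ^ 2)⁻¹ * x ^ 4 := by
        rw [inv_mul_eq_div, le_div_iff₀ hτ]
        nlinarith [sq_nonneg x]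
      have : 0 ≤ t * |x| := by positivity
      linarith
  have h2 : ν⁻¹ * (t * |x|) ≤ t ^ 2 / A * ((ν ^ 2)⁻¹ * (p⁻¹ * x ^ 2)) + A / 4 * p := by
    rw [← sub_nonneg]
    have : t ^ 2 / A * ((ν ^ 2)⁻¹ * (p⁻¹ * x ^ 2)) + A / 4 * p - ν⁻¹ * (t * |x|) =
        (p * A)⁻¹ * (t * (ν⁻¹ * |x|) - A / 2 * p) ^ 2 := by
      rw [← sq_abs x]
      field_simp
      ring
    rw [this]
    positivity
  have h3 := mul_le_mul_of_nonneg_left h1 (inv_nonneg.2 hν.le)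
  linarith

/-- Whatever the sampling distribution `p`, the weighted second-moment form is bounded below by the
unweighted one, `A`, and the fourth moment. -/
lemma norm_sq_le_weighted_sum {d n : ℕ} (hn : 0 < n) {p : Fin n → ℝ} (hp0 : ∀ i, 0 < p i)
    (hp1 : ∑ i, p i = 1) (g : Fin n → Vec d) {A : ℝ} (hA : 0 < A)
    (h : ∀ u : Vec d, A * ‖u‖ ^ 2 ≤ (n : ℝ)⁻¹ * ∑ i, inner ℝ (g i) u ^ 2) (u : Vec d) :
    ‖u‖ ^ 2 ≤ 8 * ((n : ℝ)⁻¹ * ∑ i, ‖g i‖ ^ 4 + 1) / A ^ 3 *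
      (((n : ℝ) ^ 2)⁻¹ * ∑ i, (p i)⁻¹ * inner ℝ (g i) u ^ 2) := by
  have hn' : (0 : ℝ) < n := by exact_mod_cast hn
  obtain ⟨b, hb⟩ : ∃ b, b = (n : ℝ)⁻¹ * ∑ i, ‖g i‖ ^ 4 := ⟨_, rfl⟩
  have hb0 : 0 ≤ b := by rw [hb]; positivity
  rw [← hb]
  have hunit : ∀ w : Vec d, ‖w‖ = 1 → 1 ≤ 8 * (b + 1) / A ^ 3 *
      (((n : ℝ) ^ 2)⁻¹ * ∑ i, (p i)⁻¹ * inner ℝ (g i) w ^ 2) := by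
    intro w hw
    have hAw := h w
    obtain ⟨x, hx⟩ : ∃ x : Fin n → ℝ, x = fun i => inner ℝ (g i) w := ⟨_, rfl⟩
    have hx4 : ∀ i, x i ^ 4 ≤ ‖g i‖ ^ 4 := by
      intro i
      have h1 := abs_real_inner_le_norm (g i) w
      rw [hw, mul_one] at h1
      rw [← (by decide : Even 4).pow_abs (x i), hx]
      exact pow_le_pow_left₀ (abs_nonneg _) h1 4
    have hxi : ∀ i, inner ℝ (g i) w = x i := fun i => by rw [hx]
    simp only [hxi, hw, one_pow, mul_one] at hAw ⊢
    -- this choice makes the last two terms of the pointwise bound sum up to at most `A / 2`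
    have hτ0 : 0 < 4 * (b + 1) / A := by positivity
    obtain ⟨τ, hτ⟩ : ∃ τ, τ = 4 * (b + 1) / A := ⟨_, rfl⟩
    rw [← hτ] at hτ0
    obtain ⟨Q, hQ⟩ : ∃ Q, Q = ((n : ℝ) ^ 2)⁻¹ * ∑ i, (p i)⁻¹ * x i ^ 2 := ⟨_, rfl⟩
    have hsum : (n : ℝ)⁻¹ * ∑ i, x i ^ 2 ≤ τ / A * Q + A / 4 + τ⁻¹ * b := by
      have hb' : (n : ℝ)⁻¹ * ∑ i, x i ^ 4 ≤ b := by
        rw [hb]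
        exact mul_le_mul_of_nonneg_left (Finset.sum_le_sum fun i _ => hx4 i) (by positivity)
      have h1 := Finset.sum_le_sum fun i (_ : i ∈ Finset.univ) =>
        inv_mul_sq_le (x := x i) hn' (hp0 i) hA hτ0
      rw [Finset.sum_add_distrib, Finset.sum_add_distrib, ← Finset.mul_sum, ← Finset.mul_sum,
        ← Finset.mul_sum, ← Finset.mul_sum, ← Finset.mul_sum, ← Finset.mul_sum, hp1, ← hQ] at h1
      have h2 := mul_le_mul_of_nonneg_left hb' (inv_nonneg.2 hτ0.le)
      linarith
    rw [← hQ]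
    have hτb : τ⁻¹ * b ≤ A / 4 := by
      rw [hτ, inv_div, div_mul_eq_mul_div, div_le_div_iff₀ (by positivity) (by norm_num)]
      nlinarith
    have hfin : A / 2 ≤ τ / A * Q := by linarith
    have h8 : 8 * (b + 1) / A ^ 3 * Q = 2 / A * (τ / A * Q) := by rw [hτ]; field_simp; ring
    rw [h8]
    calc (1 : ℝ) = 2 / A * (A / 2) := by field_simp
      _ ≤ _ := mul_le_mul_of_nonneg_left hfin (by positivity)
  rcases eq_or_ne u 0 with rfl | hu
  · simp
  have hu' : ‖u‖ ≠ 0 := norm_ne_zero_iff.2 hu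
  have h1 := hunit (‖u‖⁻¹ • u) (by simp [norm_smul, inv_mul_cancel₀ hu'])
  have h2 : ∑ i, (p i)⁻¹ * inner ℝ (g i) (‖u‖⁻¹ • u) ^ 2 =
      (‖u‖ ^ 2)⁻¹ * ∑ i, (p i)⁻¹ * inner ℝ (g i) u ^ 2 := by
    rw [Finset.mul_sum]
    refine Finset.sum_congr rfl fun i _ => ?_
    rw [inner_smul_right, mul_pow, inv_pow]
    ring
  rw [h2] at h1
  have h3 := mul_le_mul_of_nonneg_left h1 (sq_nonneg ‖u‖)
  rw [mul_one] at h3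
  refine h3.trans (le_of_eq ?_)
  field_simp

namespace FullDataModel

variable {d : ℕ} {Ω 𝓩 : Type*} [MeasurableSpace Ω] [MeasurableSpace 𝓩]
  {P : Measure Ω} {μ : Measure 𝓩} {Z : ℕ → Ω → 𝓩} {m : 𝓩 → Vec d → ℝ} {Θ U : Set (Vec d)}
  {θ₀ : Vec d} {ψ : 𝓩 → ℝ} {θhat : ℕ → Ω → Vec d}

lemma measurable_grad (M : FullDataModel P μ Z m Θ U θ₀ ψ θhat) {n i : ℕ} (hi : i < n)
    (k : Fin d) : Measurable[dataSigma Z n] fun ω => grad m (Z i ω) (θhat n ω) k :=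
  @measurable_grad_comp _ _ _ _ _ _ (dataSigma Z n) M.isOpen M.smooth M.measurable_criterion _ _
    (measurable_dataSigma n hi) (M.measurable_estimator n) (fun ω => M.subset (M.estimator_mem n ω)) k

lemma measurable_hess (M : FullDataModel P μ Z m Θ U θ₀ ψ θhat) {n i : ℕ} (hi : i < n)
    (k l : Fin d) : Measurable[dataSigma Z n] fun ω => hess m (Z i ω) (θhat n ω) k l :=
  @measurable_hess_comp _ _ _ _ _ _ (dataSigma Z n) M.isOpen M.smooth M.measurable_criterion _ _
    (measurable_dataSigma n hi) (M.measurable_estimator n) (fun ω => M.subset (M.estimator_mem n ω))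
    k l

lemma isSymm_fullHess (M : FullDataModel P μ Z m Θ U θ₀ ψ θhat) (n : ℕ) (ω : Ω) :
    (fullHess m Z n ω (θhat n ω)).IsSymm := by
  refine Matrix.IsSymm.ext fun k l => ?_
  rw [fullHess_apply, fullHess_apply]
  congr 1
  exact Finset.sum_congr rfl fun i _ =>
    (hess_isSymm M.isOpen M.smooth _ (M.subset (M.estimator_mem n ω))).apply k l

variable [IsProbabilityMeasure μ] [IsProbabilityMeasure P]

/-- The averaged Hessian at the estimator converges to the population Hessian. -/
lemma tendsto_fullHess (M : FullDataModel P μ Z m Θ U θ₀ ψ θhat) (k l : Fin d) :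
    Tendsto (fun p : ℕ × Ω => fullHess m Z p.1 p.2 (θhat p.1 p.2) k l) (whp P)
      (𝓝 (popHess μ m θ₀ k l)) := by
  have h0 : Tendsto (fun p : ℕ × Ω => fullHess m Z p.1 p.2 θ₀ k l) (whp P)
      (𝓝 (popHess μ m θ₀ k l)) := by
    have hlim : popHess μ m θ₀ k l = ∫ z, hess m z θ₀ k l ∂μ := by rw [popHess, Matrix.of_apply]
    rw [hlim]
    exact (M.tendsto_mean (f := fun z => hess m z θ₀ k l) (M.integrable_hess k l)).congr
      fun p => (fullHess_apply m Z p.1 p.2 θ₀ k l).symm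
  have hψ := (M.tendsto_mean M.integrable_psi).mul M.tendsto_norm_estimator_sub
  rw [mul_zero] at hψ
  have hdiff : Tendsto (fun p : ℕ × Ω => fullHess m Z p.1 p.2 (θhat p.1 p.2) k l -
      fullHess m Z p.1 p.2 θ₀ k l) (whp P) (𝓝 0) := by
    refine squeeze_zero_norm' ?_ hψ
    filter_upwards [M.eventually_lipschitz] with p hp
    rw [fullHess_apply, fullHess_apply, ← mul_sub, ← Finset.sum_sub_distrib, Real.norm_eq_abs,
      abs_mul, abs_of_nonneg (by positivity : (0 : ℝ) ≤ (p.1 : ℝ)⁻¹), mul_assoc, Finset.sum_mul]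
    refine mul_le_mul_of_nonneg_left ?_ (by positivity)
    exact (Finset.abs_sum_le_sum_abs _ _).trans (Finset.sum_le_sum fun i _ =>
      hp i _ (M.estimator_mem _ _) _ M.mem k l)
  simpa using hdiff.add h0

/-- The mean square of the Hessian entries at the estimator is bounded in probability. -/
lemma boundedInProb_hess_sq (M : FullDataModel P μ Z m Θ U θ₀ ψ θhat) (k l : Fin d) :
    BoundedInProb P fun n ω => (n : ℝ)⁻¹ * ∑ i : Fin n, hess m (Z i ω) (θhat n ω) k l ^ 2 := by
  have h1 := M.tendsto_mean (M.memLp_hess k l).integrable_sq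
  have h2 := (M.tendsto_mean M.memLp_psi.integrable_sq).mul (M.tendsto_norm_estimator_sub.pow 2)
  have h3 := (h1.const_mul 2).add (h2.const_mul 2)
  refine (BoundedInProb.of_tendsto (X := fun n ω => 2 * ((n : ℝ)⁻¹ * ∑ i : Fin n,
    hess m (Z i ω) θ₀ k l ^ 2) + 2 * ((n : ℝ)⁻¹ * (∑ i : Fin n, ψ (Z i ω) ^ 2) *
      ‖θhat n ω - θ₀‖ ^ 2)) h3).mono ?_
  filter_upwards [M.eventually_lipschitz] with p hp
  rw [abs_of_nonneg (by positivity), abs_of_nonneg (by positivity)]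
  have h4 : ∀ i : Fin p.1, hess m (Z i p.2) (θhat p.1 p.2) k l ^ 2 ≤
      2 * hess m (Z i p.2) θ₀ k l ^ 2 + 2 * (ψ (Z i p.2) ^ 2 * ‖θhat p.1 p.2 - θ₀‖ ^ 2) := by
    intro i
    have h5 := hp i _ (M.estimator_mem p.1 p.2) _ M.mem k l
    have h6 := sq_le_sq' (by linarith [abs_nonneg (hess m (Z i p.2) (θhat p.1 p.2) k l -
      hess m (Z i p.2) θ₀ k l)]) h5
    rw [sq_abs, mul_pow] at h6
    nlinarith [sq_nonneg (2 * hess m (Z i p.2) θ₀ k l - hess m (Z i p.2) (θhat p.1 p.2) k l)]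
  calc _ ≤ (p.1 : ℝ)⁻¹ * ∑ i : Fin p.1, (2 * hess m (Z i p.2) θ₀ k l ^ 2 +
        2 * (ψ (Z i p.2) ^ 2 * ‖θhat p.1 p.2 - θ₀‖ ^ 2)) := by gcongr with i; exact h4 i
    _ = _ := by
      rw [Finset.sum_add_distrib, ← Finset.mul_sum, ← Finset.mul_sum, ← Finset.sum_mul]
      ring

/-- The full-data gradient vanishes at the estimator once the estimator is interior. -/
lemma eventually_mean_grad_eq_zero (M : FullDataModel P μ Z m Θ U θ₀ ψ θhat) :
    ∀ᶠ p in whp P, ∑ i : Fin p.1, grad m (Z i p.2) (θhat p.1 p.2) = 0 := by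
  obtain ⟨ρ, hρ, hball⟩ := M.exists_closedBall
  have hargmax : ∀ᶠ p in whp P, IsArgmax (fullObjective m Z p.1 p.2) Θ (θhat p.1 p.2) :=
    eventually_whp_of_ae (Eventually.of_forall fun n => M.argmax_estimator n)
  filter_upwards [hargmax, M.tendsto_norm_estimator_sub.eventually_lt_const hρ,
    tendsto_fst_whp.eventually_gt_atTop 0] with p h1 h2 h3
  set θ := θhat p.1 p.2 with hθ
  have hn : (p.1 : ℝ)⁻¹ ≠ 0 := inv_ne_zero (by exact_mod_cast h3.ne')
  have hmem : Θ ∈ 𝓝 θ := by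
    refine mem_of_superset (Metric.isOpen_ball.mem_nhds ?_) (Metric.ball_subset_closedBall.trans hball)
    rwa [mem_ball_iff_norm]
  have hu : ∀ u : Vec d, inner ℝ (∑ i : Fin p.1, grad m (Z i p.2) θ) u = 0 := by
    intro u
    have hder : HasDerivAt (fun t : ℝ => fullObjective m Z p.1 p.2 (θ + t • u))
        ((p.1 : ℝ)⁻¹ * ∑ i : Fin p.1, inner ℝ (grad m (Z i p.2) θ) u) 0 := by
      refine HasDerivAt.const_mul _ (HasDerivAt.fun_sum fun i _ => ?_)
      have h := hasDerivAt_line M.isOpen M.smooth (Z i p.2) (c := θ) (u := u) (t := 0)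
        (by simpa using M.subset h1.1)
      simpa using h
    have hloc : IsLocalMax (fun t : ℝ => fullObjective m Z p.1 p.2 (θ + t • u)) 0 := by
      have hc : Tendsto (fun t : ℝ => θ + t • u) (𝓝 0) (𝓝 θ) := by
        have : Continuous fun t : ℝ => θ + t • u := by fun_prop
        simpa using this.tendsto 0
      filter_upwards [hc.eventually hmem] with t ht
      simpa using h1.2 ht
    have h := hloc.hasDerivAt_eq_zero hder
    rw [sum_inner]
    exact (mul_eq_zero.1 h).resolve_left hn
  exact inner_self_eq_zero.1 (hu _)

/-- The unweighted second-moment matrix of the gradients at the estimator is uniformly positive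
definite with probability tending to one. -/
lemma exists_eventually_le_mean_inner_sq (M : FullDataModel P μ Z m Θ U θ₀ ψ θhat) :
    ∃ A : ℝ, 0 < A ∧ ∀ᶠ p in whp P, ∀ u : Vec d,
      A * ‖u‖ ^ 2 ≤ (p.1 : ℝ)⁻¹ * ∑ i : Fin p.1,
        inner ℝ (grad m (Z i p.2) (θhat p.1 p.2)) u ^ 2 := by
  obtain ⟨c, hc, hcoer⟩ := exists_coercive_of_posDef M.posDef_lambda
  obtain ⟨D, hD⟩ := M.isCompact.isBounded.subset_closedBall θ₀
  have hDle : ∀ θ ∈ Θ, ‖θ - θ₀‖ ≤ D := fun θ hθ => by simpa [dist_eq_norm] using hD hθ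
  -- `L z` bounds all Hessian entries on `Θ`
  let L : 𝓩 → ℝ := fun z => (∑ k, ∑ l, |hess m z θ₀ k l|) + ψ z * D
  have hL2 : MemLp L 2 μ := by
    refine MemLp.add ?_ (M.memLp_psi.mul_const D)
    exact memLp_finsetSum _ fun k _ => memLp_finsetSum _ fun l _ => (M.memLp_hess k l).norm
  have hLz : ∀ᵐ z ∂μ, ∀ θ ∈ Θ, ∀ k l, |hess m z θ k l| ≤ L z := by
    filter_upwards [M.lipschitz_hess] with z hz θ hθ k l
    have h1 := hz θ hθ θ₀ M.mem k l
    have h2 : |hess m z θ₀ k l| ≤ ∑ k, ∑ l, |hess m z θ₀ k l| :=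
      (Finset.single_le_sum (f := fun l => |hess m z θ₀ k l|) (fun _ _ => abs_nonneg _)
        (Finset.mem_univ l)).trans
      (Finset.single_le_sum (f := fun k => ∑ l, |hess m z θ₀ k l|)
        (fun _ _ => Finset.sum_nonneg fun _ _ => abs_nonneg _) (Finset.mem_univ k))
    have h3 : ψ z * ‖θ - θ₀‖ ≤ ψ z * D :=
      mul_le_mul_of_nonneg_left (hDle θ hθ) (M.psi_nonneg z)
    have h4 := abs_sub_abs_le_abs_sub (hess m z θ k l) (hess m z θ₀ k l)
    simp only [L]
    linarith
  have hlimΛ : ∀ k l, Tendsto (fun p : ℕ × Ω => ((p.1 : ℝ)⁻¹ • ∑ i : Fin p.1,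
      outer (grad m (Z i p.2) θ₀)) k l) (whp P) (𝓝 (popLambda μ m θ₀ k l)) := by
    intro k l
    have hint : Integrable (fun z => outer (grad m z θ₀) k l) μ := by
      simp only [outer, Matrix.of_apply]
      exact (M.memLp_grad_apply k).integrable_mul (M.memLp_grad_apply l)
    have h2 : popLambda μ m θ₀ k l = ∫ z, outer (grad m z θ₀) k l ∂μ := by
      rw [popLambda, Matrix.of_apply]
    rw [h2]
    refine (M.tendsto_mean (f := fun z => outer (grad m z θ₀) k l) hint).congr fun p => ?_
    simp [Matrix.sum_apply]
  obtain ⟨κ, -, hκ, hκle⟩ := exists_entrywise_bound hlimΛ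
  have hpert : Tendsto (fun p : ℕ × Ω => (d : ℝ) ^ 2 * ((p.1 : ℝ)⁻¹ *
      ∑ i : Fin p.1, L (Z i p.2) ^ 2) * ‖θhat p.1 p.2 - θ₀‖ ^ 2) (whp P) (𝓝 0) := by
    have h := ((M.tendsto_mean hL2.integrable_sq).const_mul ((d : ℝ) ^ 2)).mul
      (M.tendsto_norm_estimator_sub.pow 2)
    simpa using h
  have hdκ : Tendsto (fun p => (d : ℝ) * κ p) (whp P) (𝓝 0) := by simpa using hκ.const_mul (d : ℝ)
  have hLω : ∀ᶠ p in whp P, ∀ i, ∀ θ ∈ Θ, ∀ k l, |hess m (Z i p.2) θ k l| ≤ L (Z i p.2) :=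
    eventually_whp_of_ae (Eventually.of_forall fun _ =>
      ae_forall_data M.measurable_data M.law_data hLz)
  refine ⟨c / 8, by positivity, ?_⟩
  filter_upwards [hdκ.eventually_le_const (by positivity : (0 : ℝ) < c / 2),
    hpert.eventually_le_const (by positivity : (0 : ℝ) < c / 8), hLω] with p h1 h2 h3 u
  set θ := θhat p.1 p.2 with hθ
  have hn0 : (0 : ℝ) ≤ (p.1 : ℝ)⁻¹ := by positivity
  have hemp : c / 2 * ‖u‖ ^ 2 ≤ (p.1 : ℝ)⁻¹ * ∑ i : Fin p.1, inner ℝ (grad m (Z i p.2) θ₀) u ^ 2 := by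
    have h4 := abs_inner_toEuclideanLin_le
      (A := (p.1 : ℝ)⁻¹ • ∑ i : Fin p.1, outer (grad m (Z i p.2) θ₀) - popLambda μ m θ₀)
      (κ := κ p) (fun k l => hκle p k l) u u
    rw [toEuclideanLin_sub_apply, inner_sub_right] at h4
    simp only [map_smul, map_sum, LinearMap.smul_apply, LinearMap.sum_apply, inner_smul_right,
      inner_sum, inner_outer] at h4
    have h5 := (abs_le.1 h4).1
    have h6 := hcoer u
    have h7 : d * κ p * (‖u‖ * ‖u‖) ≤ c / 2 * (‖u‖ * ‖u‖) := by gcongr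
    nlinarith
  have hdiff : ∀ i : Fin p.1, 1 / 2 * inner ℝ (grad m (Z i p.2) θ₀) u ^ 2 -
      (d : ℝ) ^ 2 * L (Z i p.2) ^ 2 * ‖θ - θ₀‖ ^ 2 * ‖u‖ ^ 2 ≤ inner ℝ (grad m (Z i p.2) θ) u ^ 2 := by
    intro i
    have h4 := norm_grad_sub_le M.isOpen M.subset M.smooth M.convex (h3 i) M.mem
      (M.estimator_mem p.1 p.2)
    set δ := grad m (Z i p.2) θ - grad m (Z i p.2) θ₀ with hδ
    have h5 : inner ℝ (grad m (Z i p.2) θ) u = inner ℝ (grad m (Z i p.2) θ₀) u + inner ℝ δ u := by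
      rw [← inner_add_left, hδ]; congr 1; abel
    have h6 : inner ℝ δ u ^ 2 ≤ (d : ℝ) ^ 2 * L (Z i p.2) ^ 2 * ‖θ - θ₀‖ ^ 2 * ‖u‖ ^ 2 := by
      have h7 : |inner ℝ δ u| ≤ d * L (Z i p.2) * ‖θ - θ₀‖ * ‖u‖ :=
        (abs_real_inner_le_norm _ _).trans (by gcongr)
      rw [← sq_abs]
      calc |inner ℝ δ u| ^ 2 ≤ (d * L (Z i p.2) * ‖θ - θ₀‖ * ‖u‖) ^ 2 := by gcongr
        _ = _ := by ring
    rw [h5]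
    nlinarith [sq_nonneg (inner ℝ (grad m (Z i p.2) θ₀) u + 2 * inner ℝ δ u)]
  have hsum := mul_le_mul_of_nonneg_left
    (Finset.sum_le_sum fun i (_ : i ∈ Finset.univ) => hdiff i) hn0
  refine le_trans ?_ hsum
  rw [Finset.sum_sub_distrib, ← Finset.mul_sum, ← Finset.sum_mul, ← Finset.sum_mul,
    ← Finset.mul_sum]
  have h8 := mul_le_mul_of_nonneg_right h2 (sq_nonneg ‖u‖)
  nlinarith

end FullDataModel

/-! ### Linearization of the subsample estimator -/

/-- The assumptions of the theorem on the subsampling distribution, the subsample and the subsample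
estimator. -/
structure SubsamplingModel {d : ℕ} {Ω 𝓩 : Type*} [MeasurableSpace Ω] [MeasurableSpace 𝓩]
    (P : Measure Ω) (Z : ℕ → Ω → 𝓩) (m : 𝓩 → Vec d → ℝ) (Θ : Set (Vec d)) (π : ℕ → ℕ → Ω → ℝ)
    (s : ℕ → ℕ) (J : (n : ℕ) → Fin (s n) → Ω → ℕ) (θtilde : ℕ → Ω → Vec d) : Prop where
  distribution : IsSubsamplingDistribution Z π
  bounded_inv : BoundedInProb P fun n ω => ⨆ i : Fin n, ((n : ℝ) * π n i ω)⁻¹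
  tendsto_size : Tendsto s atTop atTop
  subsample : IsSubsampleWithReplacement P Z π s J
  measurable_estimator : ∀ n, Measurable (θtilde n)
  argmax_estimator : ∀ n, ∀ᵐ ω ∂P, IsArgmax (subObjective m Z π s J n ω) Θ (θtilde n ω)

/-- The weighted subsample average of the gradients at the full-data estimator. -/
noncomputable def subGrad {d : ℕ} {Ω 𝓩 : Type*} (m : 𝓩 → Vec d → ℝ) (Z : ℕ → Ω → 𝓩)
    (π : ℕ → ℕ → Ω → ℝ) (s : ℕ → ℕ) (J : (n : ℕ) → Fin (s n) → Ω → ℕ) (θhat : ℕ → Ω → Vec d)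
    (n : ℕ) (ω : Ω) : Vec d :=
  ∑ j : Fin (s n), ((n : ℝ) * s n * π n (J n j ω) ω)⁻¹ • grad m (Z (J n j ω) ω) (θhat n ω)

lemma subGrad_apply {d : ℕ} {Ω 𝓩 : Type*} (m : 𝓩 → Vec d → ℝ) (Z : ℕ → Ω → 𝓩)
    (π : ℕ → ℕ → Ω → ℝ) (s : ℕ → ℕ) (J : (n : ℕ) → Fin (s n) → Ω → ℕ) (θhat : ℕ → Ω → Vec d)
    (n : ℕ) (ω : Ω) (k : Fin d) :
    subGrad m Z π s J θhat n ω k =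
      subMean π s J (fun n i ω => grad m (Z i ω) (θhat n ω) k) n ω := by
  simp [subGrad, subMean]

namespace SubsamplingModel

variable {d : ℕ} {Ω 𝓩 : Type*} [MeasurableSpace Ω] [MeasurableSpace 𝓩]
  {P : Measure Ω} {μ : Measure 𝓩} {Z : ℕ → Ω → 𝓩} {m : 𝓩 → Vec d → ℝ} {Θ U : Set (Vec d)}
  {θ₀ : Vec d} {ψ : 𝓩 → ℝ} {θhat : ℕ → Ω → Vec d} {π : ℕ → ℕ → Ω → ℝ} {s : ℕ → ℕ}
  {J : (n : ℕ) → Fin (s n) → Ω → ℕ} {θtilde : ℕ → Ω → Vec d}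

lemma tendsto_sqrt_size (S : SubsamplingModel P Z m Θ π s J θtilde) :
    Tendsto (fun p : ℕ × Ω => √(s p.1 : ℝ)) (whp P) atTop :=
  Real.tendsto_sqrt_atTop.comp (tendsto_natCast_atTop_atTop.comp
    (S.tendsto_size.comp tendsto_fst_whp))

variable [IsProbabilityMeasure P]

/-- Weighted subsample averages have the same limit in probability as full-data averages. -/
lemma tendsto_subMean (S : SubsamplingModel P Z m Θ π s J θtilde) (hZ : ∀ i, Measurable (Z i))
    {y : ℕ → ℕ → Ω → ℝ} (hym : ∀ n, ∀ i < n, Measurable[dataSigma Z n] (y n i))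
    (hy : BoundedInProb P fun n ω => (n : ℝ)⁻¹ * ∑ i : Fin n, y n i ω ^ 2) {a : ℝ}
    (ha : Tendsto (fun p : ℕ × Ω => fullMean y p.1 p.2) (whp P) (𝓝 a)) :
    Tendsto (fun p : ℕ × Ω => subMean π s J y p.1 p.2) (whp P) (𝓝 a) := by
  have h1 := boundedInProb_sqrt_mul_subMean_sub hZ S.distribution S.bounded_inv S.tendsto_size
    S.subsample hym hy
  have h2 := (h1.tendsto_mul_zero (Y := fun n _ => (√(s n : ℝ))⁻¹)
    (tendsto_inv_atTop_zero.comp S.tendsto_sqrt_size)).add ha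
  rw [zero_add] at h2
  refine h2.congr' ?_
  filter_upwards [S.tendsto_sqrt_size.eventually_gt_atTop 0] with p hp
  rw [inv_mul_cancel_left₀ hp.ne']
  ring

/-- Almost surely all the drawn indices are smaller than `n`. -/
lemma eventually_index_lt (S : SubsamplingModel P Z m Θ π s J θtilde)
    (hZ : ∀ i, Measurable (Z i)) :
    ∀ᶠ p in whp P, ∀ j, J p.1 j p.2 < p.1 := by
  refine eventually_whp_of_ae ?_
  filter_upwards [eventually_gt_atTop 0] with n hn
  filter_upwards [ae_exists_drawn (dataSigma_le hZ n) (S.subsample n hn).1 (S.subsample n hn).2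
    (S.distribution n hn).2.2] with ω ⟨k, hk⟩ j
  rw [hk j]
  exact (k j).2

variable [IsProbabilityMeasure μ]

lemma boundedInProb_sqrt_mul_norm_subGrad (S : SubsamplingModel P Z m Θ π s J θtilde)
    (M : FullDataModel P μ Z m Θ U θ₀ ψ θhat) :
    BoundedInProb P fun n ω => √(s n : ℝ) * ‖subGrad m Z π s J θhat n ω‖ := by
  have hcoord : ∀ k : Fin d, BoundedInProb P fun n ω => √(s n : ℝ) *
      |subGrad m Z π s J θhat n ω k| := by
    intro k
    have hsq : BoundedInProb P fun n ω =>
        (n : ℝ)⁻¹ * ∑ i : Fin n, grad m (Z i ω) (θhat n ω) k ^ 2 := by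
      refine ((BoundedInProb.const 1).add M.bounded_grad).mono ?_
      filter_upwards [tendsto_fst_whp.eventually_gt_atTop 0] with p hp
      rw [abs_of_nonneg (by positivity), abs_of_nonneg (by positivity)]
      have hp' : (p.1 : ℝ) ≠ 0 := by exact_mod_cast hp.ne'
      have h1 : (1 : ℝ) = (p.1 : ℝ)⁻¹ * ∑ _i : Fin p.1, (1 : ℝ) := by simp [hp']
      rw [h1, ← mul_add, ← Finset.sum_add_distrib]
      refine mul_le_mul_of_nonneg_left (Finset.sum_le_sum fun i _ => ?_) (by positivity)
      have h2 := abs_coord_le_norm (grad m (Z i p.2) (θhat p.1 p.2)) k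
      have h3 := pow_le_pow_left₀ (abs_nonneg _) h2 2
      rw [sq_abs] at h3
      nlinarith [sq_nonneg (‖grad m (Z i p.2) (θhat p.1 p.2)‖ ^ 2 - 1),
        sq_nonneg (‖grad m (Z i p.2) (θhat p.1 p.2)‖ ^ 2)]
    refine (boundedInProb_sqrt_mul_subMean_sub M.measurable_data S.distribution S.bounded_inv
      S.tendsto_size S.subsample (y := fun n i ω => grad m (Z i ω) (θhat n ω) k)
      (fun n i hi => M.measurable_grad hi k) hsq).mono ?_
    filter_upwards [M.eventually_mean_grad_eq_zero] with p hp
    -- the centring term vanishes exactly, so that the factor `√s` does no harm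
    have h1 : fullMean (fun n i ω => grad m (Z i ω) (θhat n ω) k) p.1 p.2 = 0 := by
      have h2 := congrArg (fun v : Vec d => v k) hp
      simp only [PiLp.zero_apply, WithLp.ofLp_sum, Finset.sum_apply] at h2
      rw [fullMean, h2, mul_zero]
    rw [h1, sub_zero, subGrad_apply, abs_mul, abs_mul, abs_abs]
  refine (BoundedInProb.finset_sum Finset.univ fun k _ => hcoord k).mono
    (Eventually.of_forall fun p => ?_)
  rw [abs_of_nonneg (by positivity), abs_of_nonneg (by positivity), ← Finset.mul_sum]
  exact mul_le_mul_of_nonneg_left (norm_le_sum_abs _) (by positivity)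

lemma tendsto_subMean_hess (S : SubsamplingModel P Z m Θ π s J θtilde)
    (M : FullDataModel P μ Z m Θ U θ₀ ψ θhat) (k l : Fin d) :
    Tendsto (fun p : ℕ × Ω =>
      subMean π s J (fun n i ω => hess m (Z i ω) (θhat n ω) k l) p.1 p.2) (whp P)
      (𝓝 (popHess μ m θ₀ k l)) :=
  S.tendsto_subMean M.measurable_data (fun _ _ hi => M.measurable_hess hi k l)
    (M.boundedInProb_hess_sq k l)
    ((M.tendsto_fullHess k l).congr fun p => fullHess_apply m Z p.1 p.2 _ k l)

lemma tendsto_subMean_psi (S : SubsamplingModel P Z m Θ π s J θtilde)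
    (M : FullDataModel P μ Z m Θ U θ₀ ψ θhat) :
    Tendsto (fun p : ℕ × Ω => subMean π s J (fun _ i ω => ψ (Z i ω)) p.1 p.2) (whp P)
      (𝓝 (∫ z, ψ z ∂μ)) := by
  have h1 : BoundedInProb P fun n ω => (n : ℝ)⁻¹ * ∑ i : Fin n, ψ (Z i ω) ^ 2 :=
    BoundedInProb.of_tendsto (M.tendsto_mean (f := fun z => ψ z ^ 2) M.memLp_psi.integrable_sq)
  have h2 := M.tendsto_mean (f := ψ) M.integrable_psi
  exact S.tendsto_subMean (y := fun _ i ω => ψ (Z i ω)) M.measurable_data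
    (fun n _ hi => M.measurable_psi.comp (measurable_dataSigma n hi)) h1 h2

/-- The subsample estimator differs from one Newton step, taken from the full-data estimator with
the population Hessian, by `o_P(s^{-1/2})`. -/
theorem tendsto_sqrt_mul_norm_sub_newton (S : SubsamplingModel P Z m Θ π s J θtilde)
    (M : FullDataModel P μ Z m Θ U θ₀ ψ θhat) :
    Tendsto (fun p : ℕ × Ω => √(s p.1 : ℝ) * ‖θtilde p.1 p.2 - (θhat p.1 p.2 +
      -toEuclideanLin (popHess μ m θ₀)⁻¹ (subGrad m Z π s J θhat p.1 p.2))‖) (whp P) (𝓝 0) := by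
  obtain ⟨lam, hlam, hH⟩ := M.exists_popHess_le
  obtain ⟨ρ, hρ, hball⟩ := M.exists_closedBall
  obtain ⟨C, hC, hCle⟩ := exists_norm_toEuclideanLin_le (popHess μ m θ₀)⁻¹
  obtain ⟨e, he⟩ : ∃ e : ℕ → Ω → Vec d, e = fun n ω =>
    -toEuclideanLin (popHess μ m θ₀)⁻¹ (subGrad m Z π s J θhat n ω) := ⟨_, rfl⟩
  have heω : ∀ n ω, -toEuclideanLin (popHess μ m θ₀)⁻¹ (subGrad m Z π s J θhat n ω) = e n ω :=
    fun n ω => by rw [he]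
  simp only [heω]
  have hlimH : ∀ k l, Tendsto (fun p : ℕ × Ω => (Matrix.of fun k l =>
      subMean π s J (fun n i ω => hess m (Z i ω) (θhat n ω) k l) p.1 p.2) k l) (whp P)
      (𝓝 (popHess μ m θ₀ k l)) := fun k l => S.tendsto_subMean_hess M k l
  obtain ⟨κ, hκ0, hκ, hκle⟩ := exists_entrywise_bound hlimH
  have hse : BoundedInProb P fun n ω => √(s n : ℝ) * ‖e n ω‖ := by
    refine ((BoundedInProb.const C).mul (S.boundedInProb_sqrt_mul_norm_subGrad M)).mono
      (Eventually.of_forall fun p => ?_)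
    rw [abs_of_nonneg (by positivity), abs_of_nonneg (by positivity), he, norm_neg]
    have := mul_le_mul_of_nonneg_left (hCle (subGrad m Z π s J θhat p.1 p.2))
      (Real.sqrt_nonneg (s p.1 : ℝ))
    linarith
  have hsinv : Tendsto (fun p : ℕ × Ω => (√(s p.1 : ℝ))⁻¹) (whp P) (𝓝 0) :=
    tendsto_inv_atTop_zero.comp S.tendsto_sqrt_size
  rw [Metric.tendsto_nhds]
  intro ε hε
  have hε2 : 0 < ε / 2 := half_pos hε
  have hb : BoundedInProb P fun n ω => √(s n : ℝ) * ‖e n ω‖ + ε / 2 :=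
    hse.add (BoundedInProb.const _)
  have hΨ := S.tendsto_subMean_psi M
  -- the smallness condition of the localization lemma for the radius `ε / (2 √s)`, multiplied
  -- by `s`
  have hlim : Tendsto (fun p : ℕ × Ω => d * (κ p * (√(s p.1 : ℝ) * ‖e p.1 p.2‖ + ε / 2) ^ 2) +
      2 * (d * ((√(s p.1 : ℝ))⁻¹ * (subMean π s J (fun _ i ω => ψ (Z i ω)) p.1 p.2 *
        (√(s p.1 : ℝ) * ‖e p.1 p.2‖ + ε / 2) ^ 3)))) (whp P) (𝓝 0) := by
    have h1 := (hb.pow 2).tendsto_mul_zero (Y := fun n ω => κ (n, ω)) hκ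
    have h2 := ((BoundedInProb.of_tendsto hΨ).mul (hb.pow 3)).tendsto_mul_zero
      (Y := fun n _ => (√(s n : ℝ))⁻¹) hsinv
    have h3 := (h1.const_mul (d : ℝ)).add ((h2.const_mul (d : ℝ)).const_mul 2)
    simpa only [mul_zero, add_zero] using h3
  have hsmall : Tendsto (fun p : ℕ × Ω => (√(s p.1 : ℝ))⁻¹ * (√(s p.1 : ℝ) * ‖e p.1 p.2‖ + ε / 2))
      (whp P) (𝓝 0) := hb.tendsto_mul_zero (Y := fun n _ => (√(s n : ℝ))⁻¹) hsinv
  have hargmax : ∀ᶠ p in whp P, IsArgmax (subObjective m Z π s J p.1 p.2) Θ (θtilde p.1 p.2) :=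
    eventually_whp_of_ae (Eventually.of_forall fun n => S.argmax_estimator n)
  filter_upwards [hlim.eventually_lt_const (by positivity : 0 < lam / 2 * (ε / 2) ^ 2),
    hsmall.eventually_le_const (half_pos hρ), hargmax, M.eventually_lipschitz,
    M.tendsto_norm_estimator_sub.eventually_le_const (half_pos hρ),
    S.tendsto_sqrt_size.eventually_gt_atTop 0, S.eventually_index_lt M.measurable_data,
    tendsto_fst_whp.eventually_gt_atTop 0] with p h1 h2 h3 h4 h5 hs0 hJ hn
  obtain ⟨n, ω⟩ := p
  dsimp only at h1 h2 h3 h4 h5 hs0 hJ hn ⊢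
  obtain ⟨q, hq⟩ : ∃ q, q = √(s n : ℝ) := ⟨_, rfl⟩
  rw [← hq] at h1 h2 hs0 ⊢
  have hr0 : 0 < ε / 2 / q := by positivity
  have hw0 : ∀ j, 0 ≤ ((n : ℝ) * s n * π n (J n j ω) ω)⁻¹ := fun j => by
    have := (S.distribution n hn).2.1 _ (hJ j) ω
    positivity
  have h6 := norm_argmax_weighted_sum_sub_le (w := fun j => ((n : ℝ) * s n * π n (J n j ω) ω)⁻¹)
    (z := fun j => Z (J n j ω) ω) (ψ := fun j => ψ (Z (J n j ω) ω)) (θs := θtilde n ω)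
    (c := θhat n ω) (e := e n ω) (ρ := ρ / 2) (r := ε / 2 / q) (κ := κ (n, ω))
    (Ψ := subMean π s J (fun _ i ω => ψ (Z i ω)) n ω)
    M.isOpen M.subset M.smooth M.concave M.convex hw0 (fun j => h4 _)
    (by
      have : (fun θ => ∑ j, ((n : ℝ) * s n * π n (J n j ω) ω)⁻¹ * m (Z (J n j ω) ω) θ) =
          subObjective m Z π s J n ω := by
        funext θ
        rw [subObjective]
        exact Finset.sum_congr rfl fun j _ => inv_mul_eq_div _ _
      rw [this]; exact h3)
    hr0
    (by
      refine (Metric.closedBall_subset_closedBall' ?_).trans hball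
      rw [dist_eq_norm]
      linarith)
    M.isSymm_popHess hH (by rw [← heω, M.popHess_newton, subGrad])
    (hκ0 _) (Finset.sum_nonneg fun j _ => mul_nonneg (hw0 j) (M.psi_nonneg _))
    (fun k l => hκle (n, ω) k l) le_rfl
    (by
      have h7 : q⁻¹ * (q * ‖e n ω‖ + ε / 2) = ‖e n ω‖ + ε / 2 / q := by field_simp
      rwa [h7] at h2)
    (by
      have h7 : ‖e n ω‖ + ε / 2 / q = q⁻¹ * (q * ‖e n ω‖ + ε / 2) := by field_simp
      have h8 := mul_lt_mul_of_pos_left h1 (by positivity : 0 < (q⁻¹) ^ 2)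
      rw [h7]
      refine lt_of_eq_of_lt ?_ (h8.trans_eq ?_)
      · ring
      · rw [div_eq_mul_inv (ε / 2) q]
        ring)
  rw [Real.dist_eq, sub_zero, abs_of_nonneg (by positivity)]
  rw [le_div_iff₀ hs0, mul_comm] at h6
  linarith

end SubsamplingModel

/-! ### Standardization -/

section Standardization

variable {d : ℕ} {Ω 𝓩 : Type*}

/-- The matrix `V^{-1/2} M̈⁻¹` at the full-data estimator. It maps the weighted subsample gradient
to (minus) the leading term of the standardized error. -/
noncomputable def standardizer (m : 𝓩 → Vec d → ℝ) (Z : ℕ → Ω → 𝓩) (π : ℕ → ℕ → Ω → ℝ)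
    (θhat : ℕ → Ω → Vec d) (n : ℕ) (ω : Ω) : Matrix (Fin d) (Fin d) ℝ :=
  invSqrt (varianceR m Z π n ω (θhat n ω)) * (fullHess m Z n ω (θhat n ω))⁻¹

/-- The leading term of the standardized error: one Newton step, standardized. -/
noncomputable def leadingTerm (m : 𝓩 → Vec d → ℝ) (Z : ℕ → Ω → 𝓩) (π : ℕ → ℕ → Ω → ℝ)
    (s : ℕ → ℕ) (J : (n : ℕ) → Fin (s n) → Ω → ℕ) (θhat : ℕ → Ω → Vec d) (n : ℕ) (ω : Ω) : Vec d :=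
  √(s n : ℝ) • -toEuclideanLin (standardizer m Z π θhat n ω) (subGrad m Z π s J θhat n ω)

/-- The contribution of the draw of the index `i` to the leading term, before scaling by
`s^{-1/2}`. -/
noncomputable def influence (m : 𝓩 → Vec d → ℝ) (Z : ℕ → Ω → 𝓩) (π : ℕ → ℕ → Ω → ℝ)
    (θhat : ℕ → Ω → Vec d) (n i : ℕ) (ω : Ω) : Vec d :=
  -((n : ℝ) * π n i ω)⁻¹ • toEuclideanLin (standardizer m Z π θhat n ω)
    (grad m (Z i ω) (θhat n ω))

lemma leadingTerm_eq (m : 𝓩 → Vec d → ℝ) (Z : ℕ → Ω → 𝓩) (π : ℕ → ℕ → Ω → ℝ)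
    (s : ℕ → ℕ) (J : (n : ℕ) → Fin (s n) → Ω → ℕ) (θhat : ℕ → Ω → Vec d) (n : ℕ) (ω : Ω) :
    leadingTerm m Z π s J θhat n ω =
      (√(s n : ℝ))⁻¹ • ∑ j, influence m Z π θhat n (J n j ω) ω := by
  simp only [leadingTerm, subGrad, influence, map_sum, map_smul, ← Finset.sum_neg_distrib,
    Finset.smul_sum, smul_smul, ← neg_smul]
  refine Finset.sum_congr rfl fun j _ => ?_
  congr 1
  have h : √(s n : ℝ) * (s n : ℝ)⁻¹ = (√(s n : ℝ))⁻¹ := by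
    rw [← div_eq_mul_inv, Real.sqrt_div_self]
  rw [mul_inv, mul_inv, mul_inv, ← h]
  ring

namespace SubsamplingModel

variable [MeasurableSpace Ω] [MeasurableSpace 𝓩]
  {P : Measure Ω} {μ : Measure 𝓩} {Z : ℕ → Ω → 𝓩} {m : 𝓩 → Vec d → ℝ} {Θ U : Set (Vec d)}
  {θ₀ : Vec d} {ψ : 𝓩 → ℝ} {θhat : ℕ → Ω → Vec d} {π : ℕ → ℕ → Ω → ℝ} {s : ℕ → ℕ}
  {J : (n : ℕ) → Fin (s n) → Ω → ℕ} {θtilde : ℕ → Ω → Vec d}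

lemma measurable_varianceR (S : SubsamplingModel P Z m Θ π s J θtilde)
    (M : FullDataModel P μ Z m Θ U θ₀ ψ θhat) {n : ℕ} (hn : 0 < n) :
    (∀ k l, Measurable[dataSigma Z n] fun ω => (fullHess m Z n ω (θhat n ω))⁻¹ k l) ∧
    ∀ k l, Measurable[dataSigma Z n] fun ω => varianceR m Z π n ω (θhat n ω) k l := by
  have hH : ∀ k l, Measurable[dataSigma Z n] fun ω => fullHess m Z n ω (θhat n ω) k l := by
    intro k l
    simp only [fullHess_apply]
    exact (show Measurable[dataSigma Z n] fun ω => ∑ i : Fin n, hess m (Z i ω) (θhat n ω) k l from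
      Finset.measurable_sum _ fun i _ => M.measurable_hess i.2 k l).const_mul _
  have hΛ : ∀ k l, Measurable[dataSigma Z n] fun ω => lambdaR m Z π n ω (θhat n ω) k l := by
    intro k l
    simp only [lambdaR_apply]
    exact (show Measurable[dataSigma Z n] fun ω => ∑ i : Fin n, (π n i ω)⁻¹ *
      (grad m (Z i ω) (θhat n ω) k * grad m (Z i ω) (θhat n ω) l) from
      Finset.measurable_sum _ fun i _ => ((S.distribution n hn).1 i i.2).inv.mul
        ((M.measurable_grad i.2 k).mul (M.measurable_grad i.2 l))).const_mul _
  have hHi := @measurable_matrix_inv d Ω (dataSigma Z n) _ hH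
  exact ⟨hHi, @measurable_matrix_mul d Ω (dataSigma Z n) _ _
    (@measurable_matrix_mul d Ω (dataSigma Z n) _ _ hHi hΛ) hHi⟩

lemma measurable_influence (S : SubsamplingModel P Z m Θ π s J θtilde)
    (M : FullDataModel P μ Z m Θ U θ₀ ψ θhat) {n i : ℕ} (hi : i < n) :
    Measurable[dataSigma Z n] (influence m Z π θhat n i) := by
  have hn : 0 < n := (Nat.zero_le i).trans_lt hi
  obtain ⟨hHi, hV⟩ := S.measurable_varianceR M hn
  have hB := @measurable_matrix_mul d Ω (dataSigma Z n) _ _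
    (@measurable_invSqrt d Ω (dataSigma Z n) _ hV) hHi
  have hg : Measurable[dataSigma Z n] fun ω => grad m (Z i ω) (θhat n ω) := by
    have h1 : Measurable[dataSigma Z n] fun ω => (fun k => grad m (Z i ω) (θhat n ω) k) :=
      @measurable_pi_lambda _ _ _ (dataSigma Z n) _ _ fun k => M.measurable_grad hi k
    exact (WithLp.measurable_toLp 2 (Fin d → ℝ)).comp h1
  have hc : Measurable[dataSigma Z n] fun ω => -((n : ℝ) * π n i ω)⁻¹ :=
    (((S.distribution n hn).1 i hi).const_mul (n : ℝ)).inv.neg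
  exact hc.smul (@measurable_toEuclideanLin d Ω (dataSigma Z n) _ _ hB hg)

lemma measurable_standardizedError (S : SubsamplingModel P Z m Θ π s J θtilde)
    (M : FullDataModel P μ Z m Θ U θ₀ ψ θhat) {n : ℕ} (hn : 0 < n) :
    Measurable (standardizedError m Z π s θhat θtilde n) := by
  have hle := dataSigma_le M.measurable_data n
  have hV := measurable_invSqrt fun k l => ((S.measurable_varianceR M hn).2 k l).mono hle le_rfl
  exact Measurable.const_smul (measurable_toEuclideanLin hV ((S.measurable_estimator n).sub
    ((M.measurable_estimator n).mono hle le_rfl))) (√(s n : ℝ))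

variable [IsProbabilityMeasure P] [IsProbabilityMeasure μ]

/-- With probability tending to one the standardizer is well behaved: it whitens `Λ`, and its norm
is controlled by the fourth moment of the gradients. -/
lemma exists_eventually_standardizer (S : SubsamplingModel P Z m Θ π s J θtilde)
    (M : FullDataModel P μ Z m Θ U θ₀ ψ θhat) :
    ∃ X : ℕ → Ω → ℝ, BoundedInProb P X ∧ ∀ᶠ p in whp P,
      IsUnit (fullHess m Z p.1 p.2 (θhat p.1 p.2)).det ∧
      standardizer m Z π θhat p.1 p.2 * lambdaR m Z π p.1 p.2 (θhat p.1 p.2) *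
        (standardizer m Z π θhat p.1 p.2)ᵀ = 1 ∧
      0 ≤ X p.1 p.2 ∧
      ∀ u : Vec d, ‖toEuclideanLin (standardizer m Z π θhat p.1 p.2) u‖ ≤ X p.1 p.2 * ‖u‖ := by
  obtain ⟨A, hA, hAle⟩ := M.exists_eventually_le_mean_inner_sq
  obtain ⟨lam, hlam, hH⟩ := M.exists_popHess_le
  obtain ⟨Y, hY⟩ : ∃ Y : ℕ → Ω → ℝ, Y = fun (n : ℕ) ω =>
    8 * ((n : ℝ)⁻¹ * ∑ i : Fin n, ‖grad m (Z i ω) (θhat n ω)‖ ^ 4 + 1) / A ^ 3 := ⟨_, rfl⟩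
  have hY0 : ∀ n ω, 0 < Y n ω := fun n ω => by rw [hY]; positivity
  have hYb : BoundedInProb P Y := by
    have h := (BoundedInProb.const (P := P) (8 / A ^ 3)).mul
      (M.bounded_grad.add (BoundedInProb.const 1))
    have h2 : Y = fun (n : ℕ) ω => 8 / A ^ 3 *
        ((n : ℝ)⁻¹ * ∑ i : Fin n, ‖grad m (Z i ω) (θhat n ω)‖ ^ 4 + 1) := by
      rw [hY]; funext n ω; ring
    rw [h2]
    exact h
  obtain ⟨κ, -, hκ0, hκle⟩ := exists_entrywise_bound M.tendsto_fullHess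
  have hκ : Tendsto (fun p => (d : ℝ) * κ p) (whp P) (𝓝 0) := by simpa using hκ0.const_mul (d : ℝ)
  refine ⟨fun n ω => √(Y n ω), ?_, ?_⟩
  · refine ((BoundedInProb.const 1).add hYb).mono (Eventually.of_forall fun p => ?_)
    have h1 := hY0 p.1 p.2
    rw [abs_of_nonneg (Real.sqrt_nonneg _), abs_of_nonneg (by positivity)]
    nlinarith [Real.sq_sqrt h1.le, sq_nonneg (√(Y p.1 p.2) - 1)]
  filter_upwards [hAle, hκ.eventually_le_const (half_pos hlam),
    tendsto_fst_whp.eventually_gt_atTop 0] with p h1 h2 hn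
  have hcoer : ∀ u : Vec d, (Y p.1 p.2)⁻¹ * ‖u‖ ^ 2 ≤
      inner ℝ u (toEuclideanLin (lambdaR m Z π p.1 p.2 (θhat p.1 p.2)) u) := by
    intro u
    have h3 := norm_sq_le_weighted_sum hn (p := fun i : Fin p.1 => π p.1 i p.2)
      (fun i => (S.distribution p.1 hn).2.1 i i.2 p.2) ((S.distribution p.1 hn).2.2 p.2)
      (fun i : Fin p.1 => grad m (Z i p.2) (θhat p.1 p.2)) hA h1 u
    rw [inner_lambdaR, inv_mul_le_iff₀ (hY0 _ _), hY]
    exact h3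
  have hYi : 0 < (Y p.1 p.2)⁻¹ := inv_pos.2 (hY0 _ _)
  have hΛ : (lambdaR m Z π p.1 p.2 (θhat p.1 p.2)).PosDef :=
    posDef_of_coercive (isSymm_lambdaR m Z π p.1 p.2 _) hYi hcoer
  have hsymm := M.isSymm_fullHess p.1 p.2
  have hHpd : (-fullHess m Z p.1 p.2 (θhat p.1 p.2)).PosDef := by
    refine posDef_of_coercive hsymm.neg (half_pos hlam) fun u => ?_
    have h3 := (abs_le.1 (abs_inner_toEuclideanLin_le
      (A := fullHess m Z p.1 p.2 (θhat p.1 p.2) - popHess μ m θ₀) (fun k l => hκle p k l) u u)).2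
    rw [toEuclideanLin_sub_apply, inner_sub_right] at h3
    have h4 := hH u
    have h5 : d * κ p * (‖u‖ * ‖u‖) ≤ lam / 2 * (‖u‖ * ‖u‖) := by gcongr
    rw [map_neg, LinearMap.neg_apply, inner_neg_right]
    nlinarith
  have hdet : IsUnit (fullHess m Z p.1 p.2 (θhat p.1 p.2)).det := by
    have h := hHpd.isUnit.neg
    rw [neg_neg] at h
    exact (Matrix.isUnit_iff_isUnit_det _).1 h
  have hB : standardizer m Z π θhat p.1 p.2 * lambdaR m Z π p.1 p.2 (θhat p.1 p.2) *
      (standardizer m Z π θhat p.1 p.2)ᵀ = 1 := standardizer_mul_mul_transpose hsymm hdet hΛ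
  refine ⟨hdet, hB, Real.sqrt_nonneg _, fun u => ?_⟩
  have h3 := norm_le_of_mul_mul_transpose_eq_one hB hYi hcoer u
  rwa [Real.sqrt_inv, inv_inv] at h3

/-- The standardized error is asymptotically equal to its leading term. -/
theorem tendsto_norm_standardizedError_sub (S : SubsamplingModel P Z m Θ π s J θtilde)
    (M : FullDataModel P μ Z m Θ U θ₀ ψ θhat) :
    Tendsto (fun p : ℕ × Ω => ‖standardizedError m Z π s θhat θtilde p.1 p.2 -
      leadingTerm m Z π s J θhat p.1 p.2‖) (whp P) (𝓝 0) := by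
  obtain ⟨X, hX, hXle⟩ := S.exists_eventually_standardizer M
  obtain ⟨C, hC, hCle⟩ := exists_norm_toEuclideanLin_le (popHess μ m θ₀)
  obtain ⟨C', hC', hCle'⟩ := exists_norm_toEuclideanLin_le (popHess μ m θ₀)⁻¹
  obtain ⟨κ, hκ0, hκ, hκle⟩ := exists_entrywise_bound M.tendsto_fullHess
  have hr := S.tendsto_sqrt_mul_norm_sub_newton M
  have hg := S.boundedInProb_sqrt_mul_norm_subGrad M
  obtain ⟨r, hrdef⟩ : ∃ r : ℕ × Ω → ℝ, r = fun p => √(s p.1 : ℝ) * ‖θtilde p.1 p.2 -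
    (θhat p.1 p.2 + -toEuclideanLin (popHess μ m θ₀)⁻¹ (subGrad m Z π s J θhat p.1 p.2))‖ :=
    ⟨_, rfl⟩
  have hr0 : Tendsto r (whp P) (𝓝 0) := by rw [hrdef]; exact hr
  have hinner : Tendsto (fun p : ℕ × Ω => C * r p + d * (κ p * r p +
      C' * (κ p * (√(s p.1 : ℝ) * ‖subGrad m Z π s J θhat p.1 p.2‖)))) (whp P) (𝓝 0) := by
    have h1 := hg.tendsto_mul_zero (Y := fun n ω => κ (n, ω)) hκ
    have h2 := (hr0.const_mul C).add (((hκ.mul hr0).add (h1.const_mul C')).const_mul (d : ℝ))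
    simpa only [mul_zero, add_zero] using h2
  have hbound := hX.tendsto_mul_zero (Y := fun n ω => C * r (n, ω) + d * (κ (n, ω) * r (n, ω) +
      C' * (κ (n, ω) * (√(s n : ℝ) * ‖subGrad m Z π s J θhat n ω‖)))) hinner
  refine squeeze_zero_norm' ?_ hbound
  filter_upwards [hXle] with p ⟨hdet, _, hX0, hB⟩
  obtain ⟨n, ω⟩ := p
  have hκn := hκ0 (n, ω)
  have hκc := hκle (n, ω)
  simp only at hdet hX0 hB hκc ⊢
  have hrn : r (n, ω) = √(s n : ℝ) * ‖θtilde n ω -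
    (θhat n ω + -toEuclideanLin (popHess μ m θ₀)⁻¹ (subGrad m Z π s J θhat n ω))‖ := by rw [hrdef]
  have hnewton := M.popHess_newton (subGrad m Z π s J θhat n ω)
  have hCe := hCle' (subGrad m Z π s J θhat n ω)
  rw [← norm_neg] at hCe
  rw [standardizedError, leadingTerm]
  -- `V^{-1/2} = B H`, so the difference of the two sides involves only the remainder `v` of the
  -- Newton step and the difference of the full-data and the population Hessian
  have hfac : invSqrt (varianceR m Z π n ω (θhat n ω)) =
      standardizer m Z π θhat n ω * fullHess m Z n ω (θhat n ω) := by
    rw [standardizer, Matrix.mul_assoc, Matrix.nonsing_inv_mul _ hdet, Matrix.mul_one]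
  rw [hfac, toEuclideanLin_mul_apply]
  obtain ⟨B, hBdef⟩ : ∃ B, B = standardizer m Z π θhat n ω := ⟨_, rfl⟩
  obtain ⟨H, hHdef⟩ : ∃ H, H = fullHess m Z n ω (θhat n ω) := ⟨_, rfl⟩
  obtain ⟨g, hgdef⟩ : ∃ g, g = subGrad m Z π s J θhat n ω := ⟨_, rfl⟩
  obtain ⟨e, hedef⟩ : ∃ e, e = -toEuclideanLin (popHess μ m θ₀)⁻¹ g := ⟨_, rfl⟩
  obtain ⟨v, hvdef⟩ : ∃ v, v = θtilde n ω - (θhat n ω + e) := ⟨_, rfl⟩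
  simp only [← hBdef, ← hHdef, ← hgdef] at hnewton hCe hrn hB hκc ⊢
  rw [← hedef] at hnewton hCe hrn
  rw [← hvdef] at hrn
  have hu : θtilde n ω - θhat n ω = v + e := by rw [hvdef]; abel
  have hsplit : toEuclideanLin H (v + e) = toEuclideanLin (popHess μ m θ₀) v - g +
      toEuclideanLin (H - popHess μ m θ₀) (v + e) := by
    rw [toEuclideanLin_sub_apply, map_add (toEuclideanLin (popHess μ m θ₀)), hnewton]
    abel
  have hdiff : √(s n : ℝ) • toEuclideanLin B (toEuclideanLin H (v + e)) -
      √(s n : ℝ) • -toEuclideanLin B g = √(s n : ℝ) • toEuclideanLin B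
        (toEuclideanLin (popHess μ m θ₀) v + toEuclideanLin (H - popHess μ m θ₀) (v + e)) := by
    rw [← smul_sub, hsplit, sub_neg_eq_add, ← map_add]
    congr 2
    abel
  rw [hu, hdiff, norm_norm, norm_smul, Real.norm_eq_abs, abs_of_nonneg (Real.sqrt_nonneg _)]
  have h1 := hB (toEuclideanLin (popHess μ m θ₀) v + toEuclideanLin (H - popHess μ m θ₀) (v + e))
  have h2 : ‖toEuclideanLin (popHess μ m θ₀) v + toEuclideanLin (H - popHess μ m θ₀) (v + e)‖ ≤
      C * ‖v‖ + d * κ (n, ω) * (‖v‖ + C' * ‖g‖) := by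
    refine (norm_add_le _ _).trans (add_le_add (hCle v) ?_)
    refine (norm_toEuclideanLin_le (A := H - popHess μ m θ₀) (fun k l => hκc k l) _).trans ?_
    exact mul_le_mul_of_nonneg_left ((norm_add_le _ _).trans (by linarith)) (by positivity)
  have h3 := mul_le_mul_of_nonneg_left (h1.trans (mul_le_mul_of_nonneg_left h2 hX0))
    (Real.sqrt_nonneg (s n : ℝ))
  refine h3.trans (le_of_eq ?_)
  rw [hrn]
  ring

end SubsamplingModel

end Standardization

/-! ### The conditional central limit theorem -/

section ConditionalLimit

lemma indicator_one_le {α : Type*} {A B : Set α} {a : α} (h : a ∈ A → a ∈ B) :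
    A.indicator (fun _ => (1 : ℝ)) a ≤ B.indicator (fun _ => 1) a := by
  by_cases hA : a ∈ A
  · rw [Set.indicator_of_mem hA, Set.indicator_of_mem (h hA)]
  · rw [Set.indicator_of_notMem hA]
    exact Set.indicator_nonneg (fun _ _ => zero_le_one) _

lemma condProb_le_add {Ω : Type*} {𝒟 mΩ : MeasurableSpace Ω} {P : Measure Ω} [IsFiniteMeasure P]
    {A B R : Set Ω} (hA : MeasurableSet A) (hB : MeasurableSet B) (hR : MeasurableSet R)
    (h : ∀ᵐ ω ∂P, ω ∈ A → ω ∉ R → ω ∈ B) :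
    ∀ᵐ ω ∂P, (P⟦A | 𝒟⟧) ω ≤ (P⟦B | 𝒟⟧) ω + (P⟦R | 𝒟⟧) ω := by
  have hi : ∀ {C : Set Ω}, MeasurableSet C → Integrable (C.indicator fun _ => (1 : ℝ)) P :=
    fun hC => (integrable_const 1).indicator hC
  have hle : A.indicator (fun _ => (1 : ℝ)) ≤ᵐ[P]
      B.indicator (fun _ => 1) + R.indicator (fun _ => 1) := by
    filter_upwards [h] with ω hω
    rw [Pi.add_apply]
    by_cases hωR : ω ∈ R
    · have h1 : A.indicator (fun _ => (1 : ℝ)) ω ≤ R.indicator (fun _ => 1) ω :=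
        indicator_one_le fun _ => hωR
      have h2 : (0 : ℝ) ≤ B.indicator (fun _ => 1) ω :=
        Set.indicator_nonneg (fun _ _ => zero_le_one) _
      linarith
    · rw [Set.indicator_of_notMem hωR, add_zero]
      exact indicator_one_le fun hA => hω hA hωR
  filter_upwards [condExp_mono (m := 𝒟) (hi hA) ((hi hB).add (hi hR)) hle,
    condExp_add (hi hB) (hi hR) 𝒟] with ω h1 h2
  rw [h2] at h1
  exact h1

/-- By Markov's inequality, the conditional probabilities of events of vanishing probability tend
to zero in probability. -/
lemma tendsto_condProb_zero {Ω : Type*} {mΩ : MeasurableSpace Ω} {P : Measure Ω}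
    [IsProbabilityMeasure P] {𝒟 : ℕ → MeasurableSpace Ω} (h𝒟 : ∀ n, 𝒟 n ≤ mΩ) {R : ℕ → Set Ω}
    (hR : ∀ n, MeasurableSet (R n)) (h0 : Tendsto (fun n => P (R n)) atTop (𝓝 0)) :
    Tendsto (fun p : ℕ × Ω => (P⟦R p.1 | 𝒟 p.1⟧) p.2) (whp P) (𝓝 0) := by
  have hnn : ∀ n, 0 ≤ᵐ[P] P⟦R n | 𝒟 n⟧ := fun n =>
    condExp_nonneg (Eventually.of_forall fun ω => Set.indicator_nonneg (fun _ _ => zero_le_one) ω)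
  have hnn' : ∀ᶠ p in whp P, 0 ≤ (P⟦R p.1 | 𝒟 p.1⟧) p.2 :=
    eventually_whp_of_ae (Eventually.of_forall fun n => hnn n)
  rw [Metric.tendsto_nhds]
  intro ε hε
  have h1 : ∀ᶠ p in whp P, (P⟦R p.1 | 𝒟 p.1⟧) p.2 < ε := by
    rw [eventually_whp_iff]
    have h2 : Tendsto (fun n => ENNReal.ofReal (ε⁻¹) * P (R n)) atTop (𝓝 0) := by
      have := ENNReal.Tendsto.const_mul (a := ENNReal.ofReal (ε⁻¹)) h0
        (Or.inr ENNReal.ofReal_ne_top)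
      rwa [mul_zero] at this
    refine tendsto_of_tendsto_of_tendsto_of_le_of_le tendsto_const_nhds h2 (fun _ => zero_le)
      fun n => ?_
    have h3 := mul_meas_ge_le_integral_of_nonneg (hnn n) integrable_condExp ε
    rw [← measureReal_eq_integral_condProb (h𝒟 n) (hR n)] at h3
    have h4 : P.real {ω | ε ≤ (P⟦R n | 𝒟 n⟧) ω} ≤ ε⁻¹ * P.real (R n) := by
      rw [inv_mul_eq_div, le_div_iff₀ hε]
      linarith
    simp only [not_lt]
    rw [← ofReal_measureReal (μ := P) (s := R n), ← ENNReal.ofReal_mul (by positivity),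
      ← ofReal_measureReal]
    exact ENNReal.ofReal_le_ofReal h4
  filter_upwards [h1, hnn'] with p h2 h3
  rwa [Real.dist_eq, sub_zero, abs_of_nonneg h3]

/-- The event that the leading term lies in the orthant below `y`, written through the drawn
indices. -/
def leadingEvent {d : ℕ} {Ω 𝓩 : Type*} (m : 𝓩 → Vec d → ℝ) (Z : ℕ → Ω → 𝓩) (π : ℕ → ℕ → Ω → ℝ)
    (s : ℕ → ℕ) (J : (n : ℕ) → Fin (s n) → Ω → ℕ) (θhat : ℕ → Ω → Vec d) (y : Vec d) (n : ℕ) :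
    Set Ω :=
  drawnEvent n (J n) fun k => {ω | ∀ c : Fin d,
    ((√(s n : ℝ))⁻¹ • ∑ j, influence m Z π θhat n (k j) ω : Vec d) c ≤ y c}

namespace SubsamplingModel

variable {d : ℕ} {Ω 𝓩 : Type*} [MeasurableSpace Ω] [MeasurableSpace 𝓩]
  {P : Measure Ω} {μ : Measure 𝓩} {Z : ℕ → Ω → 𝓩} {m : 𝓩 → Vec d → ℝ} {Θ U : Set (Vec d)}
  {θ₀ : Vec d} {ψ : 𝓩 → ℝ} {θhat : ℕ → Ω → Vec d} {π : ℕ → ℕ → Ω → ℝ} {s : ℕ → ℕ}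
  {J : (n : ℕ) → Fin (s n) → Ω → ℕ} {θtilde : ℕ → Ω → Vec d}

lemma measurableSet_sum_influence_le (S : SubsamplingModel P Z m Θ π s J θtilde)
    (M : FullDataModel P μ Z m Θ U θ₀ ψ θhat) (y : Vec d) (n : ℕ) (k : Fin (s n) → Fin n) :
    MeasurableSet[dataSigma Z n] {ω | ∀ c : Fin d,
      ((√(s n : ℝ))⁻¹ • ∑ j, influence m Z π θhat n (k j) ω : Vec d) c ≤ y c} := by
  have h1 : Measurable[dataSigma Z n] fun ω =>
      ((√(s n : ℝ))⁻¹ • ∑ j, influence m Z π θhat n (k j) ω : Vec d) :=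
    (show Measurable[dataSigma Z n] fun ω => ∑ j, influence m Z π θhat n (k j) ω from
      Finset.measurable_sum _ fun j _ => S.measurable_influence M (k j).2).const_smul
        ((√(s n : ℝ))⁻¹)
  exact h1 (measurableSet_orthant y)

lemma measurableSet_leadingEvent (S : SubsamplingModel P Z m Θ π s J θtilde)
    (M : FullDataModel P μ Z m Θ U θ₀ ψ θhat) (y : Vec d) {n : ℕ} (hn : 0 < n) :
    MeasurableSet (leadingEvent m Z π s J θhat y n) :=
  measurableSet_drawnEvent (dataSigma_le M.measurable_data n) (S.subsample n hn).1
    (S.measurableSet_sum_influence_le M y n)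

variable [IsProbabilityMeasure P]

lemma condProb_leadingEvent (S : SubsamplingModel P Z m Θ π s J θtilde)
    (M : FullDataModel P μ Z m Θ U θ₀ ψ θhat) (y : Vec d) {n : ℕ} (hn : 0 < n) :
    P⟦leadingEvent m Z π s J θhat y n | dataSigma Z n⟧ =ᵐ[P] fun ω =>
      (scaledSumLaw (s n) (fun i : Fin n => π n i ω)
        (fun i : Fin n => influence m Z π θhat n i ω)).real {z | ∀ k, z k ≤ y k} := by
  refine (condProb_drawnEvent (dataSigma_le M.measurable_data n) (S.subsample n hn).1
    (S.subsample n hn).2 (S.measurableSet_sum_influence_le M y n)).trans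
    (Eventually.of_forall fun ω => ?_)
  dsimp only
  rw [scaledSumLaw_real_apply (fun i => ((S.distribution n hn).2.1 i i.2 ω).le)
    (measurableSet_orthant y)]
  rfl

lemma ae_mem_leadingEvent_iff (S : SubsamplingModel P Z m Θ π s J θtilde)
    (hZ : ∀ i, Measurable (Z i)) (y : Vec d) {n : ℕ} (hn : 0 < n) :
    ∀ᵐ ω ∂P, ω ∈ leadingEvent m Z π s J θhat y n ↔
      ∀ c, leadingTerm m Z π s J θhat n ω c ≤ y c := by
  filter_upwards [ae_exists_drawn (dataSigma_le hZ n) (S.subsample n hn).1 (S.subsample n hn).2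
    (S.distribution n hn).2.2] with ω ⟨k, hk⟩
  have hW : leadingTerm m Z π s J θhat n ω =
      (√(s n : ℝ))⁻¹ • ∑ j, influence m Z π θhat n (k j) ω := by
    rw [leadingTerm_eq]
    simp only [hk]
  rw [hW]
  constructor
  · intro h
    obtain ⟨k', hk', h'⟩ := Set.mem_iUnion.1 h
    have : k' = k := funext fun j => Fin.ext ((hk' j).symm.trans (hk j))
    rw [this] at h'
    exact h'
  · intro h
    exact Set.mem_iUnion.2 ⟨k, hk, h⟩

variable [IsProbabilityMeasure μ]

/-- The conditional law of the leading term, a normalized sum of independent whitened terms, is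
asymptotically standard normal by Lyapunov's theorem. -/
lemma eventually_abs_scaledSumLaw_sub_le (S : SubsamplingModel P Z m Θ π s J θtilde)
    (M : FullDataModel P μ Z m Θ U θ₀ ψ θhat) (x : Vec d) {η : ℝ} (hη : 0 < η) :
    ∀ᶠ p in whp P, |(scaledSumLaw (s p.1) (fun i : Fin p.1 => π p.1 i p.2)
        (fun i : Fin p.1 => influence m Z π θhat p.1 i p.2)).real {y | ∀ k, y k ≤ x k} -
      (stdGaussian (Vec d)).real {y | ∀ k, y k ≤ x k}| ≤ η := by
  obtain ⟨δ, hδ, hlyap⟩ := exists_lyapunov_bound x hη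
  obtain ⟨X, hX, hXle⟩ := S.exists_eventually_standardizer M
  have hsinv : Tendsto (fun p : ℕ × Ω => ((s p.1 : ℝ))⁻¹) (whp P) (𝓝 0) :=
    tendsto_inv_atTop_zero.comp (tendsto_natCast_atTop_atTop.comp
      (S.tendsto_size.comp tendsto_fst_whp))
  have hfour := ((hX.pow 4).mul ((S.bounded_inv.pow 3).mul M.bounded_grad)).tendsto_mul_zero
    (Y := fun n _ => ((s n : ℝ))⁻¹) hsinv
  filter_upwards [hXle, M.eventually_mean_grad_eq_zero, hsinv.eventually_le_const hδ,
    hfour.eventually_le_const hδ, tendsto_fst_whp.eventually_gt_atTop 0,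
    (S.tendsto_size.comp tendsto_fst_whp).eventually_gt_atTop 0] with p ⟨_, hB, hX0, hBle⟩ hmean
    hsδ h4 hn hs0
  obtain ⟨n, ω⟩ := p
  simp only [Function.comp_apply] at hB hX0 hBle hmean hsδ h4 hn hs0 ⊢
  have hn' : (0 : ℝ) < n := by exact_mod_cast hn
  have hs' : (0 : ℝ) < s n := by exact_mod_cast hs0
  have hπ0 : ∀ i : Fin n, 0 < π n i ω := fun i => (S.distribution n hn).2.1 i i.2 ω
  obtain ⟨K, hK⟩ : ∃ K, K = ⨆ i : Fin n, ((n : ℝ) * π n i ω)⁻¹ := ⟨_, rfl⟩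
  have hKle : ∀ i : Fin n, ((n : ℝ) * π n i ω)⁻¹ ≤ K := fun i => by
    rw [hK]; exact inv_mul_weight_le_iSup π n ω i
  obtain ⟨B, hBdef⟩ : ∃ B, B = standardizer m Z π θhat n ω := ⟨_, rfl⟩
  obtain ⟨g, hg⟩ : ∃ g : Fin n → Vec d, g = fun (i : Fin n) => grad m (Z i ω) (θhat n ω) :=
    ⟨_, rfl⟩
  have hgi : ∀ i : Fin n, grad m (Z i ω) (θhat n ω) = g i := fun i => by rw [hg]
  have hv : ∀ i : Fin n, influence m Z π θhat n i ω =
      -((n : ℝ) * π n i ω)⁻¹ • toEuclideanLin B (g i) := fun i => by rw [influence, hBdef, hg]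
  have hinner : ∀ u : Vec d, inner ℝ u (toEuclideanLin (lambdaR m Z π n ω (θhat n ω)) u) =
      ((n : ℝ) ^ 2)⁻¹ * ∑ i : Fin n, (π n i ω)⁻¹ * inner ℝ (g i) u ^ 2 := fun u => by
    rw [inner_lambdaR, hg]
  simp only [← hBdef, hgi, ← hK] at hB hBle hmean h4
  refine hlyap n (s n) _ _ hs0 (fun i => (hπ0 i).le) ((S.distribution n hn).2.2 ω) ?_ ?_ hsδ ?_
  · have h1 : ∀ i : Fin n, π n i ω • influence m Z π θhat n i ω =
        -(n : ℝ)⁻¹ • toEuclideanLin B (g i) := fun i => by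
      rw [hv, smul_smul]
      congr 1
      have := (hπ0 i).ne'
      field_simp
    simp only [h1]
    rw [← Finset.smul_sum, ← map_sum, hmean, map_zero, smul_zero]
  · intro t
    have h1 : ∀ i : Fin n, π n i ω * inner ℝ (influence m Z π θhat n i ω) t ^ 2 =
        ((n : ℝ) ^ 2)⁻¹ * ((π n i ω)⁻¹ * inner ℝ (g i) (toEuclideanLin Bᵀ t) ^ 2) := fun i => by
      rw [hv, inner_smul_left, inner_toEuclideanLin_transpose]
      have := (hπ0 i).ne'
      simp only [conj_trivial]
      field_simp
    simp only [h1]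
    rw [← Finset.mul_sum, ← hinner]
    have h2 := inner_toEuclideanLin_transpose Bᵀ t
      (toEuclideanLin (lambdaR m Z π n ω (θhat n ω)) (toEuclideanLin Bᵀ t))
    rw [Matrix.transpose_transpose, ← toEuclideanLin_mul_apply, ← toEuclideanLin_mul_apply, hB,
      toEuclideanLin_one_apply, real_inner_self_eq_norm_sq] at h2
    rw [h2]
  -- the Lyapunov sum is at most `X⁴ · max (n π)⁻³` times the mean fourth power of the gradients
  · have h1 : ∀ i : Fin n, π n i ω * ‖influence m Z π θhat n i ω‖ ^ 4 ≤
        X n ω ^ 4 * (K ^ 3 * ((n : ℝ)⁻¹ * ‖g i‖ ^ 4)) := by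
      intro i
      have hp := hπ0 i
      have hq : 0 < ((n : ℝ) * π n i ω)⁻¹ := by positivity
      rw [hv, norm_smul, norm_neg, Real.norm_eq_abs, abs_of_pos hq, mul_pow]
      have h2 : π n i ω * ((((n : ℝ) * π n i ω)⁻¹) ^ 4 * ‖toEuclideanLin B (g i)‖ ^ 4) =
          (n : ℝ)⁻¹ * ((((n : ℝ) * π n i ω)⁻¹) ^ 3 * ‖toEuclideanLin B (g i)‖ ^ 4) := by
        field_simp
      rw [h2]
      have h3 : ‖toEuclideanLin B (g i)‖ ^ 4 ≤ (X n ω * ‖g i‖) ^ 4 :=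
        pow_le_pow_left₀ (norm_nonneg _) (hBle _) 4
      have h5 : (((n : ℝ) * π n i ω)⁻¹) ^ 3 ≤ K ^ 3 := pow_le_pow_left₀ hq.le (hKle i) 3
      have hK0 : 0 ≤ K := hq.le.trans (hKle i)
      have h6 := mul_le_mul h5 h3 (by positivity) (by positivity)
      have h7 := mul_le_mul_of_nonneg_left h6 (by positivity : 0 ≤ (n : ℝ)⁻¹)
      refine h7.trans (le_of_eq ?_)
      ring
    refine (Finset.sum_le_sum fun i _ => h1 i).trans ?_
    rw [← Finset.mul_sum, ← Finset.mul_sum, ← Finset.mul_sum]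
    rwa [inv_mul_le_iff₀ hs', mul_comm (s n : ℝ)] at h4

/-- The theorem for normalized models. The events `Δ ≤ x` are squeezed between the events
`W ≤ x ± δ` for the leading term `W`, up to an event of vanishing probability. -/
theorem tendstoInCondDistribution (S : SubsamplingModel P Z m Θ π s J θtilde)
    (M : FullDataModel P μ Z m Θ U θ₀ ψ θhat) :
    TendstoInCondDistribution P Z (standardizedError m Z π s θhat θtilde)
      (stdGaussian (Vec d)) := by
  intro x
  rw [← tendsto_whp_iff_tendstoInMeasure, Metric.tendsto_nhds]
  intro ε hε
  have hη : 0 < ε / 4 := by positivity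
  obtain ⟨δ, hδ, hup, hlow⟩ := exists_stdGaussian_orthant_shift x hη
  let xup : Vec d := WithLp.toLp 2 fun k => x k + δ
  let xlow : Vec d := WithLp.toLp 2 fun k => x k - δ
  -- the weights `π n i` are known to be measurable only for `i < n`; the measurable hull avoids
  -- the question whether the leading term is measurable
  let R : ℕ → Set Ω := fun n => toMeasurable P {ω | δ ≤ ‖standardizedError m Z π s θhat θtilde n ω -
    leadingTerm m Z π s J θhat n ω‖}
  have hRm : ∀ n, MeasurableSet (R n) := fun n => measurableSet_toMeasurable _ _
  have hR0 : Tendsto (fun n => P (R n)) atTop (𝓝 0) := by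
    have h1 := (S.tendsto_norm_standardizedError_sub M).eventually_lt_const hδ
    rw [eventually_whp_iff] at h1
    simpa only [R, measure_toMeasurable, not_lt] using h1
  have hRc := tendsto_condProb_zero (dataSigma_le M.measurable_data) hRm hR0
  have hclose : ∀ n ω, ω ∉ R n → ∀ c, |standardizedError m Z π s θhat θtilde n ω c -
      leadingTerm m Z π s J θhat n ω c| < δ := by
    intro n ω hω c
    have h1 : ‖standardizedError m Z π s θhat θtilde n ω -
        leadingTerm m Z π s J θhat n ω‖ < δ := by
      by_contra h
      exact hω (subset_toMeasurable _ _ (not_lt.1 h))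
    exact (abs_coord_le_norm _ c).trans_lt h1
  have hae : ∀ᶠ p in whp P,
      (P⟦{ω | ∀ k, standardizedError m Z π s θhat θtilde p.1 ω k ≤ x k} | dataSigma Z p.1⟧) p.2 ≤
        (scaledSumLaw (s p.1) (fun i : Fin p.1 => π p.1 i p.2)
          (fun i : Fin p.1 => influence m Z π θhat p.1 i p.2)).real {y | ∀ k, y k ≤ xup k} +
          (P⟦R p.1 | dataSigma Z p.1⟧) p.2 ∧
      (scaledSumLaw (s p.1) (fun i : Fin p.1 => π p.1 i p.2)
          (fun i : Fin p.1 => influence m Z π θhat p.1 i p.2)).real {y | ∀ k, y k ≤ xlow k} ≤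
        (P⟦{ω | ∀ k, standardizedError m Z π s θhat θtilde p.1 ω k ≤ x k} | dataSigma Z p.1⟧) p.2 +
          (P⟦R p.1 | dataSigma Z p.1⟧) p.2 := by
    refine eventually_whp_of_ae ?_
    filter_upwards [eventually_gt_atTop 0] with n hn
    have hΔ : MeasurableSet {ω | ∀ k, standardizedError m Z π s θhat θtilde n ω k ≤ x k} :=
      S.measurable_standardizedError M hn (measurableSet_orthant x)
    have h1 := condProb_le_add (𝒟 := dataSigma Z n) hΔ (S.measurableSet_leadingEvent M xup hn)
      (hRm n) (by
        filter_upwards [S.ae_mem_leadingEvent_iff (m := m) (θhat := θhat) M.measurable_data xup hn]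
          with ω hω hx hR
        refine hω.2 fun c => ?_
        have h1 := (abs_lt.1 (hclose n ω hR c)).1
        have h2 := hx c
        simp only [xup]
        linarith)
    have h2 := condProb_le_add (𝒟 := dataSigma Z n) (S.measurableSet_leadingEvent M xlow hn) hΔ
      (hRm n) (by
        filter_upwards [S.ae_mem_leadingEvent_iff (m := m) (θhat := θhat) M.measurable_data xlow hn]
          with ω hω hx hR c
        have h1 := (abs_lt.1 (hclose n ω hR c)).2
        have h2 := hω.1 hx c
        simp only [xlow] at h2
        linarith)
    filter_upwards [h1, h2, S.condProb_leadingEvent M xup hn, S.condProb_leadingEvent M xlow hn]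
      with ω h3 h4 h5 h6
    rw [h5] at h3
    rw [h6] at h4
    exact ⟨h3, h4⟩
  filter_upwards [hae, S.eventually_abs_scaledSumLaw_sub_le M xup hη,
    S.eventually_abs_scaledSumLaw_sub_le M xlow hη, hRc.eventually_lt_const hη] with p ⟨h1, h2⟩
    h3 h4 h5
  have h6 := (abs_le.1 h3).2
  have h7 := (abs_le.1 h4).1
  simp only [xup] at h1 h6
  simp only [xlow] at h2 h7
  rw [Real.dist_eq, abs_lt]
  constructor <;> linarith

end SubsamplingModel

end ConditionalLimit

end Subsampling

theorem theorem1 {d : ℕ} {Ω 𝓩 : Type*} [MeasurableSpace Ω] [MeasurableSpace 𝓩]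
    (P : Measure Ω) [IsProbabilityMeasure P] (μ : Measure 𝓩)
    -- the data: independent observations with common law `μ`
    (Z : ℕ → Ω → 𝓩) (hZ_meas : ∀ i, Measurable (Z i)) (hZ_law : ∀ i, P.map (Z i) = μ)
    (hZ_indep : iIndepFun Z P)
    -- the criterion function, smooth on an open set containing the parameter set
    (m : 𝓩 → Vec d → ℝ) (Θ U : Set (Vec d)) (hU : IsOpen U) (hΘU : Θ ⊆ U)
    (hm_meas : ∀ θ ∈ U, Measurable fun z => m z θ)
    (hm_smooth : ∀ z, ContDiffOn ℝ 2 (m z) U)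
    -- the parameter set is compact
    (hΘ : IsCompact Θ)
    -- concavity, a unique maximum in the interior, finite second moments
    (hm_concave : ∀ z, ConcaveOn ℝ Θ (m z))
    (hm_sq : ∀ θ ∈ Θ, MemLp (fun z => m z θ) 2 μ)
    (θ₀ : Vec d) (hθ₀ : IsUniqueArgmax (popObjective μ m) Θ θ₀) (hθ₀_int : θ₀ ∈ interior Θ)
    -- the Hessian
    (hH_pd : (-popHess μ m θ₀).PosDef)
    (hH_sq : ∀ θ ∈ Θ, ∀ k l, MemLp (fun z => hess m z θ k l) 2 μ)
    (ψ : 𝓩 → ℝ) (hψ : MemLp ψ 2 μ)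
    (hH_lip : ∀ z, ∀ θ₁ ∈ Θ, ∀ θ₂ ∈ Θ, ∀ k l,
      |hess m z θ₁ k l - hess m z θ₂ k l| ≤ ψ z * ‖θ₁ - θ₂‖)
    -- the full-data estimator
    (θhat : ℕ → Ω → Vec d) (hθhat_meas : ∀ n, Measurable[dataSigma Z n] (θhat n))
    (hθhat : ∀ n, ∀ᵐ ω ∂P, IsArgmax (fullObjective m Z n ω) Θ (θhat n ω))
    -- the gradient
    (hg_sq : MemLp (fun z => grad m z θ₀) 2 μ)
    (hΛ_pd : (popLambda μ m θ₀).PosDef)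
    (hg_four : BoundedInProb P fun n ω =>
      (n : ℝ)⁻¹ * ∑ i : Fin n, ‖grad m (Z i ω) (θhat n ω)‖ ^ 4)
    -- the subsampling distribution
    (π : ℕ → ℕ → Ω → ℝ) (hπ : IsSubsamplingDistribution Z π)
    (hπ_bdd : BoundedInProb P fun n ω => ⨆ i : Fin n, ((n : ℝ) * π n i ω)⁻¹)
    -- the subsample and the weighted subsample estimator
    (s : ℕ → ℕ) (hs : Tendsto s atTop atTop)
    (J : (n : ℕ) → Fin (s n) → Ω → ℕ) (hJ : IsSubsampleWithReplacement P Z π s J)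
    (θtilde : ℕ → Ω → Vec d) (hθtilde_meas : ∀ n, Measurable (θtilde n))
    (hθtilde : ∀ n, ∀ᵐ ω ∂P, IsArgmax (subObjective m Z π s J n ω) Θ (θtilde n ω)) :
    TendstoInCondDistribution P Z (standardizedError m Z π s θhat θtilde)
      (stdGaussian (Vec d)) := by
  classical
  have : IsProbabilityMeasure μ := by
    rw [← hZ_law 0]
    exact Measure.isProbabilityMeasure_map (hZ_meas 0).aemeasurable
  have hne : Nonempty 𝓩 := by
    by_contra h
    rw [not_nonempty_iff] at h
    have h1 : μ Set.univ = 1 := measure_univ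
    rw [Set.univ_eq_empty_iff.2 h, measure_empty] at h1
    exact zero_ne_one h1
  obtain ⟨z₀⟩ := hne
  -- the estimator is changed on a null set so that all its values lie in `Θ`
  let θhat' : ℕ → Ω → Vec d := fun n ω => if θhat n ω ∈ Θ then θhat n ω else θ₀
  have heq : ∀ᵐ ω ∂P, ∀ n, θhat' n ω = θhat n ω := by
    rw [ae_all_iff]
    intro n
    filter_upwards [hθhat n] with ω hω
    exact if_pos hω.1
  let ψ' : 𝓩 → ℝ := fun z => |hψ.1.mk ψ z|
  have hψ'm : Measurable ψ' := hψ.1.stronglyMeasurable_mk.measurable.abs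
  have hψ' : MemLp ψ' 2 μ := ((memLp_congr_ae hψ.1.ae_eq_mk).1 hψ).norm
  have M : FullDataModel P μ Z m Θ U θ₀ ψ' θhat' :=
    { measurable_data := hZ_meas
      law_data := hZ_law
      indep_data := hZ_indep
      isOpen := hU
      subset := hΘU
      measurable_criterion := hm_meas
      smooth := hm_smooth
      isCompact := hΘ
      convex := (hm_concave z₀).1
      concave := hm_concave
      integrable_criterion := fun θ hθ => (hm_sq θ hθ).integrable (by norm_num)
      popObjective_le := fun θ hθ => by
        rcases eq_or_ne θ θ₀ with rfl | h
        · exact le_rfl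
        · exact (hθ₀.2 θ hθ h).le
      mem_interior := hθ₀_int
      posDef_hess := hH_pd
      memLp_hess := hH_sq θ₀ hθ₀.1
      measurable_psi := hψ'm
      psi_nonneg := fun _ => abs_nonneg _
      memLp_psi := hψ'
      lipschitz_hess := by
        filter_upwards [hψ.1.ae_eq_mk] with z hz θ₁ h₁ θ₂ h₂ k l
        refine (hH_lip z θ₁ h₁ θ₂ h₂ k l).trans ?_
        rw [hz]
        exact mul_le_mul_of_nonneg_right (le_abs_self _) (norm_nonneg _)
      measurable_estimator := fun n =>
        Measurable.ite (hθhat_meas n hΘ.isClosed.measurableSet) (hθhat_meas n) measurable_const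
      estimator_mem := fun n ω => by
        by_cases h : θhat n ω ∈ Θ
        · simp only [θhat', if_pos h]
          exact h
        · simp only [θhat', if_neg h]
          exact hθ₀.1
      argmax_estimator := fun n => by
        filter_upwards [hθhat n, heq] with ω h1 h2
        rw [h2 n]
        exact h1
      memLp_grad := hg_sq
      posDef_lambda := hΛ_pd
      bounded_grad := by
        refine hg_four.mono (eventually_whp_of_ae (Eventually.of_forall fun n => ?_))
        filter_upwards [heq] with ω hω
        simp only [hω n, le_refl] }
  have S : SubsamplingModel P Z m Θ π s J θtilde :=
    { distribution := hπ
      bounded_inv := hπ_bdd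
      tendsto_size := hs
      subsample := hJ
      measurable_estimator := hθtilde_meas
      argmax_estimator := hθtilde }
  intro x
  refine (S.tendstoInCondDistribution M x).congr_left fun n => condExp_congr_ae ?_
  filter_upwards [heq] with ω hω
  refine Set.indicator_const_eq_indicator_const ?_
  simp only [Set.mem_ofPred_eq, standardizedError, hω n]
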